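/- For $\delta>0$ and $A\subset\mathbb{R}$ let $\mathcal N_\delta(A)=\{x\in\mathbb R:\operatorname{dist}(x,A)\le\delta\}$. For a finite Borel measure $\mu$ on $\mathbb{R}$ let $\hat\mu(\xi)=\int e^{-2\pi i x\xi}\,d\mu(x)$. The Fourier dimension of $E\subset\mathbb{R}$ is $$\dim_{\mathcal F}E=\sup\{t\le 1:\ \exists\,\mu\neq 0 \text{ finite Borel, supported on a compact subset of } E,\ \exists\, C,\ |\hat\mu(\xi)|\le C|\xi|^{-t/2}\ \ \forall\,\xi\neq 0\}.$$ Let $\beta,\gamma\ge 0$ with $2\gamma+\beta\le 1$ and $\gamma+\beta<1$ (that is, $(\gamma,\beta)\ne(0,1)$). Then there is an increasing sequence $(q_i)_{i\ge 1}$ in $(1,\infty)$ with $q_{i+1}>q_i^{10i}$ for all $i$ such that the set $$E:=\begin{cases}\displaystyle\bigcap_i\ \bigcup_{1\le H\le q_i^\gamma}\mathcal N_{q_i^{-1}}\Big(\frac{\mathbb Z}{Hq_i^{\beta}}\Big), & 2\gamma+\beta<1,\\[2ex] \displaystyle\bigcap_i\ \bigcup_{H\le q_i^\gamma,\ H\text{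 prime}}\mathcal N_{q_i^{-1}}\Big(\frac{\mathbb Z}{Hq_i^{\beta}}\Big), & 2\gamma+\beta=1,\end{cases}$$ ($H$ ranging over integers) has Hausdorff dimension $2\gamma+\beta$ and Fourier dimension $2\gamma$. Moreover, for the same sequence there is a nonzero finite Borel measure $\mu$ supported on $E\cap[0,1]$, and if $\gamma>0$ even supported on $$\bigcap_i\ \bigcup_{q_i^\gamma/2\le p\le q_i^\gamma,\ p\text{ prime}}\mathcal N_{q_i^{-1}}\Big(\frac{\mathbb Z\setminus p\mathbb Z}{pq_i^{\beta}}\Big)\cap[0,1],$$ such that for every $\epsilon>0$ there is a constant $C_\epsilon$ with $$\mu([x-r,x+r])\le C_\epsilon\, r^{2\gamma+\beta-\epsilon}\quad(x\in\mathbb R,\ 0<r\le 1),\qquad |\hat\mu(\xi)|\le C_\epsilon\,|\xi|^{-\gamma+\epsilon}\quad(|\xi|\ge 1).$$ -/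

import Mathlib

open MeasureTheory

/-- The Fourier transform `ξ ↦ ∫ e^{-2πixξ} dμ(x)` of a measure on the line. -/
noncomputable def measureFourier (μ : Measure ℝ) (ξ : ℝ) : ℂ :=
  ∫ x : ℝ, Complex.exp (-2 * Real.pi * Complex.I * (x : ℂ) * (ξ : ℂ)) ∂μ

/-- `μ` is a nonzero finite Borel measure supported on a compact subset of `E`. -/
def IsCompactlySupportedMeasureOn (μ : Measure ℝ) (E : Set ℝ) : Prop :=
  IsFiniteMeasure μ ∧ μ ≠ 0 ∧ ∃ K : Set ℝ, IsCompact K ∧ K ⊆ E ∧ μ Kᶜ = 0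

/-- The Fourier dimension of a subset of the line. For nonempty `E` the set on the right
contains `0`, and it always lies in `[0, 1]`. -/
noncomputable def fourierDim (E : Set ℝ) : ℝ :=
  sSup {t : ℝ | t ≤ 1 ∧ ∃ μ : Measure ℝ, IsCompactlySupportedMeasureOn μ E ∧
    ∃ C : ℝ, ∀ ξ : ℝ, ξ ≠ 0 → ‖measureFourier μ ξ‖ ≤ C * |ξ| ^ (-t / 2)}

/-- The closed `δ`-neighbourhood of `S / c`, for a set `S` of integers. -/
def progressionNhd (δ c : ℝ) (S : Set ℤ) : Set ℝ :=
  Metric.cthickening δ ((fun m : ℤ => (m : ℝ) / c) '' S)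

/-- `⋂ i, ⋃ 1 ≤ H ≤ q_i^γ, N_{1/q_i}(ℤ / (H q_i^β))`. -/
noncomputable def integerConstruction (q : ℕ → ℝ) (γ β : ℝ) : Set ℝ :=
  ⋂ i : ℕ, ⋃ H ∈ {H : ℕ | 1 ≤ H ∧ (H : ℝ) ≤ q i ^ γ},
    progressionNhd (q i)⁻¹ ((H : ℝ) * q i ^ β) Set.univ

/-- `⋂ i, ⋃ H ≤ q_i^γ prime, N_{1/q_i}(ℤ / (H q_i^β))`. -/
noncomputable def primeConstruction (q : ℕ → ℝ) (γ β : ℝ) : Set ℝ :=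
  ⋂ i : ℕ, ⋃ H ∈ {H : ℕ | H.Prime ∧ (H : ℝ) ≤ q i ^ γ},
    progressionNhd (q i)⁻¹ ((H : ℝ) * q i ^ β) Set.univ

/-- The set `E`: all denominators if `2γ + β < 1`, prime denominators in the endpoint case. -/
noncomputable def approxSet (q : ℕ → ℝ) (γ β : ℝ) : Set ℝ :=
  if 2 * γ + β < 1 then integerConstruction q γ β else primeConstruction q γ β

/-- `⋂ i, ⋃ q_i^γ/2 ≤ p ≤ q_i^γ prime, N_{1/q_i}((ℤ \ pℤ) / (p q_i^β)) ∩ [0, 1]`. -/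
noncomputable def reducedPrimeConstruction (q : ℕ → ℝ) (γ β : ℝ) : Set ℝ :=
  (⋂ i : ℕ, ⋃ p ∈ {p : ℕ | p.Prime ∧ q i ^ γ / 2 ≤ (p : ℝ) ∧ (p : ℝ) ≤ q i ^ γ},
    progressionNhd (q i)⁻¹ ((p : ℝ) * q i ^ β) {m : ℤ | ¬ (p : ℤ) ∣ m}) ∩ Set.Icc 0 1

/-!
Let `F_q` be the density of the reduced fractions `m / (p q ^ β)`, `p` prime of size about `q ^ γ`
(only `p = 1` if `γ = 0`), mollified at scale `1 / q`. By Poisson summation its Fourier coefficients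
live on `q ^ β ℤ` and are averages over `p` of the normalised Ramanujan sums `c_p(k) / φ(p)`. For
`k ≠ 0` such an average is `O(q ^ (-γ + ε))`, because only few of the primes `p` divide `k`. If `q`
is huge compared with the scale on which a density `g` varies, then multiplying `g` by `F_q` changes
`ĝ(ξ)` by a small multiple of `|ξ| ^ (-γ + ε)`, so the products of the `F_q` over a sufficiently
lacunary sequence of scales have a weak limit with Fourier decay of exponent `γ - ε`. Distinct
reduced fractions in `F_q` are at least `q ^ (-2γ-β) ≥ q⁻¹` apart, and counting them in intervals
gives the Frostman condition of exponent `2γ + β - ε`; here the scales are chosen such that there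
are at least `q ^ (γ - ε)` primes available.

The Hausdorff dimension is bounded above by covering each stage with about `q ^ (2γ+β)` intervals of
length `2 / q`. For the Fourier dimension, suppose the Fourier transform of `μ` is `O(|ξ| ^ (-a))`
with `a > γ`. Poisson summation against a bump of width `1 / q` bounds the `μ`-mass within `1 / q`
of `ℤ / (H q ^ β)` by `O(q ^ (γ+β-1)) μ(ℝ) + o(q ^ (-γ))`, and the sum over the at most `q ^ γ`
values of `H` tends to `0`, so `μ = 0`; if `2γ + β = 1`, the first term needs the density zero of
the primes.
-/

open Filter Set
open scoped FourierTransform ContDiff SchwartzMap Topology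

/-! ### Fourier transforms and Poisson summation -/

theorem fourier_comp_mul_sub (f : ℝ → ℂ) {q : ℝ} (hq : 0 < q) (x ξ : ℝ) :
    𝓕 (fun t => f (q * (t - x))) ξ =
      Complex.exp (↑(-2 * Real.pi * x * ξ) * Complex.I) * ((q⁻¹ : ℝ) * 𝓕 f (ξ / q)) := by
  simp only [Real.fourier_real_eq_integral_exp_smul, smul_eq_mul]
  set F : ℝ → ℂ := fun t => Complex.exp (↑(-2 * Real.pi * t * (ξ / q)) * Complex.I) * f t
  calc ∫ t, Complex.exp (↑(-2 * Real.pi * t * ξ) * Complex.I) * f (q * (t - x))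
      = ∫ t, Complex.exp (↑(-2 * Real.pi * x * ξ) * Complex.I) * F (q * (t - x)) := by
        congr 1 with t
        simp only [F]
        rw [← mul_assoc, ← Complex.exp_add, ← add_mul, ← Complex.ofReal_add]
        congr 4
        field_simp
        ring
    _ = Complex.exp (↑(-2 * Real.pi * x * ξ) * Complex.I) * ∫ t, F (q * t) := by
        rw [integral_const_mul, integral_sub_right_eq_self (fun t => F (q * t))]
    _ = _ := by
        rw [Measure.integral_comp_mul_left, abs_of_pos (inv_pos.2 hq), Complex.real_smul]

theorem fourier_exp_mul (f : ℝ → ℂ) (ξ η : ℝ) :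
    𝓕 (fun x : ℝ => Complex.exp (↑(-2 * Real.pi * x * ξ) * Complex.I) * f x) η = 𝓕 f (ξ + η) := by
  simp only [Real.fourier_real_eq_integral_exp_smul, smul_eq_mul, ← mul_assoc, ← Complex.exp_add]
  congr 1 with x
  congr 2
  push_cast
  ring

theorem exists_schwartz_norm_le {E F : Type*} [NormedAddCommGroup E] [NormedSpace ℝ E]
    [NormedAddCommGroup F] [NormedSpace ℝ F] (f : 𝓢(E, F)) (N : ℕ) :
    ∃ C : ℝ, 0 < C ∧ ∀ x, ‖f x‖ ≤ C * ((1 + ‖x‖) ^ N)⁻¹ := by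
  set D := 2 ^ N * (Finset.Iic (N, 0)).sup (fun m => SchwartzMap.seminorm ℝ m.1 m.2) f
  refine ⟨max D 1, by positivity, fun x => ?_⟩
  have hD : (1 + ‖x‖) ^ N * ‖iteratedFDeriv ℝ 0 f x‖ ≤ D :=
    SchwartzMap.one_add_le_sup_seminorm_apply (𝕜 := ℝ) (m := (N, 0)) le_rfl le_rfl f x
  rw [norm_iteratedFDeriv_zero] at hD
  rw [← div_eq_mul_inv, le_div_iff₀ (by positivity), mul_comm]
  exact hD.trans (le_max_left _ _)

theorem exists_norm_fourier_le {f : ℝ → ℂ} (hf : ContDiff ℝ ∞ f) (hc : HasCompactSupport f)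
    (N : ℕ) : ∃ C : ℝ, 0 < C ∧ ∀ ξ : ℝ, ‖𝓕 f ξ‖ ≤ C * ((1 + |ξ|) ^ N)⁻¹ :=
  exists_schwartz_norm_le (𝓕 (hc.toSchwartzMap hf)) N

/-- The Schwartz function `t ↦ f (q (t - x))`. -/
noncomputable def rescale {F : Type*} [NormedAddCommGroup F] [NormedSpace ℝ F] (f : 𝓢(ℝ, F))
    {q : ℝ} (hq : q ≠ 0) (x : ℝ) : 𝓢(ℝ, F) :=
  (f.compCLMOfContinuousLinearEquiv ℝ
    (ContinuousLinearEquiv.unitsEquivAut ℝ (Units.mk0 q hq))).compSubConstCLM ℝ x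

theorem rescale_apply {F : Type*} [NormedAddCommGroup F] [NormedSpace ℝ F] (f : 𝓢(ℝ, F))
    {q : ℝ} (hq : q ≠ 0) (x t : ℝ) : rescale f hq x t = f (q * (t - x)) :=
  congrArg f (mul_comm _ _)

theorem fourier_rescale (f : 𝓢(ℝ, ℂ)) {q : ℝ} (hq : 0 < q) (x ξ : ℝ) :
    𝓕 (rescale f hq.ne' x) ξ =
      Complex.exp (↑(-2 * Real.pi * x * ξ) * Complex.I) * ((q⁻¹ : ℝ) * 𝓕 f (ξ / q)) := by
  rw [SchwartzMap.fourier_coe, SchwartzMap.fourier_coe, ← fourier_comp_mul_sub f hq,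
    funext (rescale_apply f hq.ne' x)]

theorem summable_schwartz_int_mul {F : Type*} [NormedAddCommGroup F] [NormedSpace ℝ F]
    [CompleteSpace F] (f : 𝓢(ℝ, F)) {c : ℝ} (hc : c ≠ 0) : Summable fun k : ℤ => f (k * c) := by
  refine (summable_of_isBigO (Real.summable_abs_int_rpow one_lt_two)
    (((rescale f hc 0).isBigO_cocompact_rpow (-2)).comp_tendsto
      Int.tendsto_coe_cofinite)).congr fun k => ?_
  simp [rescale_apply, mul_comm]

theorem tsum_int_div_eq_tsum_fourier (f : 𝓢(ℝ, ℂ)) {c : ℝ} (hc : 0 < c) :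
    ∑' m : ℤ, f (m / c) = c * ∑' k : ℤ, 𝓕 f (k * c) := by
  have hpoisson := (rescale f (inv_pos.2 hc).ne' 0).tsum_eq_tsum_fourier 0
  simpa [fourier_rescale f (inv_pos.2 hc), rescale_apply, tsum_mul_left, div_eq_inv_mul,
    mul_comm c] using hpoisson

theorem tsum_ite_dvd {E : Type*} [AddCommMonoid E] [TopologicalSpace E] (f : ℤ → E) {p : ℤ}
    (hp : p ≠ 0) : ∑' m : ℤ, (if p ∣ m then f m else 0) = ∑' k : ℤ, f (p * k) := by
  rw [← (mul_right_injective₀ hp).tsum_eq]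
  · simp
  · rintro m hm
    simp only [Function.mem_support, ne_eq, ite_eq_right_iff, Classical.not_imp] at hm
    exact hm.1.imp fun k hk => hk.symm

/-- The normalised Ramanujan sum `c_p(k) / φ(p)` for `p` prime or `p = 1`; at `p = 1` the
divisibility holds, so the junk value `0⁻¹` never occurs. -/
noncomputable def ramanujanCoeff (p : ℕ) (k : ℤ) : ℝ :=
  if (p : ℤ) ∣ k then 1 else -((p : ℝ) - 1)⁻¹

theorem abs_ramanujanCoeff_le_one {p : ℕ} (hp : p ≠ 0) (k : ℤ) :
    |ramanujanCoeff p k| ≤ 1 := by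
  unfold ramanujanCoeff
  split_ifs with h
  · exact abs_one.le
  · have hp2 : 2 ≤ p := by
      rcases p with - | - | p
      · exact absurd rfl hp
      · exact (h ((Int.natCast_one).symm ▸ one_dvd k)).elim
      · omega
    have hp2' : (2 : ℝ) ≤ p := by exact_mod_cast hp2
    rw [abs_neg, abs_inv, abs_of_nonneg (by linarith)]
    exact inv_le_one_of_one_le₀ (by linarith)

theorem int_gcd_eq_one_iff_of_prime {p : ℕ} (hp : p.Prime) (m : ℤ) :
    Int.gcd m p = 1 ↔ ¬ (p : ℤ) ∣ m := by
  rw [← Int.isCoprime_iff_gcd_eq_one, isCoprime_comm,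
    (Nat.prime_iff_prime_int.1 hp).coprime_iff_not_dvd]

theorem summable_ramanujanCoeff_mul {p : ℕ} (hp : p ≠ 0) {f : ℤ → ℂ} (hf : Summable f) :
    Summable fun k => (ramanujanCoeff p k : ℂ) * f k := by
  refine .of_norm_bounded hf.norm fun k => ?_
  rw [norm_mul, Complex.norm_real]
  exact mul_le_of_le_one_left (norm_nonneg _) (abs_ramanujanCoeff_le_one hp k)

theorem tsum_not_dvd_eq_tsum_fourier (f : 𝓢(ℝ, ℂ)) {Q : ℝ} (hQ : 0 < Q) {p : ℕ} (hp : 0 < p) :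
    ∑' m : ℤ, (if (p : ℤ) ∣ m then 0 else f (m / (p * Q))) =
      (p * Q : ℝ) * ∑' k : ℤ, (if (p : ℤ) ∣ k then 𝓕 f (k * Q) else 0) -
        Q * ∑' k : ℤ, 𝓕 f (k * Q) := by
  have hp0 : (0 : ℝ) < p := by exact_mod_cast hp
  have hpQ : 0 < p * Q := by positivity
  have hpZ : (p : ℤ) ≠ 0 := by exact_mod_cast hp.ne'
  have hall : Summable fun m : ℤ => f (m / (p * Q)) := by
    simpa only [div_eq_mul_inv] using summable_schwartz_int_mul f (inv_ne_zero hpQ.ne')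
  have hdvd : Summable fun m : ℤ => if (p : ℤ) ∣ m then f (m / (p * Q)) else 0 :=
    .of_norm_bounded hall.norm fun m => by split_ifs <;> simp
  have hmultiples : ∑' m : ℤ, (if (p : ℤ) ∣ m then f (m / (p * Q)) else 0) =
      Q * ∑' k : ℤ, 𝓕 f (k * Q) := by
    rw [tsum_ite_dvd (fun m : ℤ => f (m / (p * Q))) hpZ, ← tsum_int_div_eq_tsum_fourier f hQ]
    refine tsum_congr fun k => ?_
    rw [Int.cast_mul, Int.cast_natCast, mul_div_mul_left _ _ hp0.ne']
  have hfrequencies : ∑' k : ℤ, (if (p : ℤ) ∣ k then 𝓕 f (k * Q) else 0) =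
      ∑' k : ℤ, 𝓕 f (k * (p * Q)) := by
    rw [tsum_ite_dvd (fun m : ℤ => 𝓕 f (m * Q)) hpZ]
    refine tsum_congr fun k => ?_
    rw [Int.cast_mul, Int.cast_natCast, mul_comm (p : ℝ), mul_assoc]
  rw [← hmultiples, hfrequencies, ← tsum_int_div_eq_tsum_fourier f hpQ, ← hall.tsum_sub hdvd]
  refine tsum_congr fun m => ?_
  split_ifs <;> simp

theorem tsum_coprime_eq_tsum_fourier (f : 𝓢(ℝ, ℂ)) {Q : ℝ} (hQ : 0 < Q) {p : ℕ}
    (hp : p = 1 ∨ p.Prime) :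
    ∑' m : ℤ, (if Int.gcd m p = 1 then f (m / (p * Q)) else 0) =
      (p.totient * Q : ℝ) * ∑' k : ℤ, (ramanujanCoeff p k : ℂ) * 𝓕 f (k * Q) := by
  rcases hp with rfl | hp
  · simp [ramanujanCoeff, tsum_int_div_eq_tsum_fourier f hQ]
  have hF : Summable fun k : ℤ => 𝓕 f (k * Q) := summable_schwartz_int_mul (𝓕 f) hQ.ne'
  have hFdvd : Summable fun k : ℤ => if (p : ℤ) ∣ k then 𝓕 f (k * Q) else 0 :=
    .of_norm_bounded hF.norm fun k => by split_ifs <;> simp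
  simp only [int_gcd_eq_one_iff_of_prime hp, ite_not]
  rw [tsum_not_dvd_eq_tsum_fourier f hQ hp.pos, ← tsum_mul_left, ← tsum_mul_left, ← tsum_mul_left,
    ← (hFdvd.mul_left _).tsum_sub (hF.mul_left _)]
  refine tsum_congr fun k => ?_
  have hp1 : (p : ℂ) - 1 ≠ 0 := sub_ne_zero.2 (by exact_mod_cast hp.one_lt.ne')
  rw [Nat.totient_prime hp, Nat.cast_sub hp.one_lt.le, ramanujanCoeff]
  split_ifs
  · push_cast
    ring
  · push_cast
    field_simp
    ring

/-! ### Mollified reduced fractions -/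

/-- A fixed even smooth probability density supported in `[-1, 1]`. -/
noncomputable def mollifier : ℝ → ℝ :=
  (⟨1 / 2, 1, by norm_num, by norm_num⟩ : ContDiffBump (0 : ℝ)).normed volume

theorem mollifier_contDiff : ContDiff ℝ ∞ mollifier := ContDiffBump.contDiff_normed _

theorem mollifier_nonneg (x : ℝ) : 0 ≤ mollifier x := ContDiffBump.nonneg_normed _ x

theorem mollifier_neg (x : ℝ) : mollifier (-x) = mollifier x := ContDiffBump.normed_neg _ x

theorem mollifier_hasCompactSupport : HasCompactSupport mollifier :=
  ContDiffBump.hasCompactSupport_normed _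

theorem integral_mollifier : ∫ x, mollifier x = 1 := ContDiffBump.integral_normed _

theorem mollifier_eq_zero {x : ℝ} (hx : 1 ≤ |x|) : mollifier x = 0 := by
  rw [← Function.notMem_support, mollifier, ContDiffBump.support_normed_eq, mem_ball_zero_iff]
  exact hx.not_gt

theorem exists_mollifier_le : ∃ A : ℝ, 1 ≤ A ∧ ∀ x, mollifier x ≤ A := by
  obtain ⟨A, hA⟩ := mollifier_contDiff.continuous.bounded_above_of_compact_support
    mollifier_hasCompactSupport
  exact ⟨max A 1, le_max_right _ _, fun x => (le_abs_self _).trans ((hA x).trans (le_max_left _ _))⟩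

/-- The Fourier transform of the mollifier. -/
noncomputable def mollifierHat (ξ : ℝ) : ℂ := 𝓕 (fun x => (mollifier x : ℂ)) ξ

theorem norm_mollifierHat_le_one (ξ : ℝ) : ‖mollifierHat ξ‖ ≤ 1 := by
  refine (VectorFourier.norm_fourierIntegral_le_integral_norm _ _ _ _ _).trans ?_
  simp_rw [Complex.norm_real, Real.norm_of_nonneg (mollifier_nonneg _)]
  exact integral_mollifier.le

theorem mollifierHat_zero : mollifierHat 0 = 1 := by
  simp [mollifierHat, Real.fourier_real_eq_integral_exp_smul, integral_complex_ofReal,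
    integral_mollifier]

theorem exists_mollifierHat_le (N : ℕ) :
    ∃ C : ℝ, 0 < C ∧ ∀ ξ : ℝ, ‖mollifierHat ξ‖ ≤ C * ((1 + |ξ|) ^ N)⁻¹ :=
  exists_norm_fourier_le (Complex.ofRealCLM.contDiff.comp mollifier_contDiff)
    (mollifier_hasCompactSupport.comp_left Complex.ofReal_zero) N

/-- The `L¹`-normalised rescaling of the mollifier to width `1 / q`. -/
noncomputable def scaledMollifier (q x : ℝ) : ℝ := q * mollifier (q * x)

theorem scaledMollifier_contDiff (q : ℝ) : ContDiff ℝ ∞ (scaledMollifier q) :=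
  contDiff_const.mul (mollifier_contDiff.comp (contDiff_const.mul contDiff_id))

theorem scaledMollifier_nonneg {q : ℝ} (hq : 0 < q) (x : ℝ) : 0 ≤ scaledMollifier q x :=
  mul_nonneg hq.le (mollifier_nonneg _)

theorem scaledMollifier_neg (q x : ℝ) : scaledMollifier q (-x) = scaledMollifier q x := by
  simp only [scaledMollifier, mul_neg, mollifier_neg]

theorem scaledMollifier_eq_zero {q x : ℝ} (hq : 0 < q) (hx : q⁻¹ ≤ |x|) :
    scaledMollifier q x = 0 := by
  rw [scaledMollifier, mollifier_eq_zero, mul_zero]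
  rwa [abs_mul, abs_of_pos hq, ← div_le_iff₀' hq, one_div]

theorem scaledMollifier_hasCompactSupport {q : ℝ} (hq : 0 < q) :
    HasCompactSupport (scaledMollifier q) :=
  (mollifier_hasCompactSupport.comp_homeomorph (Homeomorph.mulLeft₀ q hq.ne')).mul_left

theorem integral_scaledMollifier {q : ℝ} (hq : 0 < q) : ∫ x, scaledMollifier q x = 1 := by
  simp only [scaledMollifier]
  rw [integral_const_mul, Measure.integral_comp_mul_left mollifier q, integral_mollifier,
    abs_of_pos (inv_pos.2 hq), smul_eq_mul, mul_one, mul_inv_cancel₀ (ne_of_gt hq)]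

theorem fourier_scaledMollifier {q : ℝ} (hq : 0 < q) (ξ : ℝ) :
    𝓕 (fun x => (scaledMollifier q x : ℂ)) ξ = mollifierHat (ξ / q) := by
  have hfun : (fun x => (scaledMollifier q x : ℂ)) =
      (q : ℂ) • fun x => (mollifier (q * (x - 0)) : ℂ) := by
    ext x
    simp [scaledMollifier]
  have hscale := fourier_comp_mul_sub (fun x => (mollifier x : ℂ)) hq 0 ξ
  rw [Real.fourier_real_eq_integral_exp_smul] at hscale
  rw [hfun, Real.fourier_real_eq_integral_exp_smul]
  simp only [Pi.smul_apply, smul_comm _ (q : ℂ), integral_smul]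
  rw [hscale]
  simp [mollifierHat, hq.ne']

/-- The average of `f` around `t` at scale `1 / q`. -/
noncomputable def mollify (f : ℝ → ℂ) (q t : ℝ) : ℂ := ∫ x, f x * scaledMollifier q (x - t)

theorem mollify_eq_convolution (f : ℝ → ℂ) (q : ℝ) :
    mollify f q = convolution f (fun x => (scaledMollifier q x : ℂ))
      (ContinuousLinearMap.mul ℂ ℂ) volume := by
  ext t
  rw [mollify, convolution_def]
  congr 1 with x
  rw [← neg_sub, scaledMollifier_neg, ContinuousLinearMap.mul_apply']

section Mollify

variable {f : ℝ → ℂ} {q : ℝ}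

theorem mollify_contDiff (hf : Continuous f) (hq : 0 < q) : ContDiff ℝ ∞ (mollify f q) := by
  rw [mollify_eq_convolution]
  exact HasCompactSupport.contDiff_convolution_right (ContinuousLinearMap.mul ℝ ℂ)
    ((scaledMollifier_hasCompactSupport hq).comp_left Complex.ofReal_zero) hf.locallyIntegrable
    (Complex.ofRealCLM.contDiff.comp (scaledMollifier_contDiff q))

theorem mollify_hasCompactSupport (hc : HasCompactSupport f) (hq : 0 < q) :
    HasCompactSupport (mollify f q) := by
  rw [mollify_eq_convolution]
  exact hc.convolution _ ((scaledMollifier_hasCompactSupport hq).comp_left Complex.ofReal_zero)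

theorem fourier_mollify (hf : Integrable f) (hq : 0 < q) (ξ : ℝ) :
    𝓕 (mollify f q) ξ = 𝓕 f ξ * mollifierHat (ξ / q) := by
  have hint : Integrable fun x => (scaledMollifier q x : ℂ) :=
    ((scaledMollifier_contDiff q).continuous.integrable_of_hasCompactSupport
      (scaledMollifier_hasCompactSupport hq)).ofReal
  rw [mollify_eq_convolution, Real.fourier_mul_convolution_eq hf hint, fourier_scaledMollifier hq]

theorem exists_schwartz_eq_mollify (hf : Continuous f) (hc : HasCompactSupport f) (hq : 0 < q) :
    ∃ g : 𝓢(ℝ, ℂ), (∀ t, g t = mollify f q t) ∧ ∀ ξ, 𝓕 g ξ = 𝓕 f ξ * mollifierHat (ξ / q) := by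
  refine ⟨(mollify_hasCompactSupport hc hq).toSchwartzMap (mollify_contDiff hf hq),
    fun _ => rfl, fun ξ => ?_⟩
  rw [SchwartzMap.fourier_coe]
  exact fourier_mollify (hf.integrable_of_hasCompactSupport hc) hq ξ

theorem mollify_eq_zero (h0 : ∀ x ∉ Icc (0 : ℝ) 1, f x = 0) (hq : 1 ≤ q) {t : ℝ} (ht : 2 ≤ |t|) :
    mollify f q t = 0 := by
  refine (integral_congr_ae (.of_forall fun x => ?_)).trans (integral_zero ℝ ℂ)
  by_cases hx : x ∈ Icc (0 : ℝ) 1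
  · have hxt : q⁻¹ ≤ |x - t| := by
      have habs : |x| ≤ 1 := abs_le.2 ⟨by linarith [hx.1], hx.2⟩
      linarith [inv_le_one_of_one_le₀ hq, abs_sub_abs_le_abs_sub t x, abs_sub_comm t x]
    simp only [scaledMollifier_eq_zero (one_pos.trans_le hq) hxt, Complex.ofReal_zero, mul_zero]
  · simp only [h0 x hx, zero_mul]

theorem integrable_mul_scaledMollifier (hf : Continuous f) (hc : HasCompactSupport f) (q t : ℝ) :
    Integrable fun x => f x * (scaledMollifier q (x - t) : ℂ) := by
  have hcont := (scaledMollifier_contDiff q).continuous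
  exact (by fun_prop : Continuous fun x => f x * (scaledMollifier q (x - t) : ℂ))
    |>.integrable_of_hasCompactSupport hc.mul_right

end Mollify

/-- The numerators prime to `p` of the fractions `m / (p Q)` that matter on `[0, 1]`: for
`p Q ≤ q` the fractions with `|m| > 2 q` lie outside `[-2, 2]`. -/
noncomputable def reducedNumerators (q : ℝ) (p : ℕ) : Finset ℤ :=
  (Finset.Icc (-⌈2 * q⌉) ⌈2 * q⌉).filter fun m => Int.gcd m p = 1

theorem two_mul_lt_abs_of_notMem_reducedNumerators {q : ℝ} {p : ℕ} {m : ℤ}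
    (hm : m ∉ reducedNumerators q p) (hcoprime : Int.gcd m p = 1) : 2 * q < |(m : ℝ)| := by
  contrapose! hm
  obtain ⟨hlow, hhigh⟩ := abs_le.1 hm
  refine Finset.mem_filter.2 ⟨Finset.mem_Icc.2 ⟨?_, ?_⟩, hcoprime⟩
  · exact_mod_cast (show (-(⌈2 * q⌉ : ℤ) : ℝ) ≤ m by linarith [Int.le_ceil (2 * q)])
  · exact_mod_cast hhigh.trans (Int.le_ceil _)

/-- The mollified density of the reduced fractions `m / (p Q)` with `p ∈ P`, normalised so that
each `p` contributes mean density `1 / #P` near `[0, 1]`. -/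
noncomputable def bumpSum (P : Finset ℕ) (Q q x : ℝ) : ℝ :=
  ∑ p ∈ P, ∑ m ∈ reducedNumerators q p,
    ((P.card : ℝ) * (p.totient * Q))⁻¹ * scaledMollifier q (x - m / (p * Q))

/-- The average over `p ∈ P` of the normalised Ramanujan sums. -/
noncomputable def averageCoeff (P : Finset ℕ) (k : ℤ) : ℝ :=
  (P.card : ℝ)⁻¹ * ∑ p ∈ P, ramanujanCoeff p k

theorem bumpSum_contDiff (P : Finset ℕ) (Q q : ℝ) : ContDiff ℝ ∞ (bumpSum P Q q) := by
  unfold bumpSum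
  exact ContDiff.sum fun p _ => ContDiff.sum fun m _ => contDiff_const.mul
    ((scaledMollifier_contDiff q).comp (contDiff_id.sub contDiff_const))

theorem bumpSum_nonneg (P : Finset ℕ) {Q q : ℝ} (hQ : 0 ≤ Q) (hq : 0 < q) (x : ℝ) :
    0 ≤ bumpSum P Q q x :=
  Finset.sum_nonneg fun p _ => Finset.sum_nonneg fun m _ =>
    mul_nonneg (by positivity) (scaledMollifier_nonneg hq _)

theorem averageCoeff_zero {P : Finset ℕ} (hP : P.Nonempty) : averageCoeff P 0 = 1 := by
  have hcard : (P.card : ℝ) ≠ 0 := by exact_mod_cast hP.card_pos.ne'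
  simp [averageCoeff, ramanujanCoeff, hcard]

theorem abs_averageCoeff_le_one {P : Finset ℕ} (hp : ∀ p ∈ P, p ≠ 0) (k : ℤ) :
    |averageCoeff P k| ≤ 1 := by
  have hsum : |∑ p ∈ P, ramanujanCoeff p k| ≤ P.card :=
    (Finset.abs_sum_le_sum_abs _ _).trans <|
      (Finset.sum_le_sum fun p hpP => abs_ramanujanCoeff_le_one (hp p hpP) k).trans (by simp)
  rw [averageCoeff, abs_mul, abs_inv, Nat.abs_cast]
  exact inv_mul_le_one_of_le₀ hsum (Nat.cast_nonneg _)

theorem hasCompactSupport_of_zero_off_Icc {E : Type*} [Zero E] {f : ℝ → E} {a b : ℝ}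
    (h0 : ∀ x ∉ Icc a b, f x = 0) : HasCompactSupport f :=
  .of_support_subset_isCompact isCompact_Icc fun x hx => by_contra fun h => hx (h0 x h)

section BumpSumFourier

variable {f : ℝ → ℂ} {P : Finset ℕ} {Q q : ℝ}

theorem integral_mul_bumpSum_eq_sum_mollify (hf : Continuous f) (hc : HasCompactSupport f) :
    ∫ x, f x * bumpSum P Q q x =
      ∑ p ∈ P, (((P.card : ℝ) * (p.totient * Q))⁻¹ : ℝ) *
        ∑ m ∈ reducedNumerators q p, mollify f q (m / (p * Q)) := by
  have hint := integrable_mul_scaledMollifier hf hc q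
  calc ∫ x, f x * bumpSum P Q q x
      = ∫ x, ∑ p ∈ P, ∑ m ∈ reducedNumerators q p, (((P.card : ℝ) * (p.totient * Q))⁻¹ : ℝ) *
          (f x * (scaledMollifier q (x - m / (p * Q)) : ℂ)) := by
        congr 1 with x
        simp only [bumpSum, Complex.ofReal_sum, Complex.ofReal_mul, Finset.mul_sum,
          mul_left_comm (f x)]
    _ = _ := by
        rw [integral_finsetSum _ fun p _ => integrable_finsetSum _ fun m _ =>
          (hint _).const_mul _]
        refine Finset.sum_congr rfl fun p _ => ?_
        rw [integral_finsetSum _ fun m _ => (hint _).const_mul _, Finset.mul_sum]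
        exact Finset.sum_congr rfl fun m _ => integral_const_mul _ _

theorem sum_reducedNumerators_mollify (hf : Continuous f) (h0 : ∀ x ∉ Icc (0 : ℝ) 1, f x = 0)
    (hQ : 0 < Q) (hq : 1 ≤ q) {p : ℕ} (hp : p = 1 ∨ p.Prime) (hpQ : p * Q ≤ q) :
    ∑ m ∈ reducedNumerators q p, mollify f q (m / (p * Q)) =
      (p.totient * Q : ℝ) * ∑' k : ℤ,
        (ramanujanCoeff p k : ℂ) * (𝓕 f (k * Q) * mollifierHat (k * Q / q)) := by
  have hq0 : 0 < q := one_pos.trans_le hq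
  have hc := hasCompactSupport_of_zero_off_Icc h0
  have hp0 : 0 < p := hp.elim (fun h => h ▸ one_pos) Nat.Prime.pos
  obtain ⟨g, hg, hghat⟩ := exists_schwartz_eq_mollify hf hc hq0
  have hpoisson := tsum_coprime_eq_tsum_fourier g hQ hp
  simp only [hg, hghat] at hpoisson
  rw [← hpoisson, tsum_eq_sum (s := reducedNumerators q p)]
  · exact Finset.sum_congr rfl fun m hm => (if_pos (Finset.mem_filter.1 hm).2).symm
  · intro m hm
    split_ifs with hcoprime
    · refine mollify_eq_zero h0 hq ?_
      have hpQ0 : 0 < p * Q := by positivity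
      rw [abs_div, abs_of_pos hpQ0, le_div_iff₀ hpQ0]
      linarith [two_mul_lt_abs_of_notMem_reducedNumerators hm hcoprime]
    · rfl

theorem integral_mul_bumpSum (hf : Continuous f) (h0 : ∀ x ∉ Icc (0 : ℝ) 1, f x = 0)
    (hp : ∀ p ∈ P, p = 1 ∨ p.Prime) (hQ : 0 < Q) (hq : 1 ≤ q) (hpQ : ∀ p ∈ P, p * Q ≤ q) :
    ∫ x, f x * bumpSum P Q q x =
      ∑' k : ℤ, (averageCoeff P k : ℂ) * (𝓕 f (k * Q) * mollifierHat (k * Q / q)) := by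
  have hq0 : 0 < q := one_pos.trans_le hq
  have hc := hasCompactSupport_of_zero_off_Icc h0
  have hp0 : ∀ p ∈ P, 0 < p := fun p hpP =>
    (hp p hpP).elim (fun h => h ▸ one_pos) Nat.Prime.pos
  set t : ℤ → ℂ := fun k => 𝓕 f (k * Q) * mollifierHat (k * Q / q)
  have ht : Summable t := by
    obtain ⟨g, -, hghat⟩ := exists_schwartz_eq_mollify hf hc hq0
    simpa only [hghat] using summable_schwartz_int_mul (𝓕 g) hQ.ne'
  calc ∫ x, f x * bumpSum P Q q x
      = ∑ p ∈ P, (P.card : ℂ)⁻¹ * ∑' k : ℤ, (ramanujanCoeff p k : ℂ) * t k := by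
        rw [integral_mul_bumpSum_eq_sum_mollify hf hc]
        refine Finset.sum_congr rfl fun p hpP => ?_
        rw [sum_reducedNumerators_mollify hf h0 hQ hq (hp p hpP) (hpQ p hpP), ← mul_assoc]
        congr 1
        have hφ : (p.totient : ℂ) ≠ 0 := by
          exact_mod_cast (Nat.totient_pos.2 (hp0 p hpP)).ne'
        have hQ' : (Q : ℂ) ≠ 0 := by exact_mod_cast hQ.ne'
        push_cast
        field_simp
    _ = ∑' k : ℤ, (averageCoeff P k : ℂ) * t k := by
        rw [← Finset.mul_sum, ← Summable.tsum_finsetSum fun p hpP =>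
          summable_ramanujanCoeff_mul (hp0 p hpP).ne' ht, ← tsum_mul_left]
        refine tsum_congr fun k => ?_
        rw [averageCoeff, ← Finset.sum_mul, ← mul_assoc]
        push_cast
        rfl

end BumpSumFourier

theorem summable_int_inv_one_add_sq : Summable fun k : ℤ => ((1 + |(k : ℝ)| / 2) ^ 2)⁻¹ := by
  have hrpow : Summable fun k : ℤ => 4 * |(k : ℝ)| ^ (-2 : ℝ) :=
    (Real.summable_abs_int_rpow one_lt_two).mul_left 4
  refine hrpow.of_norm_bounded_eventually ?_
  filter_upwards [(finite_singleton (0 : ℤ)).compl_mem_cofinite] with k hk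
  have hk0 : 0 < |(k : ℝ)| := abs_pos.2 (Int.cast_ne_zero.2 hk)
  calc ‖((1 + |(k : ℝ)| / 2) ^ 2)⁻¹‖ = ((1 + |(k : ℝ)| / 2) ^ 2)⁻¹ :=
        Real.norm_of_nonneg (by positivity)
    _ ≤ ((|(k : ℝ)| / 2) ^ 2)⁻¹ := by
        gcongr
        linarith
    _ = 4 * |(k : ℝ)| ^ (-2 : ℝ) := by
        rw [Real.rpow_neg hk0.le, Real.rpow_two, div_pow, inv_div]
        norm_num [div_eq_mul_inv]

/-- The constant bounding the sums of `(1 + |·|)⁻²` over all shifted lattices of spacing at least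
`1`. -/
noncomputable def latticeConst : ℝ := ∑' k : ℤ, ((1 + |(k : ℝ)| / 2) ^ 2)⁻¹

section Lattice

variable {Q : ℝ}

theorem abs_sub_round_div_two_le {x : ℝ} (k : ℤ) : |((k - round x : ℤ) : ℝ)| / 2 ≤ |k - x| := by
  rcases eq_or_ne k (round x) with rfl | hk
  · simp
  · have hgap : (1 : ℝ) ≤ |((k - round x : ℤ) : ℝ)| := by
      exact_mod_cast Int.one_le_abs (sub_ne_zero.2 hk)
    have htriangle := abs_sub_le (k : ℝ) x (round x)
    push_cast at hgap ⊢
    linarith [abs_sub_round x]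

theorem inv_one_add_sq_le_shift (hQ : 1 ≤ Q) (ξ : ℝ) (k : ℤ) :
    ((1 + |ξ + k * Q|) ^ 2)⁻¹ ≤ ((1 + |((k - round (-ξ / Q) : ℤ) : ℝ)| / 2) ^ 2)⁻¹ := by
  gcongr
  have hQ0 : 0 < Q := one_pos.trans_le hQ
  calc |((k - round (-ξ / Q) : ℤ) : ℝ)| / 2 ≤ |k - -ξ / Q| := abs_sub_round_div_two_le k
    _ ≤ |k - -ξ / Q| * Q := le_mul_of_one_le_right (abs_nonneg _) hQ
    _ = |ξ + k * Q| := by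
        nth_rw 2 [← abs_of_pos hQ0]
        rw [← abs_mul]
        congr 1
        field_simp
        ring

theorem summable_shift_lattice (hQ : 1 ≤ Q) (ξ : ℝ) :
    Summable fun k : ℤ => ((1 + |ξ + k * Q|) ^ 2)⁻¹ :=
  .of_nonneg_of_le (fun _ => by positivity) (inv_one_add_sq_le_shift hQ ξ)
    ((Equiv.subRight (round (-ξ / Q))).summable_iff.2 summable_int_inv_one_add_sq)

theorem tsum_shift_lattice_le (hQ : 1 ≤ Q) (ξ : ℝ) :
    ∑' k : ℤ, ((1 + |ξ + k * Q|) ^ 2)⁻¹ ≤ latticeConst :=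
  ((summable_shift_lattice hQ ξ).tsum_le_tsum (inv_one_add_sq_le_shift hQ ξ)
    ((Equiv.subRight (round (-ξ / Q))).summable_iff.2 summable_int_inv_one_add_sq)).trans_eq
    ((Equiv.subRight (round (-ξ / Q))).tsum_eq fun k : ℤ => ((1 + |(k : ℝ)| / 2) ^ 2)⁻¹)

end Lattice

section FourierMulBumpSum

variable {h : ℝ → ℂ} {P : Finset ℕ} {Q q : ℝ}

theorem fourier_mul_bumpSum (hh : Continuous h) (h0 : ∀ x ∉ Icc (0 : ℝ) 1, h x = 0)
    (hp : ∀ p ∈ P, p = 1 ∨ p.Prime) (hQ : 0 < Q) (hq : 1 ≤ q) (hpQ : ∀ p ∈ P, p * Q ≤ q) (ξ : ℝ) :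
    𝓕 (fun x => h x * bumpSum P Q q x) ξ =
      ∑' k : ℤ, (averageCoeff P k : ℂ) * (𝓕 h (ξ + k * Q) * mollifierHat (k * Q / q)) := by
  have htwist := integral_mul_bumpSum
    (f := fun x => Complex.exp (↑(-2 * Real.pi * x * ξ) * Complex.I) * h x)
    (by fun_prop) (fun x hx => by rw [h0 x hx, mul_zero]) hp hQ hq hpQ
  simp only [fourier_exp_mul] at htwist
  rw [← htwist, Real.fourier_real_eq_integral_exp_smul]
  simp only [smul_eq_mul, mul_assoc]

theorem norm_fourier_mul_bumpSum_sub_le (hh : Continuous h)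
    (h0 : ∀ x ∉ Icc (0 : ℝ) 1, h x = 0) (hP : P.Nonempty) (hp : ∀ p ∈ P, p = 1 ∨ p.Prime)
    (hQ : 0 < Q) (hq : 1 ≤ q) (hpQ : ∀ p ∈ P, p * Q ≤ q) (ξ : ℝ) {b : ℤ → ℝ} (hb : Summable b)
    (hb0 : 0 ≤ b 0) (hbound : ∀ k : ℤ, k ≠ 0 →
      |averageCoeff P k| * ‖mollifierHat (k * Q / q)‖ * ‖𝓕 h (ξ + k * Q)‖ ≤ b k) :
    ‖𝓕 (fun x => h x * bumpSum P Q q x) ξ - 𝓕 h ξ‖ ≤ ∑' k, b k := by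
  set t : ℤ → ℂ := fun k =>
    (averageCoeff P k : ℂ) * (𝓕 h (ξ + k * Q) * mollifierHat (k * Q / q)) with ht
  have hnorm : ∀ k, k ≠ 0 → ‖t k‖ ≤ b k := fun k hk => by
    refine le_of_eq_of_le ?_ (hbound k hk)
    simp only [ht, norm_mul, Complex.norm_real, Real.norm_eq_abs]
    ring
  have htsum : Summable t := hb.of_norm_bounded_eventually <| by
    filter_upwards [(finite_singleton (0 : ℤ)).compl_mem_cofinite] with k hk using hnorm k hk
  have ht0 : t 0 = 𝓕 h ξ := by simp [ht, averageCoeff_zero hP, mollifierHat_zero]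
  rw [fourier_mul_bumpSum hh h0 hp hQ hq hpQ, htsum.tsum_eq_add_tsum_ite 0, ht0,
    add_sub_cancel_left]
  refine tsum_of_norm_bounded hb.hasSum fun k => ?_
  split_ifs with hk
  · simpa only [norm_zero, hk] using hb0
  · exact hnorm k hk

theorem one_add_abs_rpow_neg_le {a : ℝ} (ha0 : 0 ≤ a) (ha1 : a ≤ 1) (ξ η : ℝ) :
    (1 + |η|) ^ (-a) ≤ (1 + |ξ|) ^ (-a) * (1 + |ξ + η|) := by
  have htriangle : 1 + |ξ| ≤ (1 + |η|) * (1 + |ξ + η|) := by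
    have hξ : |ξ| ≤ |ξ + η| + |η| := by simpa using abs_sub (ξ + η) η
    nlinarith [mul_nonneg (abs_nonneg η) (abs_nonneg (ξ + η))]
  rw [Real.rpow_neg (by positivity), Real.rpow_neg (by positivity), inv_mul_eq_div, inv_eq_one_div,
    div_le_div_iff₀ (by positivity) (by positivity), one_mul]
  calc (1 + |ξ|) ^ a ≤ ((1 + |η|) * (1 + |ξ + η|)) ^ a := by gcongr
    _ = (1 + |η|) ^ a * (1 + |ξ + η|) ^ a := Real.mul_rpow (by positivity) (by positivity)
    _ ≤ (1 + |η|) ^ a * (1 + |ξ + η|) := by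
        gcongr
        exact Real.rpow_le_self_of_one_le (le_add_of_nonneg_right (abs_nonneg _)) ha1
    _ = (1 + |ξ + η|) * (1 + |η|) ^ a := mul_comm _ _

theorem nonneg_of_forall_norm_le_mul_inv {F : ℝ → ℂ} {C : ℝ} {n : ℕ}
    (hF : ∀ ξ, ‖F ξ‖ ≤ C * ((1 + |ξ|) ^ n)⁻¹) : 0 ≤ C := by
  simpa using (norm_nonneg _).trans (hF 0)

theorem norm_fourier_mul_bumpSum_sub_le_rpow (hh : Continuous h)
    (h0 : ∀ x ∉ Icc (0 : ℝ) 1, h x = 0) {C : ℝ} (hC : ∀ ξ, ‖𝓕 h ξ‖ ≤ C * ((1 + |ξ|) ^ 3)⁻¹)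
    (hP : P.Nonempty) (hp : ∀ p ∈ P, p = 1 ∨ p.Prime) (hQ : 1 ≤ Q) (hq : 1 ≤ q)
    (hpQ : ∀ p ∈ P, p * Q ≤ q) {a δ : ℝ} (ha0 : 0 ≤ a) (ha1 : a ≤ 1) (hδ : 0 ≤ δ)
    (hbound : ∀ k : ℤ, k ≠ 0 →
      |averageCoeff P k| * ‖mollifierHat (k * Q / q)‖ ≤ δ * (1 + |k * Q|) ^ (-a)) (ξ : ℝ) :
    ‖𝓕 (fun x => h x * bumpSum P Q q x) ξ - 𝓕 h ξ‖ ≤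
      δ * (C * latticeConst) * (1 + |ξ|) ^ (-a) := by
  have hC0 := nonneg_of_forall_norm_le_mul_inv hC
  calc ‖𝓕 (fun x => h x * bumpSum P Q q x) ξ - 𝓕 h ξ‖
      ≤ ∑' k : ℤ, δ * C * (1 + |ξ|) ^ (-a) * ((1 + |ξ + k * Q|) ^ 2)⁻¹ := by
        refine norm_fourier_mul_bumpSum_sub_le hh h0 hP hp (one_pos.trans_le hQ) hq hpQ ξ
          ((summable_shift_lattice hQ ξ).mul_left _) (by positivity) fun k hk => ?_
        calc |averageCoeff P k| * ‖mollifierHat (k * Q / q)‖ * ‖𝓕 h (ξ + k * Q)‖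
            ≤ (δ * ((1 + |ξ|) ^ (-a) * (1 + |ξ + k * Q|))) *
                (C * ((1 + |ξ + k * Q|) ^ 3)⁻¹) := by
              refine mul_le_mul ((hbound k hk).trans ?_) (hC _) (norm_nonneg _) (by positivity)
              gcongr
              exact one_add_abs_rpow_neg_le ha0 ha1 _ _
          _ = δ * C * (1 + |ξ|) ^ (-a) * ((1 + |ξ + k * Q|) ^ 2)⁻¹ := by
              have hne : (1 + |ξ + k * Q|) ≠ 0 := by positivity
              field_simp
    _ ≤ δ * C * (1 + |ξ|) ^ (-a) * latticeConst := by
        rw [tsum_mul_left]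
        gcongr
        exact tsum_shift_lattice_le hQ ξ
    _ = δ * (C * latticeConst) * (1 + |ξ|) ^ (-a) := by ring

theorem norm_fourier_mul_bumpSum_zero_sub_le (hh : Continuous h)
    (h0 : ∀ x ∉ Icc (0 : ℝ) 1, h x = 0) {C : ℝ} (hC : ∀ ξ, ‖𝓕 h ξ‖ ≤ C * ((1 + |ξ|) ^ 3)⁻¹)
    (hP : P.Nonempty) (hp : ∀ p ∈ P, p = 1 ∨ p.Prime) (hQ : 1 ≤ Q) (hq : 1 ≤ q)
    (hpQ : ∀ p ∈ P, p * Q ≤ q) :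
    ‖𝓕 (fun x => h x * bumpSum P Q q x) 0 - 𝓕 h 0‖ ≤ C * latticeConst * Q⁻¹ := by
  have hQ0 : 0 < Q := one_pos.trans_le hQ
  have hp0 : ∀ p ∈ P, p ≠ 0 := fun p hpP => (hp p hpP).elim (· ▸ one_ne_zero) Nat.Prime.ne_zero
  have hC0 := nonneg_of_forall_norm_le_mul_inv hC
  calc ‖𝓕 (fun x => h x * bumpSum P Q q x) 0 - 𝓕 h 0‖
      ≤ ∑' k : ℤ, C * Q⁻¹ * ((1 + |0 + k * Q|) ^ 2)⁻¹ := by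
        refine norm_fourier_mul_bumpSum_sub_le hh h0 hP hp hQ0 hq hpQ 0
          ((summable_shift_lattice hQ 0).mul_left _) (by positivity) fun k hk => ?_
        have hfar : Q ≤ 1 + |0 + k * Q| := by
          have hk1 : (1 : ℝ) ≤ |(k : ℝ)| := by exact_mod_cast Int.one_le_abs hk
          rw [zero_add, abs_mul, abs_of_pos hQ0]
          nlinarith
        calc |averageCoeff P k| * ‖mollifierHat (k * Q / q)‖ * ‖𝓕 h (0 + k * Q)‖
            ≤ 1 * 1 * (C * ((1 + |0 + k * Q|) ^ 3)⁻¹) := by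
              gcongr
              · exact abs_averageCoeff_le_one hp0 k
              · exact norm_mollifierHat_le_one _
              · exact hC _
          _ = C * (1 + |0 + k * Q|)⁻¹ * ((1 + |0 + k * Q|) ^ 2)⁻¹ := by
              have hne : (1 + |0 + k * Q|) ≠ 0 := by positivity
              field_simp
          _ ≤ C * Q⁻¹ * ((1 + |0 + k * Q|) ^ 2)⁻¹ := by gcongr
    _ ≤ C * Q⁻¹ * latticeConst := by
        rw [tsum_mul_left]
        gcongr
        exact tsum_shift_lattice_le hQ 0
    _ = C * latticeConst * Q⁻¹ := by ring

end FourierMulBumpSum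

section AverageCoeff

variable {P : Finset ℕ} {ε : ℝ} {k : ℤ}

theorem two_pow_card_filter_dvd_le (hp : ∀ p ∈ P, p.Prime) (hk : k ≠ 0) :
    (2 : ℝ) ^ (P.filter fun p : ℕ => (p : ℤ) ∣ k).card ≤ |(k : ℝ)| := by
  set S := P.filter fun p : ℕ => (p : ℤ) ∣ k
  have hS : ∀ p ∈ S, p.Prime := fun p h => hp p (Finset.mem_filter.1 h).1
  have hdvd : ∏ p ∈ S, p ∣ k.natAbs := Finset.prod_primes_dvd _ (fun p h => (hS p h).prime)
    fun p h => Int.natCast_dvd.1 (Finset.mem_filter.1 h).2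
  have hpow : 2 ^ S.card ≤ k.natAbs := calc
    2 ^ S.card = ∏ _p ∈ S, 2 := (Finset.prod_const 2).symm
    _ ≤ ∏ p ∈ S, p := Finset.prod_le_prod' fun p h => (hS p h).two_le
    _ ≤ k.natAbs := Nat.le_of_dvd (Int.natAbs_pos.2 hk) hdvd
  rw [← Int.cast_abs, Int.abs_eq_natAbs]
  exact_mod_cast hpow

theorem card_filter_dvd_le (hp : ∀ p ∈ P, p.Prime) (hε : 0 < ε) (hk : k ≠ 0) :
    ((P.filter fun p : ℕ => (p : ℤ) ∣ k).card : ℝ) ≤ 2 / ε * |(k : ℝ)| ^ ε := by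
  set S := P.filter fun p : ℕ => (p : ℤ) ∣ k
  have hlog : S.card * Real.log 2 ≤ |(k : ℝ)| ^ ε / ε := calc
    S.card * Real.log 2 = Real.log (2 ^ S.card) := (Real.log_pow ..).symm
    _ ≤ Real.log |(k : ℝ)| := Real.log_le_log (by positivity) (two_pow_card_filter_dvd_le hp hk)
    _ ≤ |(k : ℝ)| ^ ε / ε := Real.log_le_rpow_div (abs_nonneg _) hε
  have hlog_two : (1 / 2 : ℝ) ≤ Real.log 2 := by linarith [Real.log_two_gt_d9]
  calc (S.card : ℝ) = 2 * (S.card * (1 / 2)) := by ring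
    _ ≤ 2 * (S.card * Real.log 2) := by gcongr
    _ ≤ 2 * (|(k : ℝ)| ^ ε / ε) := by gcongr
    _ = 2 / ε * |(k : ℝ)| ^ ε := by ring

theorem abs_ramanujanCoeff_le {p : ℕ} (hp : p.Prime) {R : ℝ} (hR : 0 < R) (hRp : R / 2 ≤ p) :
    |ramanujanCoeff p k| ≤ (if (p : ℤ) ∣ k then 1 else 0) + 4 / R := by
  unfold ramanujanCoeff
  split_ifs
  · simpa only [abs_one, le_add_iff_nonneg_right] using by positivity
  · have htwo : (2 : ℝ) ≤ p := by exact_mod_cast hp.two_le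
    rw [abs_neg, abs_of_nonneg (inv_nonneg.2 (by linarith)), zero_add, inv_eq_one_div,
      div_le_div_iff₀ (by linarith) hR]
    linarith

theorem abs_averageCoeff_le (hP : P.Nonempty) (hp : ∀ p ∈ P, p.Prime) {R : ℝ} (hR : 0 < R)
    (hRp : ∀ p ∈ P, R / 2 ≤ p) (hε : 0 < ε) (hk : k ≠ 0) :
    |averageCoeff P k| ≤ (P.card : ℝ)⁻¹ * (2 / ε * |(k : ℝ)| ^ ε) + 4 / R := by
  have hcard : (P.card : ℝ) ≠ 0 := by exact_mod_cast hP.card_pos.ne'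
  rw [averageCoeff, abs_mul, abs_inv, Nat.abs_cast]
  calc (P.card : ℝ)⁻¹ * |∑ p ∈ P, ramanujanCoeff p k|
      ≤ (P.card : ℝ)⁻¹ * ∑ p ∈ P, ((if (p : ℤ) ∣ k then 1 else 0) + 4 / R) := by
        gcongr
        exact (Finset.abs_sum_le_sum_abs _ _).trans <| Finset.sum_le_sum fun p hpP =>
          abs_ramanujanCoeff_le (hp p hpP) hR (hRp p hpP)
    _ = (P.card : ℝ)⁻¹ * (P.filter fun p : ℕ => (p : ℤ) ∣ k).card + 4 / R := by
        rw [Finset.sum_add_distrib, Finset.sum_boole, Finset.sum_const, nsmul_eq_mul, mul_add,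
          inv_mul_cancel_left₀ hcard]
    _ ≤ (P.card : ℝ)⁻¹ * (2 / ε * |(k : ℝ)| ^ ε) + 4 / R := by
        gcongr
        exact card_filter_dvd_le hp hε hk

end AverageCoeff

/-- The denominators used at scale `q`: primes of size about `q ^ γ`, or only `1` if `γ = 0`. -/
noncomputable def denominators (γ q : ℝ) : Finset ℕ :=
  if γ = 0 then {1}
  else (Finset.range (⌊q ^ γ⌋₊ + 1)).filter fun p => p.Prime ∧ q ^ γ / 2 ≤ p

section Denominators

variable {γ q : ℝ} {p : ℕ}

theorem mem_denominators_of_pos (hγ : 0 < γ) (hq : 0 < q) :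
    p ∈ denominators γ q ↔ p.Prime ∧ q ^ γ / 2 ≤ p ∧ (p : ℝ) ≤ q ^ γ := by
  rw [denominators, if_neg hγ.ne', Finset.mem_filter, Finset.mem_range, Nat.lt_succ_iff,
    Nat.le_floor_iff (by positivity)]
  tauto

theorem eq_one_or_prime_of_mem_denominators (hp : p ∈ denominators γ q) : p = 1 ∨ p.Prime := by
  unfold denominators at hp
  split_ifs at hp
  · exact .inl (Finset.mem_singleton.1 hp)
  · exact .inr (Finset.mem_filter.1 hp).2.1

theorem pos_of_mem_denominators (hp : p ∈ denominators γ q) : 0 < p :=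
  (eq_one_or_prime_of_mem_denominators hp).elim (fun h => h ▸ one_pos) Nat.Prime.pos

theorem denominators_bounds (hγ : 0 ≤ γ) (hq : 0 < q) (hp : p ∈ denominators γ q) :
    q ^ γ / 2 ≤ p ∧ (p : ℝ) ≤ q ^ γ := by
  rcases hγ.eq_or_lt with rfl | hγ
  · simp only [denominators, if_true, Finset.mem_singleton] at hp
    norm_num [hp]
  · exact ((mem_denominators_of_pos hγ hq).1 hp).2

theorem mul_rpow_le_of_mem_denominators {β : ℝ} (hγ : 0 ≤ γ) (hlt : γ + β ≤ 1) (hq : 1 ≤ q)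
    (hp : p ∈ denominators γ q) : p * q ^ β ≤ q := by
  have hq0 : 0 < q := one_pos.trans_le hq
  calc p * q ^ β ≤ q ^ γ * q ^ β := by
        gcongr
        exact (denominators_bounds hγ hq0 hp).2
    _ = q ^ (γ + β) := (Real.rpow_add hq0 _ _).symm
    _ ≤ q := Real.rpow_le_self_of_one_le hq hlt

end Denominators

/-- The factor of the measure at scale `q`. -/
noncomputable def stage (γ β q : ℝ) : ℝ → ℝ := bumpSum (denominators γ q) (q ^ β) q

theorem exists_norm_mollifierHat_div_le : ∃ D : ℝ, 0 < D ∧ ∀ {q : ℝ}, 1 ≤ q → ∀ (u : ℝ) {θ : ℝ},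
    0 ≤ θ → θ ≤ 1 → ‖mollifierHat (u / q)‖ ≤ D * (q / (1 + |u|)) ^ θ := by
  obtain ⟨D, -, hD⟩ := exists_mollifierHat_le 1
  have hD1 : 1 ≤ D := by simpa [mollifierHat_zero] using hD 0
  refine ⟨D, one_pos.trans_le hD1, fun {q} hq u {θ} hθ0 hθ1 => ?_⟩
  have hq0 : 0 < q := one_pos.trans_le hq
  rcases le_total (q / (1 + |u|)) 1 with hle | hge
  · calc ‖mollifierHat (u / q)‖ ≤ D * ((1 + |u / q|) ^ 1)⁻¹ := hD _
      _ = D * (q / (q + |u|)) := by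
          rw [pow_one, abs_div, abs_of_pos hq0]
          field_simp
      _ ≤ D * (q / (1 + |u|)) := by gcongr
      _ ≤ D * (q / (1 + |u|)) ^ θ := by
          gcongr
          exact Real.self_le_rpow_of_le_one (by positivity) hle hθ1
  · exact (norm_mollifierHat_le_one _).trans
      (one_le_mul_of_one_le_of_one_le hD1 (Real.one_le_rpow hge hθ0))

section StageFourier

variable {γ β ε : ℝ}

theorem abs_averageCoeff_denominators_le {q : ℝ} (hγ : 0 < γ) (hε : 0 < ε) (hq : 1 ≤ q)
    (hcard : q ^ (γ - ε) ≤ (denominators γ q).card) {k : ℤ} (hk : k ≠ 0) {T : ℝ} (hT : 1 ≤ T)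
    (hkT : |(k : ℝ)| ≤ T) :
    |averageCoeff (denominators γ q) k| ≤ (2 / ε + 4) * (q ^ (-γ + ε) * T ^ ε) := by
  have hq0 : 0 < q := one_pos.trans_le hq
  have hcard0 : (0 : ℝ) < (denominators γ q).card := lt_of_lt_of_le (by positivity) hcard
  have hcard_inv : ((denominators γ q).card : ℝ)⁻¹ ≤ q ^ (-γ + ε) := by
    rw [show -γ + ε = -(γ - ε) by ring, Real.rpow_neg hq0.le]
    exact inv_anti₀ (by positivity) hcard
  calc |averageCoeff (denominators γ q) k|
      ≤ ((denominators γ q).card : ℝ)⁻¹ * (2 / ε * |(k : ℝ)| ^ ε) + 4 / q ^ γ :=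
        abs_averageCoeff_le (Finset.card_pos.1 (by exact_mod_cast hcard0))
          (fun p hp => ((mem_denominators_of_pos hγ hq0).1 hp).1) (by positivity)
          (fun p hp => (denominators_bounds hγ.le hq0 hp).1) hε hk
    _ ≤ q ^ (-γ + ε) * (2 / ε * T ^ ε) + 4 * (q ^ (-γ + ε) * T ^ ε) := by
        gcongr
        rw [div_eq_mul_inv, ← Real.rpow_neg hq0.le]
        gcongr
        calc q ^ (-γ) ≤ q ^ (-γ + ε) := Real.rpow_le_rpow_of_exponent_le hq (by linarith)
          _ ≤ q ^ (-γ + ε) * T ^ ε :=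
              le_mul_of_one_le_right (by positivity) (Real.one_le_rpow hT hε.le)
    _ = (2 / ε + 4) * (q ^ (-γ + ε) * T ^ ε) := by ring

theorem exists_averageCoeff_mul_mollifierHat_le (hγ : 0 < γ) (hγ1 : γ ≤ 1) (hβ : 0 ≤ β)
    (hε : 0 < ε) (hεγ : 3 * ε ≤ γ) :
    ∃ D : ℝ, 0 < D ∧ ∀ q, 1 ≤ q → q ^ (γ - ε) ≤ (denominators γ q).card → ∀ k : ℤ, k ≠ 0 →
      |averageCoeff (denominators γ q) k| * ‖mollifierHat (k * q ^ β / q)‖ ≤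
        D * q ^ (-ε) * (1 + |k * q ^ β|) ^ (-(γ - 3 * ε)) := by
  obtain ⟨D, hD0, hD⟩ := exists_norm_mollifierHat_div_le
  refine ⟨D * (2 / ε + 4), by positivity, fun q hq hcard k hk => ?_⟩
  have hq0 : 0 < q := one_pos.trans_le hq
  set T := 1 + |k * q ^ β| with hT
  have hT1 : 1 ≤ T := le_add_of_nonneg_right (abs_nonneg _)
  have hT0 : 0 < T := one_pos.trans_le hT1
  have hkT : |(k : ℝ)| ≤ T := by
    rw [hT, abs_mul, abs_of_pos (by positivity : 0 < q ^ β)]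
    nlinarith [abs_nonneg (k : ℝ), Real.one_le_rpow hq hβ]
  calc |averageCoeff (denominators γ q) k| * ‖mollifierHat (k * q ^ β / q)‖
      ≤ ((2 / ε + 4) * (q ^ (-γ + ε) * T ^ ε)) * (D * (q / T) ^ (γ - 2 * ε)) := by
        gcongr
        · exact abs_averageCoeff_denominators_le hγ hε hq hcard hk hT1 hkT
        · exact hD hq _ (by linarith) (by linarith)
    _ = D * (2 / ε + 4) * (q ^ (-γ + ε) * q ^ (γ - 2 * ε)) * (T ^ ε * T ^ (-(γ - 2 * ε))) := by
        rw [Real.div_rpow hq0.le hT0.le, Real.rpow_neg hT0.le]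
        ring
    _ = D * (2 / ε + 4) * q ^ (-ε) * T ^ (-(γ - 3 * ε)) := by
        rw [← Real.rpow_add hq0, ← Real.rpow_add hT0]
        ring_nf

theorem eventually_fourier_stage_sub_le (hγ : 0 < γ) (hβ : 0 ≤ β) (hlt : γ + β ≤ 1)
    {h : ℝ → ℂ} (hh : ContDiff ℝ ∞ h) (h0 : ∀ x ∉ Icc (0 : ℝ) 1, h x = 0)
    (hε : 0 < ε) (hεγ : 3 * ε ≤ γ) {δ : ℝ} (hδ : 0 < δ) :
    ∀ᶠ q in atTop, q ^ (γ - ε) ≤ (denominators γ q).card →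
      ∀ ξ, ‖𝓕 (fun x => h x * stage γ β q x) ξ - 𝓕 h ξ‖ ≤ δ * (1 + |ξ|) ^ (-(γ - 3 * ε)) := by
  obtain ⟨C, _, hC⟩ := exists_norm_fourier_le hh (hasCompactSupport_of_zero_off_Icc h0) 3
  obtain ⟨D, hD0, hD⟩ := exists_averageCoeff_mul_mollifierHat_le hγ (by linarith) hβ hε hεγ
  have hlim : Tendsto (fun q : ℝ => D * q ^ (-ε) * (C * latticeConst)) atTop (𝓝 0) := by
    simpa using ((tendsto_rpow_neg_atTop hε).const_mul D).mul_const (C * latticeConst)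
  filter_upwards [hlim.eventually (ge_mem_nhds hδ), eventually_ge_atTop (1 : ℝ)]
    with q hqδ hq hcard ξ
  have hcard0 : (0 : ℝ) < (denominators γ q).card := lt_of_lt_of_le (by positivity) hcard
  calc ‖𝓕 (fun x => h x * stage γ β q x) ξ - 𝓕 h ξ‖
      ≤ D * q ^ (-ε) * (C * latticeConst) * (1 + |ξ|) ^ (-(γ - 3 * ε)) :=
        norm_fourier_mul_bumpSum_sub_le_rpow hh.continuous h0 hC
          (Finset.card_pos.1 (by exact_mod_cast hcard0))
          (fun p hp => eq_one_or_prime_of_mem_denominators hp) (Real.one_le_rpow hq hβ) hq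
          (fun p hp => mul_rpow_le_of_mem_denominators hγ.le hlt hq hp) (by linarith)
          (by linarith) (by positivity) (hD q hq hcard) ξ
    _ ≤ δ * (1 + |ξ|) ^ (-(γ - 3 * ε)) := by gcongr

theorem eventually_fourier_zero_stage_sub_le (hβ : 0 < β) (hβ1 : β ≤ 1)
    {h : ℝ → ℂ} (hh : ContDiff ℝ ∞ h) (h0 : ∀ x ∉ Icc (0 : ℝ) 1, h x = 0) {δ : ℝ} (hδ : 0 < δ) :
    ∀ᶠ q in atTop, ‖𝓕 (fun x => h x * stage 0 β q x) 0 - 𝓕 h 0‖ ≤ δ := by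
  obtain ⟨C, -, hC⟩ := exists_norm_fourier_le hh (hasCompactSupport_of_zero_off_Icc h0) 3
  have hlim : Tendsto (fun q : ℝ => C * latticeConst * (q ^ β)⁻¹) atTop (𝓝 0) := by
    simpa using (tendsto_rpow_atTop hβ).inv_tendsto_atTop.const_mul (C * latticeConst)
  filter_upwards [hlim.eventually (ge_mem_nhds hδ), eventually_ge_atTop (1 : ℝ)] with q hqδ hq
  exact (norm_fourier_mul_bumpSum_zero_sub_le hh.continuous h0 hC (by simp [denominators])
    (fun p hp => eq_one_or_prime_of_mem_denominators hp) (Real.one_le_rpow hq hβ.le) hq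
    (fun p hp => mul_rpow_le_of_mem_denominators le_rfl (by linarith) hq hp)).trans hqδ

theorem fourier_ofReal_zero (g : ℝ → ℝ) : 𝓕 (fun x => (g x : ℂ)) 0 = ((∫ x, g x : ℝ) : ℂ) := by
  simp [Real.fourier_real_eq_integral_exp_smul, integral_complex_ofReal]

theorem eventually_integral_mul_stage_sub_le (hγ : 0 ≤ γ) (hβ : 0 ≤ β)
    (hpos : 0 < γ + β) (hlt : γ + β ≤ 1) {h : ℝ → ℝ} (hh : ContDiff ℝ ∞ h)
    (h0 : ∀ x ∉ Icc (0 : ℝ) 1, h x = 0) (hε : 0 < ε) (hεγ : 0 < γ → 3 * ε ≤ γ)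
    {δ : ℝ} (hδ : 0 < δ) :
    ∀ᶠ q in atTop, q ^ (γ - ε) ≤ (denominators γ q).card →
      |(∫ x, h x * stage γ β q x) - ∫ x, h x| ≤ δ := by
  have hhC : ContDiff ℝ ∞ fun x => (h x : ℂ) := Complex.ofRealCLM.contDiff.comp hh
  have h0C : ∀ x ∉ Icc (0 : ℝ) 1, (h x : ℂ) = 0 := fun x hx => by rw [h0 x hx, Complex.ofReal_zero]
  have hfourier : ∀ q, ‖𝓕 (fun x => (h x : ℂ) * stage γ β q x) 0 - 𝓕 (fun x => (h x : ℂ)) 0‖ =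
      |(∫ x, h x * stage γ β q x) - ∫ x, h x| := fun q => by
    simp only [← Complex.ofReal_mul, fourier_ofReal_zero, ← Complex.ofReal_sub, Complex.norm_real,
      Real.norm_eq_abs]
  rcases hγ.eq_or_lt with rfl | hγ
  · filter_upwards [eventually_fourier_zero_stage_sub_le (by simpa using hpos)
      (by simpa using hlt) hhC h0C hδ] with q hq _
    exact hfourier q ▸ hq
  · filter_upwards [eventually_fourier_stage_sub_le hγ hβ hlt hhC h0C hε (hεγ hγ) hδ]
      with q hq hcard
    simpa [hfourier] using hq hcard 0

end StageFourier

theorem card_le_of_separated {ι : Type*} (s : Finset ι) (z : ι → ℝ) {δ x ρ : ℝ} (hδ : 0 < δ)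
    (hρ : 0 ≤ ρ) (hz : ∀ i ∈ s, ∀ j ∈ s, i ≠ j → δ ≤ |z i - z j|) (hx : ∀ i ∈ s, |z i - x| ≤ ρ) :
    (s.card : ℝ) ≤ 2 * ρ / δ + 1 := by
  have hinj : s.card ≤ (Finset.Icc 0 ⌊2 * ρ / δ⌋).card := by
    refine Finset.card_le_card_of_injOn (fun i => ⌊(z i - (x - ρ)) / δ⌋) (fun i hi => ?_)
      fun i hi j hj hij => by_contra fun hne => ?_
    · obtain ⟨hlow, hhigh⟩ := abs_le.1 (hx i hi)
      refine Finset.mem_coe.2 (Finset.mem_Icc.2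
        ⟨Int.floor_nonneg.2 (div_nonneg (by linarith) hδ.le), Int.floor_mono ?_⟩)
      gcongr
      linarith
    · have hclose := Int.abs_sub_lt_one_of_floor_eq_floor hij
      rw [← sub_div, sub_sub_sub_cancel_right, abs_div, abs_of_pos hδ, div_lt_one hδ] at hclose
      exact hclose.not_ge (hz i hi j hj hne)
  have hfloor : 0 ≤ ⌊2 * ρ / δ⌋ := Int.floor_nonneg.2 (by positivity)
  rw [Int.card_Icc, sub_zero] at hinj
  calc (s.card : ℝ) ≤ ((⌊2 * ρ / δ⌋ + 1).toNat : ℤ) := by exact_mod_cast hinj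
    _ = ⌊2 * ρ / δ⌋ + 1 := by
        rw [Int.toNat_of_nonneg (by linarith)]
        push_cast
        rfl
    _ ≤ 2 * ρ / δ + 1 := by
        gcongr
        exact Int.floor_le _

theorem reduced_fraction_ext {p p' : ℕ} {m m' : ℤ} (hp : p ≠ 0) (hm : Int.gcd m p = 1)
    (hm' : Int.gcd m' p' = 1) (heq : m * p' = m' * p) : p = p' ∧ m = m' := by
  have hdvd : (p : ℤ) ∣ p' :=
    (Int.isCoprime_iff_gcd_eq_one.2 hm).symm.dvd_of_dvd_mul_left ⟨m', by rw [heq, mul_comm]⟩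
  have hdvd' : (p' : ℤ) ∣ p :=
    (Int.isCoprime_iff_gcd_eq_one.2 hm').symm.dvd_of_dvd_mul_left ⟨m, by rw [← heq, mul_comm]⟩
  obtain rfl : p = p' :=
    Nat.dvd_antisymm (Int.natCast_dvd_natCast.1 hdvd) (Int.natCast_dvd_natCast.1 hdvd')
  exact ⟨rfl, mul_right_cancel₀ (by exact_mod_cast hp) heq⟩

theorem separated_reduced_fractions {p p' : ℕ} {m m' : ℤ} (hp : 0 < p) (hp' : 0 < p')
    (hm : Int.gcd m p = 1) (hm' : Int.gcd m' p' = 1) (hne : ¬ (p = p' ∧ m = m')) {R Q : ℝ}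
    (hQ : 0 < Q) (hpR : p ≤ R) (hpR' : p' ≤ R) :
    (R ^ 2 * Q)⁻¹ ≤ |(m : ℝ) / (p * Q) - m' / (p' * Q)| := by
  have hnum : (1 : ℝ) ≤ |(m : ℝ) * p' - m' * p| := by
    exact_mod_cast Int.one_le_abs
      (sub_ne_zero.2 fun h => hne (reduced_fraction_ext hp.ne' hm hm' h))
  have hden : p * p' * Q ≤ R ^ 2 * Q := by
    rw [sq]
    have hR : (0 : ℝ) ≤ R := (Nat.cast_nonneg p).trans hpR
    gcongr
  calc (R ^ 2 * Q)⁻¹ ≤ (p * p' * Q)⁻¹ := by gcongr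
    _ ≤ |(m : ℝ) * p' - m' * p| / (p * p' * Q) := by
        rw [inv_eq_one_div]
        gcongr
    _ = |((m : ℝ) * p' - m' * p) / (p * p' * Q)| := by
        rw [abs_div, abs_of_pos (by positivity : 0 < p * p' * Q)]
    _ = |(m : ℝ) / (p * Q) - m' / (p' * Q)| := by
        congr 1
        field_simp

/-- The numerators in `reducedNumerators q p` of the fractions `m / (p Q)` within `ρ` of `x`. -/
noncomputable def nearNumerators (q Q x ρ : ℝ) (p : ℕ) : Finset ℤ :=
  (reducedNumerators q p).filter fun m => |(m : ℝ) / (p * Q) - x| ≤ ρ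

section NearNumerators

variable {P : Finset ℕ} {Q q ρ R : ℝ}

theorem gcd_eq_one_of_mem_nearNumerators {x : ℝ} {p : ℕ} {m : ℤ}
    (hm : m ∈ nearNumerators q Q x ρ p) : Int.gcd m p = 1 :=
  (Finset.mem_filter.1 (Finset.mem_filter.1 hm).1).2

theorem sum_card_nearNumerators_le (hQ : 0 < Q) (hpos : ∀ p ∈ P, 0 < p)
    (hpR : ∀ p ∈ P, (p : ℝ) ≤ R) (hR : 0 < R) (x : ℝ) (hρ : 0 ≤ ρ) :
    ∑ p ∈ P, ((nearNumerators q Q x ρ p).card : ℝ) ≤ 2 * ρ * (R ^ 2 * Q) + 1 := by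
  rw [← Nat.cast_sum, ← Finset.card_sigma, ← div_inv_eq_mul]
  refine card_le_of_separated _ (fun i : (Σ _ : ℕ, ℤ) => (i.2 : ℝ) / (i.1 * Q)) (x := x)
    (by positivity) hρ (fun i hi j hj hij => ?_)
    fun i hi => (Finset.mem_filter.1 (Finset.mem_sigma.1 hi).2).2
  obtain ⟨hiP, hi⟩ := Finset.mem_sigma.1 hi
  obtain ⟨hjP, hj⟩ := Finset.mem_sigma.1 hj
  exact separated_reduced_fractions (hpos _ hiP) (hpos _ hjP) (gcd_eq_one_of_mem_nearNumerators hi)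
    (gcd_eq_one_of_mem_nearNumerators hj) (fun h => hij (Sigma.ext h.1 (heq_of_eq h.2))) hQ
    (hpR _ hiP) (hpR _ hjP)

theorem card_nearNumerators_le {p : ℕ} (hQ : 0 < Q) (hp : 0 < p) (x : ℝ) (hρ : 0 ≤ ρ) :
    ((nearNumerators q Q x ρ p).card : ℝ) ≤ 2 * ρ * (p * Q) + 1 := by
  have hpQ : 0 < p * Q := by positivity
  rw [← div_inv_eq_mul]
  refine card_le_of_separated _ (fun m : ℤ => (m : ℝ) / (p * Q)) (x := x) (inv_pos.2 hpQ) hρ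
    (fun i _ j _ hij => ?_) fun m hm => (Finset.mem_filter.1 hm).2
  have hgap : (1 : ℝ) ≤ |(i : ℝ) - j| := by exact_mod_cast Int.one_le_abs (sub_ne_zero.2 hij)
  rw [← sub_div, abs_div, abs_of_pos hpQ, inv_eq_one_div]
  gcongr

theorem bumpSum_le {W A : ℝ} (hQ : 0 < Q) (hq : 0 < q) (hpos : ∀ p ∈ P, 0 < p)
    (hpR : ∀ p ∈ P, (p : ℝ) ≤ R) (hRQ : R ^ 2 * Q ≤ q) (hR : 0 < R)
    (hW : ∀ p ∈ P, ((P.card : ℝ) * (p.totient * Q))⁻¹ ≤ W) (hW0 : 0 ≤ W)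
    (hA : ∀ x, mollifier x ≤ A) (x : ℝ) : bumpSum P Q q x ≤ 3 * (W * (q * A)) := by
  have hA0 : 0 ≤ A := (mollifier_nonneg 0).trans (hA 0)
  have hcount : ∑ p ∈ P, ((nearNumerators q Q x q⁻¹ p).card : ℝ) ≤ 3 := by
    refine (sum_card_nearNumerators_le hQ hpos hpR hR x (by positivity)).trans ?_
    have hratio : q⁻¹ * (R ^ 2 * Q) ≤ 1 := inv_mul_le_one_of_le₀ hRQ hq.le
    linarith
  have hterm : ∀ p ∈ P, ∀ m : ℤ,
      ((P.card : ℝ) * (p.totient * Q))⁻¹ * scaledMollifier q (x - m / (p * Q)) ≤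
        if |(m : ℝ) / (p * Q) - x| ≤ q⁻¹ then W * (q * A) else 0 := fun p hp m => by
    split_ifs with hnear
    · exact mul_le_mul (hW p hp) (mul_le_mul_of_nonneg_left (hA _) hq.le)
        (scaledMollifier_nonneg hq _) hW0
    · rw [scaledMollifier_eq_zero hq (abs_sub_comm _ x ▸ (not_le.1 hnear).le), mul_zero]
  calc bumpSum P Q q x ≤ ∑ p ∈ P, (nearNumerators q Q x q⁻¹ p).card * (W * (q * A)) := by
        refine Finset.sum_le_sum fun p hp => (Finset.sum_le_sum fun m _ => hterm p hp m).trans ?_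
        rw [← Finset.sum_filter, Finset.sum_const, nsmul_eq_mul, nearNumerators]
    _ ≤ 3 * (W * (q * A)) := by
        rw [← Finset.sum_mul]
        gcongr

theorem integrable_scaledMollifier_sub (hq : 0 < q) (z : ℝ) :
    Integrable fun y => scaledMollifier q (y - z) :=
  ((scaledMollifier_contDiff q).continuous.integrable_of_hasCompactSupport
    (scaledMollifier_hasCompactSupport hq)).comp_sub_right z

theorem setIntegral_scaledMollifier_le (hq : 0 < q) (x r z : ℝ) :
    ∫ y in Metric.closedBall x r, scaledMollifier q (y - z) ≤
      if |z - x| ≤ r + q⁻¹ then 1 else 0 := by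
  split_ifs with hnear
  · calc ∫ y in Metric.closedBall x r, scaledMollifier q (y - z)
        ≤ ∫ y, scaledMollifier q (y - z) :=
          setIntegral_le_integral (integrable_scaledMollifier_sub hq z)
            (.of_forall fun _ => scaledMollifier_nonneg hq _)
      _ = 1 := by
          rw [integral_sub_right_eq_self (fun y => scaledMollifier q y),
            integral_scaledMollifier hq]
  · refine (setIntegral_eq_zero_of_forall_eq_zero fun y hy => scaledMollifier_eq_zero hq ?_).le
    rw [Metric.mem_closedBall, Real.dist_eq] at hy
    linarith [abs_sub_le z y x, abs_sub_comm z y]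

theorem setIntegral_bumpSum_le (hQ : 0 < Q) (hq : 0 < q) (x r : ℝ) :
    ∫ y in Metric.closedBall x r, bumpSum P Q q y ≤
      ∑ p ∈ P, ((P.card : ℝ) * (p.totient * Q))⁻¹ * (nearNumerators q Q x (r + q⁻¹) p).card := by
  have hint : ∀ z, IntegrableOn (fun y => scaledMollifier q (y - z)) (Metric.closedBall x r) :=
    fun z => (integrable_scaledMollifier_sub hq z).integrableOn
  unfold bumpSum
  rw [integral_finsetSum _ fun p _ => integrable_finsetSum _ fun m _ => (hint _).const_mul _]
  refine Finset.sum_le_sum fun p _ => ?_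
  rw [integral_finsetSum _ fun m _ => (hint _).const_mul _]
  simp_rw [integral_const_mul]
  rw [← Finset.mul_sum]
  gcongr
  rw [nearNumerators, Finset.card_filter, Nat.cast_sum]
  refine Finset.sum_le_sum fun m _ => (setIntegral_scaledMollifier_le hq x r _).trans ?_
  split_ifs <;> simp

end NearNumerators

theorem half_le_totient {p : ℕ} (hp : p = 1 ∨ p.Prime) : (p : ℝ) / 2 ≤ p.totient := by
  rcases hp with rfl | hp
  · norm_num
  · have htwo : (2 : ℝ) ≤ p := by exact_mod_cast hp.two_le
    rw [Nat.totient_prime hp, Nat.cast_sub hp.one_lt.le, Nat.cast_one]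
    linarith

section Stage

variable {γ β q ε : ℝ}

theorem rpow_div_four_le_totient {p : ℕ} (hγ : 0 ≤ γ) (hq : 0 < q)
    (hp : p ∈ denominators γ q) : q ^ γ / 4 ≤ p.totient := by
  linarith [(denominators_bounds hγ hq hp).1,
    half_le_totient (eq_one_or_prime_of_mem_denominators hp)]

theorem stage_weight_le {p : ℕ} (hγ : 0 ≤ γ) (hq : 0 < q)
    (hcard : q ^ (γ - ε) ≤ (denominators γ q).card) (hp : p ∈ denominators γ q) :
    (((denominators γ q).card : ℝ) * (p.totient * q ^ β))⁻¹ ≤ 4 * q ^ (-(2 * γ + β) + ε) := by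
  calc (((denominators γ q).card : ℝ) * (p.totient * q ^ β))⁻¹
      ≤ (q ^ (γ - ε) * (q ^ γ / 4 * q ^ β))⁻¹ := by
        gcongr
        exact rpow_div_four_le_totient hγ hq hp
    _ = 4 * (q ^ (γ - ε) * (q ^ γ * q ^ β))⁻¹ := by
        field_simp
    _ = 4 * q ^ (-(2 * γ + β) + ε) := by
        rw [← Real.rpow_add hq, ← Real.rpow_add hq, ← Real.rpow_neg hq.le]
        ring_nf

theorem rpow_sq_mul_rpow (hq : 0 < q) : (q ^ γ) ^ 2 * q ^ β = q ^ (2 * γ + β) := by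
  rw [Real.rpow_add hq, mul_comm 2 γ, Real.rpow_mul hq.le, Real.rpow_two]

theorem stage_le {A : ℝ} (hA : ∀ x, mollifier x ≤ A) (hγ : 0 ≤ γ) (hs : 2 * γ + β ≤ 1)
    (hq : 1 ≤ q) (hcard : q ^ (γ - ε) ≤ (denominators γ q).card) (x : ℝ) :
    stage γ β q x ≤ 12 * A * q ^ (1 - (2 * γ + β) + ε) := by
  have hq0 : 0 < q := one_pos.trans_le hq
  calc stage γ β q x ≤ 3 * (4 * q ^ (-(2 * γ + β) + ε) * (q * A)) := by
        refine bumpSum_le (R := q ^ γ) (by positivity) hq0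
          (fun p hp => pos_of_mem_denominators hp)
          (fun p hp => (denominators_bounds hγ hq0 hp).2) ?_ (by positivity)
          (fun p hp => stage_weight_le hγ hq0 hcard hp) (by positivity) hA x
        rw [rpow_sq_mul_rpow hq0]
        exact Real.rpow_le_self_of_one_le hq hs
    _ = 12 * A * (q ^ (-(2 * γ + β) + ε) * q ^ (1 : ℝ)) := by
        rw [Real.rpow_one]
        ring
    _ = 12 * A * q ^ (1 - (2 * γ + β) + ε) := by
        rw [← Real.rpow_add hq0]
        ring_nf

theorem setIntegral_stage_le_fine (hγ : 0 ≤ γ) (hs : 2 * γ + β ≤ 1) (hq : 1 ≤ q)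
    (hcard : q ^ (γ - ε) ≤ (denominators γ q).card) (x : ℝ) {r : ℝ} (hr : 0 ≤ r) :
    ∫ y in Metric.closedBall x r, stage γ β q y ≤
      4 * q ^ ε * (2 * r + 3 * q ^ (-(2 * γ + β))) := by
  have hq0 : 0 < q := one_pos.trans_le hq
  have hcount : ∑ p ∈ denominators γ q, ((nearNumerators q (q ^ β) x (r + q⁻¹) p).card : ℝ) ≤
      2 * (r + q⁻¹) * q ^ (2 * γ + β) + 1 := by
    rw [← rpow_sq_mul_rpow hq0]
    exact sum_card_nearNumerators_le (by positivity) (fun p hp => pos_of_mem_denominators hp)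
      (fun p hp => (denominators_bounds hγ hq0 hp).2) (by positivity) x (by positivity)
  have hinv : q⁻¹ ≤ q ^ (-(2 * γ + β)) := by
    rw [← Real.rpow_neg_one]
    exact Real.rpow_le_rpow_of_exponent_le hq (by linarith)
  calc ∫ y in Metric.closedBall x r, stage γ β q y
      ≤ ∑ p ∈ denominators γ q, (((denominators γ q).card : ℝ) * (p.totient * q ^ β))⁻¹ *
          (nearNumerators q (q ^ β) x (r + q⁻¹) p).card :=
        setIntegral_bumpSum_le (by positivity) hq0 x r
    _ ≤ 4 * q ^ (-(2 * γ + β) + ε) * (2 * (r + q⁻¹) * q ^ (2 * γ + β) + 1) := by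
        refine (Finset.sum_le_sum fun p hp => mul_le_mul_of_nonneg_right
          (stage_weight_le hγ hq0 hcard hp) (Nat.cast_nonneg _)).trans ?_
        rw [← Finset.mul_sum]
        gcongr
    _ = 4 * q ^ ε * (2 * (r + q⁻¹) + q ^ (-(2 * γ + β))) := by
        rw [Real.rpow_add hq0, Real.rpow_neg hq0.le]
        field_simp
    _ ≤ 4 * q ^ ε * (2 * r + 3 * q ^ (-(2 * γ + β))) := by
        refine mul_le_mul_of_nonneg_left ?_ (by positivity)
        linarith

theorem inv_mul_card_nearNumerators_le {p : ℕ} (hγ : 0 ≤ γ) (hlt : γ + β ≤ 1) (hq : 1 ≤ q)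
    (hp : p ∈ denominators γ q) (x : ℝ) {r : ℝ} (hr : 0 ≤ r) :
    (p.totient * q ^ β)⁻¹ * ((nearNumerators q (q ^ β) x (r + q⁻¹) p).card : ℝ) ≤
      4 * r + 8 * q ^ (-(γ + β)) := by
  have hq0 : 0 < q := one_pos.trans_le hq
  have htotient := half_le_totient (eq_one_or_prime_of_mem_denominators hp)
  have htotient' := rpow_div_four_le_totient hγ hq0 hp
  have hpos : 0 < (p.totient : ℝ) := lt_of_lt_of_le (by positivity) htotient'
  have hinv : q⁻¹ ≤ q ^ (-(γ + β)) := by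
    rw [← Real.rpow_neg_one]
    exact Real.rpow_le_rpow_of_exponent_le hq (by linarith)
  have hone : 1 ≤ p.totient * q ^ β * (4 * q ^ (-(γ + β))) := by
    calc 1 = q ^ γ / 4 * q ^ β * (4 * q ^ (-(γ + β))) := by
          rw [Real.rpow_neg hq0.le, Real.rpow_add hq0]
          field_simp
      _ ≤ p.totient * q ^ β * (4 * q ^ (-(γ + β))) := by gcongr
  rw [inv_mul_le_iff₀ (by positivity)]
  calc ((nearNumerators q (q ^ β) x (r + q⁻¹) p).card : ℝ)
      ≤ 2 * (r + q⁻¹) * (p * q ^ β) + 1 :=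
        card_nearNumerators_le (by positivity) (pos_of_mem_denominators hp) x (by positivity)
    _ = p / 2 * q ^ β * (4 * (r + q⁻¹)) + 1 := by ring
    _ ≤ p.totient * q ^ β * (4 * (r + q ^ (-(γ + β)))) +
          p.totient * q ^ β * (4 * q ^ (-(γ + β))) := by gcongr
    _ = p.totient * q ^ β * (4 * r + 8 * q ^ (-(γ + β))) := by ring

theorem setIntegral_stage_le_coarse (hγ : 0 ≤ γ) (hlt : γ + β ≤ 1) (hq : 1 ≤ q)
    (x : ℝ) {r : ℝ} (hr : 0 ≤ r) :
    ∫ y in Metric.closedBall x r, stage γ β q y ≤ 4 * r + 8 * q ^ (-(γ + β)) := by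
  have hq0 : 0 < q := one_pos.trans_le hq
  calc ∫ y in Metric.closedBall x r, stage γ β q y
      ≤ ∑ p ∈ denominators γ q, (((denominators γ q).card : ℝ) * (p.totient * q ^ β))⁻¹ *
          (nearNumerators q (q ^ β) x (r + q⁻¹) p).card :=
        setIntegral_bumpSum_le (by positivity) hq0 x r
    _ ≤ ∑ _p ∈ denominators γ q,
          ((denominators γ q).card : ℝ)⁻¹ * (4 * r + 8 * q ^ (-(γ + β))) := by
        refine Finset.sum_le_sum fun p hp => ?_
        rw [mul_inv, mul_assoc]
        gcongr
        exact inv_mul_card_nearNumerators_le hγ hlt hq hp x hr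
    _ = ((denominators γ q).card : ℝ) * ((denominators γ q).card : ℝ)⁻¹ *
          (4 * r + 8 * q ^ (-(γ + β))) := by
        rw [Finset.sum_const, nsmul_eq_mul, mul_assoc]
    _ ≤ 4 * r + 8 * q ^ (-(γ + β)) :=
        mul_le_of_le_one_left (by positivity) mul_inv_le_one

end Stage

section PrimeCount

variable {γ ε : ℝ}

theorem primeCounting_two_pow_succ_le (hγ : 0 < γ) (k : ℕ) :
    Nat.primeCounting (2 ^ (k + 1)) ≤ Nat.primeCounting (2 ^ k) +
      (denominators γ ((2 ^ (k + 1)) ^ γ⁻¹)).card := by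
  simp only [Nat.primeCounting, Nat.primeCounting', Nat.count_eq_card_filter_range]
  refine (Finset.card_le_card fun p hp => ?_).trans (Finset.card_union_le _ _)
  rw [Finset.mem_filter, Finset.mem_range, Nat.lt_succ_iff] at hp
  rw [Finset.mem_union, Finset.mem_filter, Finset.mem_range, Nat.lt_succ_iff,
    mem_denominators_of_pos hγ (by positivity), ← Real.rpow_mul (by positivity),
    inv_mul_cancel₀ hγ.ne', Real.rpow_one]
  rcases le_or_gt p (2 ^ k) with hle | hgt
  · exact .inl ⟨hle, hp.2⟩
  · have hlow : (2 : ℝ) ^ k ≤ p := by exact_mod_cast hgt.le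
    refine .inr ⟨hp.2, ?_, by exact_mod_cast hp.1⟩
    rw [pow_succ]
    linarith

theorem primeCounting_two_pow_add_le {b : ℝ} (hγ : 0 < γ) (hb : 1 ≤ b) {K : ℕ}
    (hcard : ∀ k ≥ K, ((denominators γ ((2 ^ k) ^ γ⁻¹)).card : ℝ) ≤ b ^ k) (n : ℕ) :
    (Nat.primeCounting (2 ^ (K + n)) : ℝ) ≤ Nat.primeCounting (2 ^ K) + n * b ^ (K + n) := by
  induction n with
  | zero => simp
  | succ n ih =>
    have hsucc : (Nat.primeCounting (2 ^ (K + n + 1)) : ℝ) ≤ Nat.primeCounting (2 ^ (K + n)) +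
        (denominators γ ((2 ^ (K + n + 1)) ^ γ⁻¹)).card := by
      exact_mod_cast primeCounting_two_pow_succ_le hγ (K + n)
    calc (Nat.primeCounting (2 ^ (K + n + 1)) : ℝ)
        ≤ Nat.primeCounting (2 ^ K) + n * b ^ (K + n) + b ^ (K + n + 1) :=
          hsucc.trans (add_le_add ih (hcard _ (by lia)))
      _ ≤ Nat.primeCounting (2 ^ K) + n * b ^ (K + n + 1) + b ^ (K + n + 1) := by
          gcongr _ + _ * ?_ + _
          exact pow_le_pow_right₀ hb (Nat.le_succ _)
      _ = Nat.primeCounting (2 ^ K) + (n + 1 : ℕ) * b ^ (K + (n + 1)) := by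
          push_cast
          ring

theorem two_pow_le_primeCounting_mul (k : ℕ) :
    (2 : ℝ) ^ k - (k + 1) ≤ Nat.primeCounting (2 ^ k) * k := by
  have hupper := Chebyshev.psi_le_primeCounting_mul_log (2 ^ k)
  have hlower := Chebyshev.psi_ge (2 ^ k)
  push_cast at hupper hlower
  have hlog : Real.log ((2 : ℝ) ^ k + 1) ≤ (k + 1) * Real.log 2 := by
    rw [← Nat.cast_succ, ← Real.log_pow]
    refine Real.log_le_log (by positivity) ?_
    rw [pow_succ]
    linarith [one_le_pow₀ (M₀ := ℝ) (n := k) one_le_two]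
  rw [Real.log_pow] at hupper
  refine le_of_mul_le_mul_right ?_ (Real.log_pos one_lt_two)
  linarith

theorem eventually_sq_mul_pow_add_lt_two_pow {b : ℝ} (hb0 : 0 ≤ b) (hb : b < 2) (c : ℝ) :
    ∀ᶠ k : ℕ in atTop, (k : ℝ) ^ 2 * b ^ k + c * k + 1 < 2 ^ k := by
  have hb' : |b / 2| < 1 := by
    rwa [abs_of_nonneg (by positivity), div_lt_one two_pos]
  have hhalf : |(1 / 2 : ℝ)| < 1 := by norm_num [abs_of_pos]
  have hlim := ((tendsto_pow_const_mul_const_pow_of_abs_lt_one 2 hb').add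
    ((tendsto_pow_const_mul_const_pow_of_abs_lt_one 1 hhalf).const_mul c)).add
    (tendsto_pow_const_mul_const_pow_of_abs_lt_one 0 hhalf)
  simp only [mul_zero, add_zero] at hlim
  filter_upwards [hlim.eventually (gt_mem_nhds one_pos)] with k hk
  rw [← div_lt_one (by positivity)]
  convert hk using 1
  rw [div_pow, div_pow]
  field_simp
  ring

/- If the dyadic blocks of primes `(2 ^ (k - 1), 2 ^ k]` were all of size less than
`2 ^ ((1 - ε / γ) k)` from some point on, then so would `π (2 ^ k)` be, up to a factor `k`. -/
theorem frequently_card_denominators_of_pos (hγ : 0 < γ) (hε : 0 < ε) (hεγ : ε ≤ γ) :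
    ∃ᶠ q in atTop, q ^ (γ - ε) ≤ (denominators γ q).card := by
  intro hfew
  set b : ℝ := 2 ^ (1 - ε / γ) with hb
  have hb1 : 1 ≤ b := Real.one_le_rpow one_le_two (sub_nonneg.2 ((div_le_one hγ).2 hεγ))
  have hb2 : b < 2 := by
    calc b < 2 ^ (1 : ℝ) :=
          Real.rpow_lt_rpow_of_exponent_lt one_lt_two (by linarith [div_pos hε hγ])
      _ = 2 := Real.rpow_one 2
  have hpow : ∀ k : ℕ, (((2 : ℝ) ^ k) ^ γ⁻¹) ^ (γ - ε) = b ^ k := fun k => by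
    rw [hb, ← Real.rpow_mul (by positivity), ← Real.rpow_natCast, ← Real.rpow_natCast,
      ← Real.rpow_mul (by positivity), ← Real.rpow_mul (by positivity)]
    congr 1
    field_simp
  have hscale : Tendsto (fun k : ℕ => ((2 : ℝ) ^ k) ^ γ⁻¹) atTop atTop :=
    (tendsto_rpow_atTop (inv_pos.2 hγ)).comp (tendsto_pow_atTop_atTop_of_one_lt one_lt_two)
  obtain ⟨K, hK⟩ := eventually_atTop.1 (hscale.eventually hfew)
  obtain ⟨k, hk, hKk⟩ := ((eventually_sq_mul_pow_add_lt_two_pow (zero_le_one.trans hb1) hb2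
    (1 + Nat.primeCounting (2 ^ K))).and (eventually_ge_atTop K)).exists
  obtain ⟨n, rfl⟩ := Nat.exists_eq_add_of_le hKk
  have hupper : (Nat.primeCounting (2 ^ (K + n)) : ℝ) ≤
      Nat.primeCounting (2 ^ K) + (K + n : ℕ) * b ^ (K + n) := by
    refine (primeCounting_two_pow_add_le hγ hb1
      (fun k hk => hpow k ▸ (not_le.1 (hK k hk)).le) n).trans ?_
    gcongr
    exact Nat.le_add_left n K
  have hmul := mul_le_mul_of_nonneg_right hupper (Nat.cast_nonneg (K + n))
  linarith [two_pow_le_primeCounting_mul (K + n)]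

theorem frequently_card_denominators (hγ : 0 ≤ γ) (hε : 0 < ε) (hεγ : 0 < γ → ε ≤ γ) :
    ∃ᶠ q in atTop, q ^ (γ - ε) ≤ (denominators γ q).card := by
  rcases hγ.eq_or_lt with rfl | hγ
  · refine Eventually.frequently ?_
    filter_upwards [eventually_ge_atTop (1 : ℝ)] with q hq
    simp only [denominators, if_true, Finset.card_singleton, Nat.cast_one]
    exact Real.rpow_le_one_of_one_le_of_nonpos hq (by linarith)
  · exact frequently_card_denominators_of_pos hγ hε (hεγ hγ)

end PrimeCount

/-- Smooth nonnegative functions vanishing outside `[0, 1]`: the densities of the approximating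
measures. -/
structure IsSmoothDensity (g : ℝ → ℝ) : Prop where
  contDiff : ContDiff ℝ ∞ g
  nonneg : ∀ x, 0 ≤ g x
  zero_off : ∀ x ∉ Icc (0 : ℝ) 1, g x = 0

namespace IsSmoothDensity

variable {g : ℝ → ℝ}

theorem hasCompactSupport (hg : IsSmoothDensity g) : HasCompactSupport g :=
  hasCompactSupport_of_zero_off_Icc hg.zero_off

theorem integrable (hg : IsSmoothDensity g) : Integrable g :=
  hg.contDiff.continuous.integrable_of_hasCompactSupport hg.hasCompactSupport

theorem contDiff_ofReal (hg : IsSmoothDensity g) : ContDiff ℝ ∞ fun x => (g x : ℂ) :=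
  Complex.ofRealCLM.contDiff.comp hg.contDiff

theorem ofReal_zero_off (hg : IsSmoothDensity g) : ∀ x ∉ Icc (0 : ℝ) 1, (g x : ℂ) = 0 :=
  fun x hx => by rw [hg.zero_off x hx, Complex.ofReal_zero]

theorem mul_stage (hg : IsSmoothDensity g) (γ β : ℝ) {q : ℝ} (hq : 0 < q) :
    IsSmoothDensity fun x => g x * stage γ β q x where
  contDiff := hg.contDiff.mul (bumpSum_contDiff _ _ _)
  nonneg x := mul_nonneg (hg.nonneg x) (bumpSum_nonneg _ (by positivity) hq x)
  zero_off x hx := by rw [hg.zero_off x hx, zero_mul]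

end IsSmoothDensity

theorem exists_isSmoothDensity_integral_eq_one : ∃ ψ, IsSmoothDensity ψ ∧ ∫ x, ψ x = 1 := by
  let f : ContDiffBump (1 / 2 : ℝ) := ⟨1 / 4, 1 / 2, by norm_num, by norm_num⟩
  refine ⟨f.normed volume, ⟨f.contDiff_normed, f.nonneg_normed, fun x hx => ?_⟩,
    f.integral_normed⟩
  by_contra hne
  have hball : x ∈ Metric.ball (1 / 2 : ℝ) (1 / 2) := by
    rw [← f.support_normed_eq (μ := volume)]
    exact hne
  rw [Real.ball_eq_Ioo, mem_Ioo] at hball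
  exact hx ⟨by linarith [hball.1], by linarith [hball.2]⟩

section NextScale

variable {γ β q q₀ ε ε₁ r M : ℝ} {g : ℝ → ℝ}

theorem setIntegral_mul_stage_le (hg : IsSmoothDensity g) (hq : 0 < q) (hM : ∀ x, g x ≤ M)
    (x r : ℝ) :
    ∫ y in Metric.closedBall x r, g y * stage γ β q y ≤
      M * ∫ y in Metric.closedBall x r, stage γ β q y := by
  rw [← integral_const_mul]
  have hc : Continuous (stage γ β q) := (bumpSum_contDiff _ _ _).continuous
  exact setIntegral_mono (hg.mul_stage γ β hq).integrable.integrableOn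
    ((continuous_const.mul hc).continuousOn.integrableOn_compact (isCompact_closedBall _ _))
    fun y => mul_le_mul_of_nonneg_right (hM y) (bumpSum_nonneg _ (by positivity) hq y)

theorem setIntegral_stage_nonneg (hq : 0 < q) (x r : ℝ) :
    0 ≤ ∫ y in Metric.closedBall x r, stage γ β q y :=
  setIntegral_nonneg measurableSet_closedBall fun y _ => bumpSum_nonneg _ (by positivity) hq y

theorem setIntegral_mul_stage_le_of_le (hγ : 0 ≤ γ) (hlt : γ + β ≤ 1) (hg : IsSmoothDensity g)
    (hq : 1 ≤ q) (hgM : ∀ x, g x ≤ M) (hr : 0 < r) (hM : M ≤ r ^ (-(1 - (2 * γ + β) + ε)))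
    (hqr : q ^ (-(γ + β)) ≤ r) (x : ℝ) :
    ∫ y in Metric.closedBall x (6 * r), g y * stage γ β q y ≤ 60 * r ^ (2 * γ + β - ε) := by
  have hq0 : 0 < q := one_pos.trans_le hq
  calc ∫ y in Metric.closedBall x (6 * r), g y * stage γ β q y
      ≤ M * ∫ y in Metric.closedBall x (6 * r), stage γ β q y :=
        setIntegral_mul_stage_le hg hq0 hgM x (6 * r)
    _ ≤ r ^ (-(1 - (2 * γ + β) + ε)) * (60 * r) := by
        refine mul_le_mul hM ?_ (setIntegral_stage_nonneg hq0 x _) (by positivity)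
        linarith [setIntegral_stage_le_coarse hγ hlt hq x (by positivity : 0 ≤ 6 * r)]
    _ = 60 * (r ^ (-(1 - (2 * γ + β) + ε)) * r ^ (1 : ℝ)) := by
        rw [Real.rpow_one]
        ring
    _ = 60 * r ^ (2 * γ + β - ε) := by
        rw [← Real.rpow_add hr]
        ring_nf

theorem setIntegral_mul_stage_le_of_ge (hγ : 0 ≤ γ) (hβ : 0 ≤ β) (hpos : 0 < γ + β)
    (hs : 2 * γ + β ≤ 1) (hg : IsSmoothDensity g) (hq : 1 ≤ q) (hgM : ∀ x, g x ≤ M)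
    (hε₁ : 0 < ε₁) (hεε₁ : 2 * ε₁ ≤ ε * (γ + β))
    (hcard : q ^ (γ - ε₁) ≤ (denominators γ q).card) (hM : M ≤ q ^ ε₁) (hr : q⁻¹ ≤ r)
    (hr1 : r ≤ 1) (hqr : r ≤ q ^ (-(γ + β))) (x : ℝ) :
    ∫ y in Metric.closedBall x (6 * r), g y * stage γ β q y ≤ 60 * r ^ (2 * γ + β - ε) := by
  have hq0 : 0 < q := one_pos.trans_le hq
  have hr0 : 0 < r := (inv_pos.2 hq0).trans_le hr
  have hle_rpow : r ≤ r ^ (2 * γ + β) := Real.self_le_rpow_of_le_one hr0.le hr1 hs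
  have hqs : q ^ (-(2 * γ + β)) ≤ r ^ (2 * γ + β) := by
    rw [Real.rpow_neg hq0.le, ← Real.inv_rpow hq0.le]
    exact Real.rpow_le_rpow (by positivity) hr (by positivity)
  have hqε : q ^ (2 * ε₁) ≤ r ^ (-ε) := by
    calc q ^ (2 * ε₁) = (q ^ (-(γ + β))) ^ (-(2 * ε₁ / (γ + β))) := by
          rw [← Real.rpow_mul hq0.le]
          congr 1
          field_simp
      _ ≤ r ^ (-(2 * ε₁ / (γ + β))) :=
          Real.rpow_le_rpow_of_nonpos hr0 hqr (neg_nonpos.2 (by positivity))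
      _ ≤ r ^ (-ε) := Real.rpow_le_rpow_of_exponent_ge hr0 hr1
          (neg_le_neg ((div_le_iff₀ hpos).2 hεε₁))
  calc ∫ y in Metric.closedBall x (6 * r), g y * stage γ β q y
      ≤ M * ∫ y in Metric.closedBall x (6 * r), stage γ β q y :=
        setIntegral_mul_stage_le hg hq0 hgM x (6 * r)
    _ ≤ q ^ ε₁ * (4 * q ^ ε₁ * (15 * r ^ (2 * γ + β))) := by
        refine mul_le_mul hM ((setIntegral_stage_le_fine hγ hs hq hcard x (by positivity)).trans
          (mul_le_mul_of_nonneg_left ?_ (by positivity))) (setIntegral_stage_nonneg hq0 x _)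
          (by positivity)
        linarith
    _ = 60 * (q ^ (2 * ε₁) * r ^ (2 * γ + β)) := by
        rw [two_mul ε₁, Real.rpow_add hq0]
        ring
    _ ≤ 60 * (r ^ (-ε) * r ^ (2 * γ + β)) := by gcongr
    _ = 60 * r ^ (2 * γ + β - ε) := by
        rw [← Real.rpow_add hr0]
        ring_nf

theorem setIntegral_mul_stage_le_rpow (hγ : 0 ≤ γ) (hβ : 0 ≤ β) (hpos : 0 < γ + β)
    (hs : 2 * γ + β ≤ 1) (hg : IsSmoothDensity g) (hq₀ : 1 ≤ q₀) (hε : 0 < ε)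
    (hgM : ∀ x, g x ≤ q₀ ^ (1 - (2 * γ + β) + ε)) (hq : 1 ≤ q) (hε₁ : 0 < ε₁)
    (hεε₁ : 2 * ε₁ ≤ ε * (γ + β)) (hcard : q ^ (γ - ε₁) ≤ (denominators γ q).card)
    (hM : q₀ ^ (1 - (2 * γ + β) + ε) ≤ q ^ ε₁) (x : ℝ) (hr : q⁻¹ ≤ r) (hr₀ : r ≤ q₀⁻¹) :
    ∫ y in Metric.closedBall x (6 * r), g y * stage γ β q y ≤ 60 * r ^ (2 * γ + β - ε) := by
  have hr0 : 0 < r := (inv_pos.2 (one_pos.trans_le hq)).trans_le hr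
  have hq₀0 : 0 < q₀ := one_pos.trans_le hq₀
  rcases le_total (q ^ (-(γ + β))) r with hqr | hqr
  · refine setIntegral_mul_stage_le_of_le hγ (by linarith) hg hq hgM hr0 ?_ hqr x
    rw [Real.rpow_neg hr0.le, ← Real.inv_rpow hr0.le]
    exact Real.rpow_le_rpow hq₀0.le ((le_inv_comm₀ hq₀0 hr0).2 hr₀) (by linarith)
  · exact setIntegral_mul_stage_le_of_ge hγ hβ hpos hs hg hq hgM hε₁ hεε₁ hcard hM hr
      (hr₀.trans (inv_le_one_of_one_le₀ hq₀)) hqr x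

theorem exists_small_exponent {a b c : ℝ} (ha : 0 < a) (hb : 0 < b) (hc : 0 < γ → 0 < c) :
    ∃ ε : ℝ, 0 < ε ∧ ε ≤ a ∧ ε ≤ b ∧ (0 < γ → ε ≤ c) := by
  rcases le_or_gt γ 0 with hγ | hγ
  · exact ⟨min a b, lt_min ha hb, min_le_left _ _, min_le_right _ _, fun h => absurd h hγ.not_gt⟩
  · exact ⟨min a (min b c), lt_min ha (lt_min hb (hc hγ)), min_le_left _ _,
      (min_le_right _ _).trans (min_le_left _ _),
      fun _ => (min_le_right _ _).trans (min_le_right _ _)⟩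

theorem eventually_mul_stage_le (hγ : 0 ≤ γ) (hs : 2 * γ + β ≤ 1) (hM : ∀ x, g x ≤ M)
    (hM0 : 0 ≤ M) {ε' : ℝ} (hε : ε < ε') :
    ∀ᶠ q in atTop, q ^ (γ - ε) ≤ (denominators γ q).card →
      ∀ x, g x * stage γ β q x ≤ q ^ (1 - (2 * γ + β) + ε') := by
  obtain ⟨A, _, hA⟩ := exists_mollifier_le
  filter_upwards [(tendsto_rpow_atTop (sub_pos.2 hε)).eventually_ge_atTop (M * (12 * A)),
    eventually_ge_atTop (1 : ℝ)] with q hqM hq hcard x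
  have hq0 : 0 < q := one_pos.trans_le hq
  calc g x * stage γ β q x ≤ M * (12 * A * q ^ (1 - (2 * γ + β) + ε)) :=
        mul_le_mul (hM x) (stage_le hA hγ hs hq hcard x)
          (bumpSum_nonneg _ (by positivity) hq0 x) hM0
    _ = M * (12 * A) * q ^ (1 - (2 * γ + β) + ε) := by ring
    _ ≤ q ^ (ε' - ε) * q ^ (1 - (2 * γ + β) + ε) := by gcongr
    _ = q ^ (1 - (2 * γ + β) + ε') := by
        rw [← Real.rpow_add hq0]
        ring_nf

theorem exists_next_scale (hγ : 0 ≤ γ) (hβ : 0 ≤ β) (hpos : 0 < γ + β)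
    (hs : 2 * γ + β ≤ 1) (hg : IsSmoothDensity g) {ε' δ : ℝ} (hq₀ : 1 ≤ q₀)
    (hε : 0 < ε) (hε1 : ε ≤ 1) (hgM : ∀ x, g x ≤ q₀ ^ (1 - (2 * γ + β) + ε)) (hε' : 0 < ε')
    {T : Set (ℝ → ℝ)} (hTfin : T.Finite) (hT : ∀ Φ ∈ T, ContDiff ℝ ∞ Φ) (hδ : 0 < δ) (B : ℝ) :
    ∃ q, B < q ∧ 1 ≤ q ∧ (∀ x, g x * stage γ β q x ≤ q ^ (1 - (2 * γ + β) + ε')) ∧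
      (∀ x r : ℝ, q⁻¹ ≤ r → r ≤ q₀⁻¹ →
        ∫ y in Metric.closedBall x (6 * r), g y * stage γ β q y ≤ 60 * r ^ (2 * γ + β - ε)) ∧
      (∀ Φ ∈ T, |(∫ x, Φ x * (g x * stage γ β q x)) - ∫ x, Φ x * g x| ≤ δ) ∧
      (0 < γ → ∀ ξ : ℝ, ‖𝓕 (fun x => ((g x * stage γ β q x : ℝ) : ℂ)) ξ -
        𝓕 (fun x => (g x : ℂ)) ξ‖ ≤ δ * (1 + |ξ|) ^ (-(γ * (1 - ε)))) := by
  obtain ⟨ε₁, hε₁, hε₁ε', hε₁s, hε₁γ⟩ := exists_small_exponent (γ := γ) (half_pos hε')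
    (half_pos (mul_pos hε hpos)) fun h => div_pos (mul_pos h hε) three_pos
  have hγε : 0 < γ → 3 * ε₁ ≤ γ := fun h => by
    linarith [hε₁γ h, mul_le_of_le_one_right h.le hε1]
  have htest : ∀ᶠ q : ℝ in atTop, ∀ Φ ∈ T, q ^ (γ - ε₁) ≤ (denominators γ q).card →
      |(∫ x, Φ x * g x * stage γ β q x) - ∫ x, Φ x * g x| ≤ δ :=
    (eventually_all_finite hTfin).2 fun Φ hΦ =>
      eventually_integral_mul_stage_sub_le hγ hβ hpos (by linarith) ((hT Φ hΦ).mul hg.contDiff)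
        (fun x hx => by rw [hg.zero_off x hx, mul_zero]) hε₁ hγε hδ
  have hfourier : ∀ᶠ q : ℝ in atTop, 0 < γ → q ^ (γ - ε₁) ≤ (denominators γ q).card →
      ∀ ξ, ‖𝓕 (fun x => (g x : ℂ) * stage γ β q x) ξ - 𝓕 (fun x => (g x : ℂ)) ξ‖ ≤
        δ * (1 + |ξ|) ^ (-(γ - 3 * ε₁)) :=
    eventually_imp_distrib_left.2 fun h => eventually_fourier_stage_sub_le h hβ (by linarith)
      hg.contDiff_ofReal hg.ofReal_zero_off hε₁ (hγε h) hδ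
  obtain ⟨q, hcard, hbound, hM, htest, hfourier, hB, hq⟩ :=
    ((frequently_card_denominators hγ hε₁ fun h => by linarith [hγε h]).and_eventually
      ((eventually_mul_stage_le hγ hs hgM (by positivity)
          (hε₁ε'.trans_lt (half_lt_self hε'))).and
        (((tendsto_rpow_atTop hε₁).eventually_ge_atTop _).and (htest.and (hfourier.and
          ((eventually_gt_atTop B).and (eventually_ge_atTop 1))))))).exists
  refine ⟨q, hB, hq, hbound hcard, fun x r => setIntegral_mul_stage_le_rpow hγ hβ hpos hs hg hq₀
    hε hgM hq hε₁ (by linarith) hcard hM x, fun Φ hΦ => ?_, fun h ξ => ?_⟩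
  · simpa only [mul_assoc] using htest Φ hΦ hcard
  · simp only [Complex.ofReal_mul]
    refine (hfourier h hcard ξ).trans ?_
    gcongr
    · exact le_add_of_nonneg_right (abs_nonneg ξ)
    · linarith [hε₁γ h]

end NextScale

/-! ### Construction of the scales -/

/-- A smooth cutoff equal to `1` on `[-2, 2]` and vanishing outside `[-3, 3]`. -/
noncomputable def cutoff : ContDiffBump (0 : ℝ) := ⟨2, 3, by norm_num, by norm_num⟩

/-- The cutoff rescaled to width `1 / n` around `m / n`; it is identically `1` for `n = m = 0`. -/
noncomputable def localCutoff (n : ℕ) (m : ℤ) (y : ℝ) : ℝ := cutoff (n * y - m)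

theorem localCutoff_contDiff (n : ℕ) (m : ℤ) : ContDiff ℝ ∞ (localCutoff n m) := by
  unfold localCutoff
  exact cutoff.contDiff.comp ((contDiff_const.mul contDiff_id).sub contDiff_const)

theorem localCutoff_nonneg (n : ℕ) (m : ℤ) (y : ℝ) : 0 ≤ localCutoff n m y := cutoff.nonneg

theorem localCutoff_le_one (n : ℕ) (m : ℤ) (y : ℝ) : localCutoff n m y ≤ 1 := cutoff.le_one

theorem norm_localCutoff_le_one (n : ℕ) (m : ℤ) (y : ℝ) : ‖localCutoff n m y‖ ≤ 1 := by
  rw [Real.norm_of_nonneg (localCutoff_nonneg n m y)]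
  exact localCutoff_le_one n m y

theorem localCutoff_zero_zero (y : ℝ) : localCutoff 0 0 y = 1 :=
  cutoff.one_of_mem_closedBall (by simp [cutoff])

theorem finite_setOf_localCutoff (q : ℝ) :
    {Φ | ∃ (n : ℕ) (m : ℤ), (n : ℝ) ≤ q ∧ |m| ≤ 3 * n ∧ localCutoff n m = Φ}.Finite := by
  refine (((finite_Iic ⌊q⌋₊).prod (finite_Icc (-(3 * (⌊q⌋₊ : ℤ))) (3 * ⌊q⌋₊))).image
    fun nm => localCutoff nm.1 nm.2).subset ?_
  rintro _ ⟨n, m, hn, hm, rfl⟩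
  have hn' : n ≤ ⌊q⌋₊ := Nat.le_floor hn
  rw [abs_le] at hm
  exact ⟨(n, m), ⟨hn', by dsimp only; omega, by dsimp only; omega⟩, rfl⟩

/-- The size condition on the density `g` at scale `q` under which stage `j + 1` can be built. -/
structure IsAdmissibleStage (γ β : ℝ) (j : ℕ) (q : ℝ) (g : ℝ → ℝ) : Prop where
  density : IsSmoothDensity g
  two_le : 2 ≤ q
  le_rpow : ∀ x, g x ≤ q ^ (1 - (2 * γ + β) + 1 / ((j : ℝ) + 1))

/-- The density `g'` at scale `q'` is a successor of the stage `j` density `g` at scale `q`: it is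
obtained by multiplying with the factor of scale `q'`, it obeys the Frostman bound at radii between
the two scales, and it is close to `g` both on the Fourier side and when tested against cutoffs. -/
structure IsNextStage (γ β : ℝ) (j : ℕ) (q : ℝ) (g : ℝ → ℝ) (q' : ℝ) (g' : ℝ → ℝ) : Prop where
  growth : q ^ (10 * (j + 1)) < q'
  eq_mul : ∀ x, g' x = g x * stage γ β q' x
  frostman : ∀ x r : ℝ, q'⁻¹ ≤ r → r ≤ q⁻¹ →
    ∫ y in Metric.closedBall x (6 * r), g' y ≤ 60 * r ^ (2 * γ + β - 1 / ((j : ℝ) + 1))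
  test : ∀ (n : ℕ) (m : ℤ), n ≤ q → |m| ≤ 3 * n →
    |(∫ x, localCutoff n m x * g' x) - ∫ x, localCutoff n m x * g x| ≤
      (2 ^ (j + 3))⁻¹ * (q ^ 2)⁻¹
  fourier : 0 < γ → ∀ ξ : ℝ, ‖𝓕 (fun x => (g' x : ℂ)) ξ - 𝓕 (fun x => (g x : ℂ)) ξ‖ ≤
    (2 ^ (j + 3))⁻¹ * (1 + |ξ|) ^ (-(γ * (1 - 1 / ((j : ℝ) + 1))))

/-- Lacunarity of the scales, in the strong form required of them in the theorem. -/
structure IsLacunary (q : ℕ → ℝ) : Prop where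
  two_le : ∀ i, 2 ≤ q i
  growth : ∀ i, q i ^ (10 * (i + 1)) < q (i + 1)

namespace IsLacunary

variable {q : ℕ → ℝ}

theorem one_lt (h : IsLacunary q) (i : ℕ) : 1 < q i :=
  one_lt_two.trans_le (h.two_le i)

theorem pos (h : IsLacunary q) (i : ℕ) : 0 < q i :=
  two_pos.trans_le (h.two_le i)

theorem strictMono (h : IsLacunary q) : StrictMono q :=
  strictMono_nat_of_lt_succ fun i =>
    (le_self_pow₀ (h.one_lt i).le (by omega)).trans_lt (h.growth i)

theorem tendsto_atTop (h : IsLacunary q) : Tendsto q atTop atTop := by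
  refine tendsto_atTop_mono (fun i => ?_) (tendsto_pow_atTop_atTop_of_one_lt (one_lt_two (α := ℝ)))
  induction i with
  | zero => simpa using (h.one_lt 0).le
  | succ i ih =>
    calc (2 : ℝ) ^ (i + 1) ≤ q i * q i := by
          rw [pow_succ]
          exact mul_le_mul ih (h.two_le i) zero_le_two (h.pos i).le
      _ = q i ^ 2 := (sq _).symm
      _ ≤ q i ^ (10 * (i + 1)) := pow_le_pow_right₀ (h.one_lt i).le (by omega)
      _ ≤ q (i + 1) := (h.growth i).le

theorem shift (h : IsLacunary q) : IsLacunary fun i => q (i + 1) where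
  two_le i := h.two_le (i + 1)
  growth i := (pow_le_pow_right₀ (h.one_lt _).le (by omega)).trans_lt (h.growth (i + 1))

end IsLacunary

/-- The scales and densities of the approximating measures. -/
structure DensitySequence (γ β : ℝ) (q : ℕ → ℝ) (g : ℕ → ℝ → ℝ) : Prop where
  admissible : ∀ j, IsAdmissibleStage γ β j (q j) (g j)
  integral_zero : ∫ x, g 0 x = 1
  next : ∀ j, IsNextStage γ β j (q j) (g j) (q (j + 1)) (g (j + 1))

section Construction

variable {γ β : ℝ}

theorem exists_isAdmissibleStage_zero (hs : 2 * γ + β ≤ 1) :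
    ∃ q g, IsAdmissibleStage γ β 0 q g ∧ ∫ x, g x = 1 := by
  obtain ⟨ψ, hψ, hψ1⟩ := exists_isSmoothDensity_integral_eq_one
  obtain ⟨A, hA⟩ := hψ.contDiff.continuous.bounded_above_of_compact_support hψ.hasCompactSupport
  refine ⟨max A 2, ψ, ⟨hψ, le_max_right _ _, fun x => ?_⟩, hψ1⟩
  have hle : ψ x ≤ max A 2 := (le_abs_self _).trans ((hA x).trans (le_max_left _ _))
  refine hle.trans (Real.self_le_rpow_of_one_le (one_le_two.trans (le_max_right _ _)) ?_)
  norm_num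
  linarith

theorem IsAdmissibleStage.exists_isNextStage (hγ : 0 ≤ γ) (hβ : 0 ≤ β) (hpos : 0 < γ + β)
    (hs : 2 * γ + β ≤ 1) {j : ℕ} {q : ℝ} {g : ℝ → ℝ} (h : IsAdmissibleStage γ β j q g) :
    ∃ q' g', IsAdmissibleStage γ β (j + 1) q' g' ∧ IsNextStage γ β j q g q' g' := by
  have hq : 1 ≤ q := one_le_two.trans h.two_le
  have hj : 1 / ((j : ℝ) + 1) ≤ 1 := by
    rw [div_le_one (by positivity)]
    linarith [Nat.cast_nonneg (α := ℝ) j]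
  obtain ⟨q', hqq', _, hle, hfrostman, htest, hfourier⟩ := exists_next_scale hγ hβ hpos hs
    h.density hq (by positivity) hj h.le_rpow (ε' := 1 / (((j + 1 : ℕ) : ℝ) + 1)) (by positivity)
    (finite_setOf_localCutoff q) (by rintro _ ⟨n, m, -, -, rfl⟩; exact localCutoff_contDiff n m)
    (δ := (2 ^ (j + 3) : ℝ)⁻¹ * (q ^ 2)⁻¹) (by positivity) (q ^ (10 * (j + 1)))
  have hq' : 2 ≤ q' := h.two_le.trans ((le_self_pow₀ hq (by omega)).trans hqq'.le)
  refine ⟨q', fun x => g x * stage γ β q' x, ⟨h.density.mul_stage γ β (by linarith), hq', hle⟩,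
    hqq', fun _ => rfl, hfrostman, fun n m hn hm => htest _ ⟨n, m, hn, hm, rfl⟩, fun hγ' ξ => ?_⟩
  refine (hfourier hγ' ξ).trans ?_
  gcongr
  exact mul_le_of_le_one_right (by positivity) (inv_le_one_of_one_le₀ (one_le_pow₀ hq))

theorem exists_densitySequence (hγ : 0 ≤ γ) (hβ : 0 ≤ β) (hpos : 0 < γ + β)
    (hs : 2 * γ + β ≤ 1) : ∃ q g, DensitySequence γ β q g := by
  obtain ⟨q₀, g₀, hadm₀, hint₀⟩ := exists_isAdmissibleStage_zero hs
  have hnext : ∀ (j : ℕ) (s : {s : ℝ × (ℝ → ℝ) // IsAdmissibleStage γ β j s.1 s.2}),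
      ∃ t : {t : ℝ × (ℝ → ℝ) // IsAdmissibleStage γ β (j + 1) t.1 t.2},
        IsNextStage γ β j s.1.1 s.1.2 t.1.1 t.1.2 := by
    rintro j ⟨_, hs'⟩
    obtain ⟨q', g', hadm, hstep⟩ := hs'.exists_isNextStage hγ hβ hpos hs
    exact ⟨⟨(q', g'), hadm⟩, hstep⟩
  choose next hnext using hnext
  let seq (j : ℕ) : {s : ℝ × (ℝ → ℝ) // IsAdmissibleStage γ β j s.1 s.2} :=
    Nat.rec ⟨(q₀, g₀), hadm₀⟩ next j
  exact ⟨fun j => (seq j).1.1, fun j => (seq j).1.2, fun j => (seq j).2, hint₀,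
    fun j => hnext j (seq j)⟩

end Construction

/-- The closed set of points within `1 / q` of the reduced fractions used at scale `q`. -/
def stageSet (γ β q : ℝ) : Set ℝ :=
  ⋃ p ∈ denominators γ q, progressionNhd q⁻¹ ((p : ℝ) * q ^ β) {m : ℤ | Int.gcd m p = 1}

theorem isClosed_stageSet (γ β q : ℝ) : IsClosed (stageSet γ β q) :=
  isClosed_biUnion_finset fun _ _ => Metric.isClosed_cthickening

theorem stage_eq_zero {γ β q x : ℝ} (hq : 0 < q) (hx : x ∉ stageSet γ β q) :
    stage γ β q x = 0 := by
  refine Finset.sum_eq_zero fun p hp => Finset.sum_eq_zero fun m hm => ?_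
  rw [scaledMollifier_eq_zero hq, mul_zero]
  by_contra hclose
  refine hx (mem_biUnion hp (Metric.mem_cthickening_of_dist_le x ((m : ℝ) / (p * q ^ β)) _ _
    ⟨m, (Finset.mem_filter.1 hm).2, rfl⟩ ?_))
  rw [Real.dist_eq]
  exact (not_le.1 hclose).le

theorem norm_sub_le_of_norm_succ_sub_le {E : Type*} [SeminormedAddCommGroup E] {u : ℕ → E} {c : ℝ}
    {j l : ℕ} (hc : 0 ≤ c) (hjl : j ≤ l)
    (h : ∀ i ≥ j, ‖u (i + 1) - u i‖ ≤ (2 ^ (i + 3))⁻¹ * c) : ‖u l - u j‖ ≤ c / 4 := by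
  rw [← dist_eq_norm, dist_comm]
  calc dist (u j) (u l) ≤ ∑ i ∈ Finset.Ico j l, (2 ^ (i + 3) : ℝ)⁻¹ * c :=
        dist_le_Ico_sum_of_dist_le hjl fun {i} hi _ => by
          rw [dist_comm, dist_eq_norm]
          exact h i hi
    _ ≤ ∑ i ∈ Finset.range l, (2 ^ (i + 3) : ℝ)⁻¹ * c :=
        Finset.sum_le_sum_of_subset_of_nonneg
          (fun i hi => Finset.mem_range.2 (Finset.mem_Ico.1 hi).2) fun _ _ _ => by positivity
    _ = c / 8 * ∑ i ∈ Finset.range l, (1 / 2 : ℝ) ^ i := by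
        rw [Finset.mul_sum]
        refine Finset.sum_congr rfl fun i _ => ?_
        rw [pow_add, one_div_pow]
        ring
    _ ≤ c / 8 * 2 := by gcongr; exact sum_geometric_two_le l
    _ = c / 4 := by ring

namespace DensitySequence

variable {γ β : ℝ} {q : ℕ → ℝ} {g : ℕ → ℝ → ℝ}

theorem density (h : DensitySequence γ β q g) (j : ℕ) : IsSmoothDensity (g j) :=
  (h.admissible j).density

theorem two_le (h : DensitySequence γ β q g) (j : ℕ) : 2 ≤ q j :=
  (h.admissible j).two_le

theorem isLacunary (h : DensitySequence γ β q g) : IsLacunary q :=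
  ⟨h.two_le, fun j => (h.next j).growth⟩

theorem pos (h : DensitySequence γ β q g) (j : ℕ) : 0 < q j :=
  h.isLacunary.pos j

theorem strictMono (h : DensitySequence γ β q g) : StrictMono q :=
  h.isLacunary.strictMono

theorem tendsto_atTop (h : DensitySequence γ β q g) : Tendsto q atTop atTop :=
  h.isLacunary.tendsto_atTop

theorem abs_integral_localCutoff_sub_le (h : DensitySequence γ β q g) {j l n : ℕ} {m : ℤ}
    (hn : n ≤ q j) (hm : |m| ≤ 3 * n) (hjl : j ≤ l) :
    |(∫ x, localCutoff n m x * g l x) - ∫ x, localCutoff n m x * g j x| ≤ (q j ^ 2)⁻¹ / 4 := by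
  refine norm_sub_le_of_norm_succ_sub_le (u := fun i => ∫ x, localCutoff n m x * g i x)
    (by positivity) hjl fun i hi => ?_
  have hqi : q j ≤ q i := h.strictMono.monotone hi
  have hqj := h.pos j
  refine ((h.next i).test n m (hn.trans hqi) hm).trans ?_
  gcongr

theorem half_le_integral (h : DensitySequence γ β q g) (j : ℕ) : 1 / 2 ≤ ∫ x, g j x := by
  have hsub := h.abs_integral_localCutoff_sub_le (n := 0) (m := 0)
    (by simpa using (h.pos 0).le) (by simp) (Nat.zero_le j)
  simp only [localCutoff_zero_zero, one_mul, h.integral_zero] at hsub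
  have hinv : (q 0 ^ 2)⁻¹ ≤ 1 :=
    inv_le_one_of_one_le₀ (one_le_pow₀ (one_le_two.trans (h.two_le 0)))
  linarith [(abs_le.1 hsub).1]

theorem eq_zero_off_stageSet (h : DensitySequence γ β q g) {i j : ℕ} (hij : i + 1 ≤ j) {x : ℝ}
    (hx : x ∉ stageSet γ β (q (i + 1))) : g j x = 0 := by
  induction j, hij using Nat.le_induction with
  | base => rw [(h.next i).eq_mul, stage_eq_zero (h.pos _) hx, mul_zero]
  | succ j _ ih => rw [(h.next j).eq_mul, ih, zero_mul]

end DensitySequence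

theorem exists_mapClusterPt_of_compl_eq_zero {E : Type*} [MeasurableSpace E] [TopologicalSpace E]
    [T2Space E] [BorelSpace E] {K : Set E} (hK : IsCompact K) {P : ℕ → ProbabilityMeasure E}
    (hP : ∀ j, P j Kᶜ = 0) : ∃ ν, MapClusterPt ν atTop P := by
  obtain ⟨ν, -, hν⟩ := (isCompact_setOfPred_probabilityMeasure_mass_eq_compl_isCompact_le
    (u := fun _ => 0) tendsto_const_nhds (fun _ => hK)
    (Or.inr monotone_const)).exists_mapClusterPt (f := atTop) (u := P)
    (by
      rw [le_principal_iff, mem_map]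
      exact Eventually.of_forall fun j _ => (hP j).le)
  exact ⟨ν, hν⟩

section ClusterPoint

variable {Ω ι : Type*} [MeasurableSpace Ω] [TopologicalSpace Ω] [OpensMeasurableSpace Ω]
  {l : Filter ι} {P : ι → ProbabilityMeasure Ω} {ν : ProbabilityMeasure Ω}

theorem norm_integral_le_of_mapClusterPt (hν : MapClusterPt ν l P)
    (f : BoundedContinuousFunction Ω ℂ) {B : ℝ}
    (hB : ∀ᶠ i in l, ‖∫ x, f x ∂(P i : Measure Ω)‖ ≤ B) :
    ‖∫ x, f x ∂(ν : Measure Ω)‖ ≤ B := by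
  obtain ⟨U, hUl, hU⟩ := mapClusterPt_iff_ultrafilter.1 hν
  exact le_of_tendsto
    ((ProbabilityMeasure.tendsto_iff_forall_integral_rclike_tendsto ℂ).1 hU f).norm (hUl hB)

theorem measure_compl_eq_zero_of_mapClusterPt [HasOuterApproxClosed Ω] (hν : MapClusterPt ν l P)
    {K : Set Ω} (hK : IsClosed K) (h : ∀ᶠ i in l, (P i : Measure Ω) Kᶜ = 0) :
    (ν : Measure Ω) Kᶜ = 0 := by
  obtain ⟨U, hUl, hU⟩ := mapClusterPt_iff_ultrafilter.1 hν
  refine le_antisymm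
    ((ProbabilityMeasure.le_liminf_measure_open_of_tendsto hU hK.isOpen_compl).trans ?_) zero_le
  exact liminf_le_of_frequently_le' ((h.filter_mono hUl).mono fun i hi => hi.le).frequently

end ClusterPoint

namespace IsSmoothDensity

variable {g : ℝ → ℝ}

/-- The probability measure with density `g / ∫ g`. -/
noncomputable def normalize (hg : IsSmoothDensity g) (hm : 0 < ∫ x, g x) :
    ProbabilityMeasure ℝ :=
  ⟨volume.withDensity fun x => ENNReal.ofReal (g x / ∫ y, g y), ⟨by
    rw [withDensity_apply _ MeasurableSet.univ, Measure.restrict_univ,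
      ← ofReal_integral_eq_lintegral_ofReal (hg.integrable.div_const _)
        (Eventually.of_forall fun x => div_nonneg (hg.nonneg x) hm.le),
      integral_div, div_self hm.ne', ENNReal.ofReal_one]⟩⟩

theorem integral_normalize (hg : IsSmoothDensity g) (hm : 0 < ∫ x, g x) (f : ℝ → ℂ) :
    ∫ x, f x ∂(hg.normalize hm : Measure ℝ) = (∫ x, g x)⁻¹ • ∫ x, f x * g x := by
  change ∫ x, f x ∂volume.withDensity (fun x => ((g x / ∫ y, g y).toNNReal : ENNReal)) = _
  rw [integral_withDensity_eq_integral_smul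
    (hg.contDiff.continuous.measurable.div_const _).real_toNNReal, ← integral_smul]
  congr 1 with x
  rw [NNReal.smul_def, Real.coe_toNNReal _ (div_nonneg (hg.nonneg x) hm.le), Complex.real_smul,
    Complex.real_smul]
  push_cast
  ring

theorem normalize_compl (hg : IsSmoothDensity g) (hm : 0 < ∫ x, g x) {K : Set ℝ}
    (hK : MeasurableSet K) (hgK : ∀ x ∉ K, g x = 0) : (hg.normalize hm : Measure ℝ) Kᶜ = 0 := by
  change volume.withDensity (fun x => ENNReal.ofReal (g x / ∫ y, g y)) Kᶜ = 0
  rw [withDensity_apply _ hK.compl,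
    setLIntegral_congr_fun (g := fun _ => 0) hK.compl fun x hx => by simp [hgK x hx],
    lintegral_zero]

end IsSmoothDensity

theorem measureFourier_eq (ν : Measure ℝ) (ξ : ℝ) :
    measureFourier ν ξ = ∫ x : ℝ, Complex.exp (↑(-2 * Real.pi * x * ξ) * Complex.I) ∂ν := by
  rw [measureFourier]
  congr 1 with x
  congr 1
  push_cast
  ring

theorem norm_measureFourier_le (ν : Measure ℝ) [IsFiniteMeasure ν] (ξ : ℝ) :
    ‖measureFourier ν ξ‖ ≤ ν.real univ := by
  rw [measureFourier_eq, ← one_mul (ν.real univ)]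
  exact norm_integral_le_of_norm_le_const
    (Eventually.of_forall fun x => (Complex.norm_exp_ofReal_mul_I _).le)

theorem measureReal_closedBall_le_integral_localCutoff (ν : Measure ℝ) [IsFiniteMeasure ν]
    {n : ℕ} {m : ℤ} {x r : ℝ} (hr : 0 < r) (hn : n ≤ 1 / r) (hm : |n * x - m| ≤ 1 / 2) :
    ν.real (Metric.closedBall x r) ≤ ∫ y, localCutoff n m y ∂ν := by
  have hone : ∀ y ∈ Metric.closedBall x r, localCutoff n m y = 1 := by
    intro y hy
    rw [Metric.mem_closedBall, Real.dist_eq] at hy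
    refine cutoff.one_of_mem_closedBall ?_
    rw [mem_closedBall_zero_iff, Real.norm_eq_abs]
    change _ ≤ (2 : ℝ)
    calc |n * y - m| = |n * (y - x) + (n * x - m)| := by ring_nf
      _ ≤ n * |y - x| + |n * x - m| := by
          refine (abs_add_le _ _).trans_eq ?_
          rw [abs_mul, Nat.abs_cast]
      _ ≤ 1 / r * r + 1 / 2 := by gcongr
      _ ≤ 2 := by rw [one_div_mul_cancel hr.ne']; norm_num
  have hint : Integrable (localCutoff n m) ν :=
    .of_bound (localCutoff_contDiff n m).continuous.aestronglyMeasurable 1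
      (Eventually.of_forall (norm_localCutoff_le_one n m))
  rw [← integral_indicator_one measurableSet_closedBall]
  refine integral_mono ((integrable_const 1).indicator measurableSet_closedBall) hint fun y => ?_
  exact indicator_le' (fun y hy => (hone y hy).ge) (fun y _ => localCutoff_nonneg n m y) y

theorem integral_localCutoff_mul_le {g : ℝ → ℝ} (hg : IsSmoothDensity g) {n : ℕ} {m : ℤ} {r : ℝ}
    (hr : 0 < r) (hn : 1 / (2 * r) ≤ n) :
    ∫ x, localCutoff n m x * g x ≤ ∫ x in Metric.closedBall (m / n : ℝ) (6 * r), g x := by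
  have hn0 : (0 : ℝ) < n := lt_of_lt_of_le (by positivity) hn
  have hzero : ∀ x ∉ Metric.closedBall (m / n : ℝ) (6 * r), localCutoff n m x = 0 := by
    intro x hx
    rw [Metric.mem_closedBall, Real.dist_eq, not_le] at hx
    refine cutoff.zero_of_le_dist ?_
    rw [dist_zero_right, Real.norm_eq_abs]
    change (3 : ℝ) ≤ _
    calc (3 : ℝ) = 1 / (2 * r) * (6 * r) := by field_simp; norm_num
      _ ≤ n * |x - m / n| := by gcongr
      _ = |n * x - m| := by rw [← Nat.abs_cast n, ← abs_mul, Nat.abs_cast]; congr 1; field_simp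
  rw [← integral_indicator measurableSet_closedBall]
  refine integral_mono_of_nonneg
    (Eventually.of_forall fun x => mul_nonneg (localCutoff_nonneg n m x) (hg.nonneg x))
    (hg.integrable.indicator measurableSet_closedBall) (Eventually.of_forall fun x => ?_)
  by_cases hx : x ∈ Metric.closedBall (m / n : ℝ) (6 * r)
  · rw [indicator_of_mem hx]
    exact mul_le_of_le_one_left (hg.nonneg x) (localCutoff_le_one n m x)
  · rw [indicator_of_notMem hx]
    dsimp only
    rw [hzero x hx, zero_mul]

theorem exists_localCutoff_parameters {x r : ℝ} (hx : |x| ≤ 2) (hr : 0 < r) (hr1 : r ≤ 1) :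
    ∃ (n : ℕ) (m : ℤ), 1 / (2 * r) ≤ n ∧ n ≤ 1 / r ∧ |m| ≤ 3 * n ∧ |n * x - m| ≤ 1 / 2 := by
  have hone : 1 ≤ 1 / r := by rwa [one_le_div hr]
  have hn : (1 : ℝ) ≤ ⌊1 / r⌋₊ := by exact_mod_cast (Nat.one_le_floor_iff _).2 hone
  have hround := abs_sub_round ((⌊1 / r⌋₊ : ℝ) * x)
  refine ⟨⌊1 / r⌋₊, round (⌊1 / r⌋₊ * x), ?_, Nat.floor_le (by positivity), ?_, hround⟩
  · have hlt := Nat.lt_floor_add_one (1 / r)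
    rw [mul_comm, ← div_div]
    linarith
  · have habs : |(round ((⌊1 / r⌋₊ : ℝ) * x) : ℝ)| ≤ 3 * ⌊1 / r⌋₊ := by
      calc |(round ((⌊1 / r⌋₊ : ℝ) * x) : ℝ)|
          ≤ |⌊1 / r⌋₊ * x - round (⌊1 / r⌋₊ * x)| + |⌊1 / r⌋₊ * x| := by
            rw [abs_sub_comm]
            exact sub_le_iff_le_add.1 (abs_sub_abs_le_abs_sub _ _)
        _ ≤ 1 / 2 + ⌊1 / r⌋₊ * 2 := by
            rw [abs_mul, Nat.abs_cast]
            gcongr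
        _ ≤ 3 * ⌊1 / r⌋₊ := by linarith
    exact_mod_cast habs

/-! ### The weak limit -/

/-- A probability measure with the properties of the weak limit: support in `[0, 1]` and in all the
stage sets, the Frostman condition, and Fourier decay. -/
structure IsLimitMeasure (γ β : ℝ) (q : ℕ → ℝ) (ν : Measure ℝ) : Prop where
  isProbabilityMeasure : IsProbabilityMeasure ν
  compl_Icc : ν (Icc (0 : ℝ) 1)ᶜ = 0
  compl_stageSet : ∀ i, ν (stageSet γ β (q i))ᶜ = 0
  ball : ∀ ε : ℝ, 0 < ε → ∃ C : ℝ, ∀ x r : ℝ, 0 < r → r ≤ 1 →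
    ν.real (Metric.closedBall x r) ≤ C * r ^ (2 * γ + β - ε)
  fourier : ∀ ε : ℝ, 0 < ε → ∃ C : ℝ, ∀ ξ : ℝ, 1 ≤ |ξ| →
    ‖measureFourier ν ξ‖ ≤ C * |ξ| ^ (-γ + ε)

namespace DensitySequence

variable {γ β : ℝ} {q : ℕ → ℝ} {g : ℕ → ℝ → ℝ}

theorem integral_pos (h : DensitySequence γ β q g) (j : ℕ) : 0 < ∫ x, g j x :=
  one_half_pos.trans_le (h.half_le_integral j)

/-- The normalised approximating measures, whose weak limit points are the measures sought. -/
noncomputable def approximant (h : DensitySequence γ β q g) (j : ℕ) : ProbabilityMeasure ℝ :=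
  (h.density j).normalize (h.integral_pos j)

theorem exists_mapClusterPt (h : DensitySequence γ β q g) :
    ∃ ν, MapClusterPt ν atTop h.approximant := by
  refine exists_mapClusterPt_of_compl_eq_zero (isCompact_Icc (a := (0 : ℝ)) (b := 1)) fun j => ?_
  rw [← ENNReal.coe_eq_zero, ProbabilityMeasure.ennreal_coeFn_eq_coeFn_toMeasure]
  exact (h.density j).normalize_compl _ measurableSet_Icc (h.density j).zero_off

theorem exists_scale (h : DensitySequence γ β q g) {j₀ : ℕ} {r : ℝ} (hr : 0 < r)
    (hr₀ : r < (q j₀)⁻¹) : ∃ j ≥ j₀, (q (j + 1))⁻¹ ≤ r ∧ r ≤ (q j)⁻¹ := by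
  have hex : ∃ J, (q J)⁻¹ ≤ r :=
    (h.tendsto_atTop.inv_tendsto_atTop.eventually (ge_mem_nhds hr)).exists
  classical
  have hlt : j₀ < Nat.find hex := (Nat.lt_find_iff hex j₀).2 fun i hi =>
    not_le.2 (hr₀.trans_le (inv_anti₀ (h.pos i) (h.strictMono.monotone hi)))
  obtain ⟨j, hj⟩ : ∃ j, Nat.find hex = j + 1 := ⟨Nat.find hex - 1, by omega⟩
  exact ⟨j, by omega, hj ▸ Nat.find_spec hex, (not_le.1 (Nat.find_min hex (by omega))).le⟩

theorem exists_norm_fourier_le (h : DensitySequence γ β q g) (hγ : 0 < γ) {e : ℝ} (he : -1 ≤ e)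
    {j₀ : ℕ} (hj₀ : -(γ * (1 - 1 / ((j₀ : ℝ) + 1))) ≤ e) :
    ∃ C, ∀ j ≥ j₀, ∀ ξ : ℝ, ‖𝓕 (fun x => (g j x : ℂ)) ξ‖ ≤ C * (1 + |ξ|) ^ e := by
  obtain ⟨C, hC0, hC⟩ := _root_.exists_norm_fourier_le (h.density j₀).contDiff_ofReal
    ((h.density j₀).hasCompactSupport.comp_left Complex.ofReal_zero) 1
  refine ⟨C + 1 / 4, fun j hj ξ => ?_⟩
  have hξ : 1 ≤ 1 + |ξ| := le_add_of_nonneg_right (abs_nonneg ξ)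
  have hbase : ‖𝓕 (fun x => (g j₀ x : ℂ)) ξ‖ ≤ C * (1 + |ξ|) ^ e := by
    refine (hC ξ).trans ?_
    gcongr
    rw [pow_one, ← Real.rpow_neg_one]
    exact Real.rpow_le_rpow_of_exponent_le hξ he
  have hstep : ∀ i ≥ j₀, ‖𝓕 (fun x => (g (i + 1) x : ℂ)) ξ - 𝓕 (fun x => (g i x : ℂ)) ξ‖ ≤
      (2 ^ (i + 3))⁻¹ * (1 + |ξ|) ^ e := by
    intro i hi
    refine ((h.next i).fourier hγ ξ).trans ?_
    gcongr ?_ * ?_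
    refine Real.rpow_le_rpow_of_exponent_le hξ (le_trans ?_ hj₀)
    gcongr
  have hsub := norm_sub_le_of_norm_succ_sub_le (u := fun i => 𝓕 (fun x => (g i x : ℂ)) ξ)
    (by positivity) hj hstep
  linarith [norm_sub_norm_le (𝓕 (fun x => (g j x : ℂ)) ξ) (𝓕 (fun x => (g j₀ x : ℂ)) ξ)]

section LimitMeasure

variable {h : DensitySequence γ β q g} {ν : ProbabilityMeasure ℝ}

theorem limit_compl_eq_zero (hν : MapClusterPt ν atTop h.approximant) {K : Set ℝ}
    (hK : IsClosed K) (j₀ : ℕ) (hg : ∀ j ≥ j₀, ∀ x ∉ K, g j x = 0) : (ν : Measure ℝ) Kᶜ = 0 :=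
  measure_compl_eq_zero_of_mapClusterPt hν hK <| (eventually_ge_atTop j₀).mono fun j hj =>
    (h.density j).normalize_compl _ hK.measurableSet (hg j hj)

theorem norm_integral_limit_le (hν : MapClusterPt ν atTop h.approximant) {f : ℝ → ℂ}
    (hf : Continuous f) {D B : ℝ} (hD : ∀ x, ‖f x‖ ≤ D) (j₀ : ℕ)
    (hB : ∀ j ≥ j₀, ‖∫ x, f x * g j x‖ ≤ B) : ‖∫ x, f x ∂(ν : Measure ℝ)‖ ≤ 2 * B := by
  refine norm_integral_le_of_mapClusterPt hν
    (BoundedContinuousFunction.ofNormedAddCommGroup f hf D hD) ?_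
  filter_upwards [eventually_ge_atTop j₀] with j hj
  change ‖∫ x, f x ∂(h.approximant j : Measure ℝ)‖ ≤ 2 * B
  have hinv : (∫ x, g j x)⁻¹ ≤ 2 := by
    rw [inv_le_comm₀ (h.integral_pos j) two_pos, ← one_div]
    exact h.half_le_integral j
  rw [approximant, (h.density j).integral_normalize, norm_smul,
    Real.norm_of_nonneg (inv_nonneg.2 (h.integral_pos j).le)]
  exact mul_le_mul hinv (hB j hj) (norm_nonneg _) two_pos.le

theorem integral_localCutoff_limit_le (hν : MapClusterPt ν atTop h.approximant) {n : ℕ} {m : ℤ}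
    {B : ℝ} (j₀ : ℕ) (hB : ∀ j ≥ j₀, ∫ x, localCutoff n m x * g j x ≤ B) :
    ∫ x, localCutoff n m x ∂(ν : Measure ℝ) ≤ 2 * B := by
  have hnorm := norm_integral_limit_le hν (f := fun x => (localCutoff n m x : ℂ))
    (Complex.continuous_ofReal.comp (localCutoff_contDiff n m).continuous) (D := 1) (B := B)
    (fun x => by rw [Complex.norm_real]; exact norm_localCutoff_le_one n m x) j₀ fun j hj => by
      simp only [← Complex.ofReal_mul]
      rw [integral_complex_ofReal, Complex.norm_real, Real.norm_of_nonneg (integral_nonneg fun x =>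
        mul_nonneg (localCutoff_nonneg n m x) ((h.density j).nonneg x))]
      exact hB j hj
  rw [integral_complex_ofReal, Complex.norm_real] at hnorm
  exact (le_abs_self _).trans hnorm

theorem limit_closedBall_le_of_abs_le (hν : MapClusterPt ν atTop h.approximant)
    (hs : 2 * γ + β ≤ 1) {j : ℕ} {x r : ℝ} (hx : |x| ≤ 2) (hrj : (q (j + 1))⁻¹ ≤ r)
    (hjr : r ≤ (q j)⁻¹) :
    (ν : Measure ℝ).real (Metric.closedBall x r) ≤
      122 * r ^ (2 * γ + β - 1 / ((j : ℝ) + 1)) := by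
  have hr : 0 < r := lt_of_lt_of_le (inv_pos.2 (h.pos _)) hrj
  have hr1 : r ≤ 1 := hjr.trans (inv_le_one_of_one_le₀ (one_le_two.trans (h.two_le j)))
  obtain ⟨n, m, hnr, hrn, hm, hnm⟩ := exists_localCutoff_parameters hx hr hr1
  have hnq : (n : ℝ) ≤ q (j + 1) := by
    refine hrn.trans ?_
    rw [one_div]
    exact inv_le_of_inv_le₀ (h.pos _) hrj
  have herr : (q (j + 1) ^ 2)⁻¹ ≤ r ^ (2 * γ + β - 1 / ((j : ℝ) + 1)) := by
    have hj : 0 < 1 / ((j : ℝ) + 1) := by positivity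
    rw [← inv_pow]
    calc (q (j + 1))⁻¹ ^ 2 ≤ r ^ 2 := pow_le_pow_left₀ (inv_pos.2 (h.pos _)).le hrj 2
      _ = r ^ (2 : ℝ) := (Real.rpow_two r).symm
      _ ≤ _ := Real.rpow_le_rpow_of_exponent_ge hr hr1 (by linarith)
  have hstage : ∀ l ≥ j + 1, ∫ y, localCutoff n m y * g l y ≤
      61 * r ^ (2 * γ + β - 1 / ((j : ℝ) + 1)) := by
    intro l hl
    have hnext := (integral_localCutoff_mul_le (h.density (j + 1)) (m := m) hr hnr).trans
      ((h.next j).frostman _ r hrj hjr)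
    have hpow : 0 < r ^ (2 * γ + β - 1 / ((j : ℝ) + 1)) := by positivity
    linarith [(abs_le.1 (h.abs_integral_localCutoff_sub_le hnq hm hl)).2]
  calc (ν : Measure ℝ).real (Metric.closedBall x r) ≤ ∫ y, localCutoff n m y ∂(ν : Measure ℝ) :=
        measureReal_closedBall_le_integral_localCutoff _ hr hrn hnm
    _ ≤ 2 * (61 * r ^ (2 * γ + β - 1 / ((j : ℝ) + 1))) :=
        integral_localCutoff_limit_le hν _ hstage
    _ = 122 * r ^ (2 * γ + β - 1 / ((j : ℝ) + 1)) := by ring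

theorem limit_closedBall_le (hν : MapClusterPt ν atTop h.approximant) (hs : 2 * γ + β ≤ 1)
    {j : ℕ} {x r : ℝ} (hrj : (q (j + 1))⁻¹ ≤ r) (hjr : r ≤ (q j)⁻¹) :
    (ν : Measure ℝ).real (Metric.closedBall x r) ≤
      122 * r ^ (2 * γ + β - 1 / ((j : ℝ) + 1)) := by
  by_cases hx : |x| ≤ 2
  · exact limit_closedBall_le_of_abs_le hν hs hx hrj hjr
  have hr : 0 < r := lt_of_lt_of_le (inv_pos.2 (h.pos _)) hrj
  have hr1 : r ≤ 1 := hjr.trans (inv_le_one_of_one_le₀ (one_le_two.trans (h.two_le j)))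
  have hdisj : Metric.closedBall x r ⊆ (Icc (0 : ℝ) 1)ᶜ := by
    rintro y hy ⟨hy0, hy1⟩
    rw [Metric.mem_closedBall, Real.dist_eq, abs_le] at hy
    exact hx (abs_le.2 ⟨by linarith, by linarith⟩)
  rw [measureReal_def, measure_mono_null hdisj
    (limit_compl_eq_zero hν isClosed_Icc 0 fun j _ => (h.density j).zero_off), ENNReal.toReal_zero]
  positivity

theorem exists_limit_closedBall_le (hν : MapClusterPt ν atTop h.approximant) (hγ : 0 ≤ γ)
    (hβ : 0 ≤ β) (hs : 2 * γ + β ≤ 1) {ε : ℝ} (hε : 0 < ε) :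
    ∃ C : ℝ, ∀ x r : ℝ, 0 < r → r ≤ 1 →
      (ν : Measure ℝ).real (Metric.closedBall x r) ≤ C * r ^ (2 * γ + β - ε) := by
  obtain ⟨j₀, hj₀⟩ := exists_nat_one_div_lt hε
  refine ⟨max (q j₀ ^ (2 * γ + β)) 122, fun x r hr hr1 => ?_⟩
  rcases le_or_gt (q j₀)⁻¹ r with hle | hlt
  · have hq := h.pos j₀
    calc (ν : Measure ℝ).real (Metric.closedBall x r) ≤ 1 := measureReal_le_one
      _ = q j₀ ^ (2 * γ + β) * (q j₀)⁻¹ ^ (2 * γ + β) := by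
          rw [← Real.mul_rpow hq.le (by positivity), mul_inv_cancel₀ hq.ne', Real.one_rpow]
      _ ≤ q j₀ ^ (2 * γ + β) * r ^ (2 * γ + β) := by gcongr
      _ ≤ max (q j₀ ^ (2 * γ + β)) 122 * r ^ (2 * γ + β - ε) := by
          gcongr ?_ * ?_
          · exact le_max_left _ _
          · exact Real.rpow_le_rpow_of_exponent_ge hr hr1 (by linarith)
  · obtain ⟨j, hj, hrj, hjr⟩ := h.exists_scale hr hlt
    have hjε : 1 / ((j : ℝ) + 1) ≤ ε := le_trans (by gcongr) hj₀.le
    calc (ν : Measure ℝ).real (Metric.closedBall x r)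
        ≤ 122 * r ^ (2 * γ + β - 1 / ((j : ℝ) + 1)) := limit_closedBall_le hν hs hrj hjr
      _ ≤ max (q j₀ ^ (2 * γ + β)) 122 * r ^ (2 * γ + β - ε) := by
          gcongr ?_ * ?_
          · exact le_max_right _ _
          · exact Real.rpow_le_rpow_of_exponent_ge hr hr1 (by linarith)

theorem exists_norm_measureFourier_limit_le (hν : MapClusterPt ν atTop h.approximant)
    (hγ : 0 < γ) {ε : ℝ} (hε : 0 < ε) (hεγ : ε ≤ γ) (hγ1 : γ ≤ 1) :
    ∃ C : ℝ, ∀ ξ : ℝ, 1 ≤ |ξ| → ‖measureFourier (ν : Measure ℝ) ξ‖ ≤ C * |ξ| ^ (-γ + ε) := by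
  obtain ⟨j₀, hj₀⟩ := exists_nat_one_div_lt (div_pos hε hγ)
  rw [lt_div_iff₀ hγ] at hj₀
  obtain ⟨C, hC⟩ := h.exists_norm_fourier_le hγ (e := -γ + ε) (by linarith) (j₀ := j₀)
    (by linarith)
  refine ⟨2 * C, fun ξ hξ => ?_⟩
  have hC0 : 0 ≤ C := nonneg_of_mul_nonneg_left ((norm_nonneg _).trans (hC j₀ le_rfl ξ))
    (by positivity)
  rw [measureFourier_eq, mul_assoc]
  refine norm_integral_limit_le hν (by fun_prop)
    (fun x => (Complex.norm_exp_ofReal_mul_I _).le) j₀ fun j hj => ?_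
  have hfourier := hC j hj ξ
  rw [Real.fourier_real_eq_integral_exp_smul] at hfourier
  simp only [smul_eq_mul] at hfourier
  refine hfourier.trans ?_
  gcongr C * ?_
  exact Real.rpow_le_rpow_of_nonpos (by linarith) (by linarith) (by linarith)

end LimitMeasure

theorem exists_isLimitMeasure (h : DensitySequence γ β q g) (hγ : 0 ≤ γ) (hβ : 0 ≤ β)
    (hs : 2 * γ + β ≤ 1) : ∃ ν, IsLimitMeasure γ β (fun i => q (i + 1)) ν := by
  obtain ⟨ν, hν⟩ := h.exists_mapClusterPt
  refine ⟨ν, inferInstance, limit_compl_eq_zero hν isClosed_Icc 0 fun j _ => (h.density j).zero_off,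
    fun i => limit_compl_eq_zero hν (isClosed_stageSet _ _ _) (i + 1) fun j hj x hx =>
      h.eq_zero_off_stageSet hj hx, fun ε hε => exists_limit_closedBall_le hν hγ hβ hs hε,
    fun ε hε => ?_⟩
  rcases hγ.eq_or_lt with rfl | hγ
  · refine ⟨1, fun ξ hξ => (norm_measureFourier_le _ ξ).trans ?_⟩
    rw [one_mul, probReal_univ]
    exact Real.one_le_rpow hξ (by linarith)
  · obtain ⟨C, hC⟩ := exists_norm_measureFourier_limit_le hν hγ (lt_min hε hγ) (min_le_right ε γ)
      (by linarith)
    refine ⟨|C|, fun ξ hξ => (hC ξ hξ).trans ?_⟩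
    gcongr
    exacts [le_abs_self C, min_le_left ε γ]

end DensitySequence

section MeasureFourier

variable {c : ℝ}

theorem tsum_int_div_sub_eq_tsum_fourier (f : 𝓢(ℝ, ℂ)) (hc : 0 < c) (x : ℝ) :
    ∑' m : ℤ, f (m / c - x) =
      ∑' k : ℤ, c * 𝓕 f (k * c) * Complex.exp (↑(-2 * Real.pi * x * (k * c)) * Complex.I) := by
  have hpoisson := tsum_int_div_eq_tsum_fourier (rescale f one_ne_zero x) hc
  simp only [rescale_apply, one_mul, fourier_rescale f one_pos, inv_one, Complex.ofReal_one,
    div_one, ← tsum_mul_left] at hpoisson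
  exact hpoisson.trans (tsum_congr fun k => by ring)

theorem norm_mul_exp_ofReal_mul_I (z : ℂ) (t : ℝ) : ‖z * Complex.exp (t * Complex.I)‖ = ‖z‖ := by
  rw [norm_mul, Complex.norm_exp_ofReal_mul_I, mul_one]

theorem summable_norm_mul_fourier_int_mul (f : 𝓢(ℝ, ℂ)) (hc : c ≠ 0) :
    Summable fun k : ℤ => ‖c * 𝓕 f (k * c)‖ :=
  ((summable_schwartz_int_mul (𝓕 f) hc).mul_left (c : ℂ)).norm

theorem integrable_tsum_int_div_sub (f : 𝓢(ℝ, ℂ)) (hc : 0 < c) (μ : Measure ℝ)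
    [IsFiniteMeasure μ] : Integrable (fun x => ∑' m : ℤ, f (m / c - x)) μ := by
  have hsum := summable_norm_mul_fourier_int_mul f hc.ne'
  have hbound := fun (k : ℤ) (x : ℝ) =>
    (norm_mul_exp_ofReal_mul_I (c * 𝓕 f (k * c)) (-2 * Real.pi * x * (k * c))).le
  simp only [tsum_int_div_sub_eq_tsum_fourier f hc]
  refine .of_bound (continuous_tsum (fun k => by fun_prop) hsum hbound).aestronglyMeasurable _
    (.of_forall fun x => tsum_of_norm_bounded hsum.hasSum fun k => hbound k x)

theorem integral_tsum_int_div_sub (f : 𝓢(ℝ, ℂ)) (hc : 0 < c) (μ : Measure ℝ)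
    [IsFiniteMeasure μ] :
    ∫ x, ∑' m : ℤ, f (m / c - x) ∂μ = ∑' k : ℤ, c * 𝓕 f (k * c) * measureFourier μ (k * c) := by
  simp only [tsum_int_div_sub_eq_tsum_fourier f hc, measureFourier_eq, ← integral_const_mul]
  refine (integral_tsum_of_summable_integral_norm (fun k => ?_) ?_).symm
  · exact .of_bound (by fun_prop) _ (.of_forall fun x => (norm_mul_exp_ofReal_mul_I _ _).le)
  · simp only [norm_mul_exp_ofReal_mul_I, integral_const, smul_eq_mul]
    exact (summable_norm_mul_fourier_int_mul f hc.ne').mul_left _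

end MeasureFourier

theorem exists_abs_sub_le_of_mem_progressionNhd {δ c x : ℝ} {S : Set ℤ} (hδ : 0 < δ)
    (hx : x ∈ progressionNhd δ c S) : ∃ m ∈ S, |m / c - x| ≤ 2 * δ := by
  obtain ⟨_, ⟨m, hm, rfl⟩, hdist⟩ := Metric.mem_thickening_iff.1
    (Metric.cthickening_subset_thickening' (by positivity) (by linarith : δ < 2 * δ) _ hx)
  exact ⟨m, hm, by rw [← Real.dist_eq, dist_comm]; exact hdist.le⟩

/-- The cutoff function as a complex-valued Schwartz function. -/
noncomputable def schwartzCutoff : 𝓢(ℝ, ℂ) :=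
  (cutoff.hasCompactSupport.comp_left Complex.ofReal_zero).toSchwartzMap
    (Complex.ofRealCLM.contDiff.comp cutoff.contDiff)

theorem schwartzCutoff_apply (x : ℝ) : schwartzCutoff x = cutoff x := rfl

section ProgressionNhd

variable {q c : ℝ}

theorem one_le_tsum_cutoff (hq : 0 < q) (hc : 0 < c) {x : ℝ}
    (hx : x ∈ progressionNhd q⁻¹ c univ) : 1 ≤ ∑' m : ℤ, cutoff (q * (m / c - x)) := by
  have hsum : Summable fun m : ℤ => cutoff (q * (m / c - x)) := by
    refine Complex.summable_ofReal.1 <| (summable_schwartz_int_mul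
      (rescale schwartzCutoff hq.ne' x) (inv_ne_zero hc.ne')).congr fun m => ?_
    rw [rescale_apply, schwartzCutoff_apply, div_eq_mul_inv]
  obtain ⟨m, -, hm⟩ := exists_abs_sub_le_of_mem_progressionNhd (inv_pos.2 hq) hx
  refine le_trans (cutoff.one_of_mem_closedBall ?_).ge
    (hsum.le_tsum m fun _ _ => cutoff.nonneg)
  rw [mem_closedBall_zero_iff, Real.norm_eq_abs, abs_mul, abs_of_pos hq]
  change _ ≤ (2 : ℝ)
  calc q * |m / c - x| ≤ q * (2 * q⁻¹) := by gcongr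
    _ = 2 := by field_simp

theorem measureReal_progressionNhd_le_integral (hq : 0 < q) (hc : 0 < c) (μ : Measure ℝ)
    [IsFiniteMeasure μ] : μ.real (progressionNhd q⁻¹ c univ) ≤
      ‖∫ x, ∑' m : ℤ, rescale schwartzCutoff hq.ne' 0 (m / c - x) ∂μ‖ := by
  set g : ℝ → ℝ := fun x => ∑' m : ℤ, cutoff (q * (m / c - x))
  have hg : ∀ x, ∑' m : ℤ, rescale schwartzCutoff hq.ne' 0 (m / c - x) = (g x : ℂ) := fun x => by
    simp only [g, rescale_apply, schwartzCutoff_apply, sub_zero, Complex.ofReal_tsum]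
  have hgint : Integrable g μ := by
    simpa only [hg, RCLike.re_to_complex, Complex.ofReal_re] using
      (integrable_tsum_int_div_sub (rescale schwartzCutoff hq.ne' 0) hc μ).re
  have hg0 : ∀ x, 0 ≤ g x := fun x => tsum_nonneg fun _ => cutoff.nonneg
  have hmeas : MeasurableSet (progressionNhd q⁻¹ c univ) :=
    Metric.isClosed_cthickening.measurableSet
  simp only [hg]
  rw [integral_complex_ofReal, Complex.norm_real, ← integral_indicator_one hmeas]
  refine (integral_mono_of_nonneg (.of_forall (indicator_nonneg fun _ _ => zero_le_one)) hgint
    (.of_forall (indicator_le' (fun x hx => ?_) fun x _ => hg0 x))).trans (le_abs_self _)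
  exact one_le_tsum_cutoff hq hc hx

theorem inv_one_add_sq_le_rpow_neg {u s : ℝ} (hu : 0 < u) (hs0 : 0 ≤ s) (hs2 : s ≤ 2) :
    ((1 + u) ^ 2)⁻¹ ≤ u ^ (-s) := calc
  ((1 + u) ^ 2)⁻¹ = (1 + u) ^ (-2 : ℝ) := by
    rw [Real.rpow_neg (by positivity), Real.rpow_two]
  _ ≤ (1 + u) ^ (-s) := Real.rpow_le_rpow_of_exponent_le (by linarith) (by linarith)
  _ ≤ u ^ (-s) := Real.rpow_le_rpow_of_nonpos hu (by linarith) (by linarith)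

theorem norm_fourier_mul_measureFourier_le {D : ℝ} {ψ : ℝ → ℂ}
    (hD : ∀ ξ, ‖ψ ξ‖ ≤ D * ((1 + |ξ|) ^ 2)⁻¹) {a η : ℝ} (ha : 0 < a) (ha2 : a ≤ 1 / 2)
    (hη : 0 < η) (hη1 : η ≤ 1) {μ : Measure ℝ} {C : ℝ}
    (hC : ∀ ξ : ℝ, ξ ≠ 0 → ‖measureFourier μ ξ‖ ≤ C * |ξ| ^ (-a)) (hq : 0 < q) {ξ : ℝ}
    (hξ : ξ ≠ 0) :
    ‖ψ (ξ / q)‖ * ‖measureFourier μ ξ‖ ≤ D * (C * q ^ (-a)) * |ξ / q| ^ (-(1 + η)) := by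
  have hD0 : 0 ≤ D := nonneg_of_forall_norm_le_mul_inv hD
  set u := |ξ / q|
  have hu : 0 < u := abs_pos.2 (div_ne_zero hξ hq.ne')
  have hψ : ‖ψ (ξ / q)‖ ≤ D * u ^ (-(1 + η - a)) := (hD _).trans <| by
    gcongr
    exact inv_one_add_sq_le_rpow_neg hu (by linarith) (by linarith)
  have hμ : ‖measureFourier μ ξ‖ ≤ C * (u * q) ^ (-a) := by
    have huq : |ξ / q| * q = |ξ| := by
      rw [abs_div, abs_of_pos hq, div_mul_cancel₀ _ hq.ne']
    exact huq.symm ▸ hC ξ hξ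
  calc ‖ψ (ξ / q)‖ * ‖measureFourier μ ξ‖
      ≤ D * u ^ (-(1 + η - a)) * (C * (u * q) ^ (-a)) := by gcongr
    _ = D * (C * q ^ (-a)) * (u ^ (-(1 + η - a)) * u ^ (-a)) := by
        rw [Real.mul_rpow hu.le hq.le]
        ring
    _ = D * (C * q ^ (-a)) * u ^ (-(1 + η)) := by
        rw [← Real.rpow_add hu]
        ring_nf

theorem norm_mul_fourier_mul_measureFourier_le {f : 𝓢(ℝ, ℂ)} {D : ℝ}
    (hD : ∀ ξ, ‖𝓕 f ξ‖ ≤ D * ((1 + ‖ξ‖) ^ 2)⁻¹) {a η : ℝ} (ha : 0 < a)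
    (ha2 : a ≤ 1 / 2) (hη : 0 < η) (hη1 : η ≤ 1) {μ : Measure ℝ} [IsFiniteMeasure μ] {C : ℝ}
    (hC : ∀ ξ : ℝ, ξ ≠ 0 → ‖measureFourier μ ξ‖ ≤ C * |ξ| ^ (-a)) (hq : 0 < q)
    (hc : 0 < c) (k : ℤ) :
    ‖c * 𝓕 (rescale f hq.ne' 0) (k * c) * measureFourier μ (k * c)‖ ≤
      (if k = 0 then D * (c / q * μ.real univ) else 0) +
        D * (C * q ^ (-a) * (c / q) ^ (-η)) * |(k : ℝ)| ^ (-(1 + η)) := by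
  have hD0 : 0 ≤ D := nonneg_of_forall_norm_le_mul_inv hD
  have hC0 : 0 ≤ C := by simpa using (norm_nonneg _).trans (hC 1 one_ne_zero)
  have hnorm : ‖c * 𝓕 (rescale f hq.ne' 0) (k * c) * measureFourier μ (k * c)‖ =
      c / q * (‖𝓕 f (k * c / q)‖ * ‖measureFourier μ (k * c)‖) := by
    rw [norm_mul, norm_mul, fourier_rescale f hq, norm_mul, Complex.norm_exp_ofReal_mul_I, norm_mul,
      Complex.norm_real, Complex.norm_real, Real.norm_of_nonneg hc.le,
      Real.norm_of_nonneg (inv_nonneg.2 hq.le)]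
    ring
  rw [hnorm]
  split_ifs with hk
  · have hhat : ‖𝓕 f (k * c / q)‖ ≤ D := by simpa [hk] using hD 0
    calc c / q * (‖𝓕 f (k * c / q)‖ * ‖measureFourier μ (k * c)‖)
        ≤ c / q * (D * μ.real univ) := by
          gcongr
          exact norm_measureFourier_le μ _
      _ = D * (c / q * μ.real univ) := by ring
      _ ≤ _ := le_add_of_nonneg_right (by positivity)
  · have hk0 : (k : ℝ) ≠ 0 := Int.cast_ne_zero.2 hk
    have hcq : 0 < c / q := by positivity
    calc c / q * (‖𝓕 f (k * c / q)‖ * ‖measureFourier μ (k * c)‖)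
        ≤ c / q * (D * (C * q ^ (-a)) * |k * c / q| ^ (-(1 + η))) := by
          gcongr ?_ * ?_
          exact norm_fourier_mul_measureFourier_le hD ha ha2 hη hη1 hC hq
            (mul_ne_zero hk0 hc.ne')
      _ = 0 + D * (C * q ^ (-a) * ((c / q) ^ (1 : ℝ) * (c / q) ^ (-(1 + η)))) *
            |(k : ℝ)| ^ (-(1 + η)) := by
          rw [mul_div_assoc, abs_mul, abs_of_pos hcq, Real.mul_rpow (abs_nonneg _) hcq.le,
            Real.rpow_one]
          ring
      _ = _ := by
          rw [← Real.rpow_add hcq]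
          ring_nf

theorem exists_measureReal_progressionNhd_le {a η : ℝ} (ha : 0 < a) (ha2 : a ≤ 1 / 2) (hη : 0 < η)
    (hη1 : η ≤ 1) : ∃ D : ℝ, 0 < D ∧ ∀ (μ : Measure ℝ) [IsFiniteMeasure μ] (C : ℝ),
      (∀ ξ : ℝ, ξ ≠ 0 → ‖measureFourier μ ξ‖ ≤ C * |ξ| ^ (-a)) → ∀ q c : ℝ, 0 < q → 0 < c →
      μ.real (progressionNhd q⁻¹ c univ) ≤
        D * (c / q * μ.real univ + C * q ^ (-a) * (c / q) ^ (-η)) := by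
  obtain ⟨D, hD0, hD⟩ := exists_schwartz_norm_le (𝓕 schwartzCutoff) 2
  set Z := ∑' k : ℤ, |(k : ℝ)| ^ (-(1 + η))
  have hZ : HasSum (fun k : ℤ => |(k : ℝ)| ^ (-(1 + η))) Z :=
    (Real.summable_abs_int_rpow (by linarith)).hasSum
  have _ : 0 ≤ Z := tsum_nonneg fun k => by positivity
  refine ⟨D * (1 + Z), by positivity, fun μ _ C hC q c hq hc => ?_⟩
  refine (measureReal_progressionNhd_le_integral hq hc μ).trans ?_
  rw [integral_tsum_int_div_sub _ hc]
  refine (tsum_of_norm_bounded ((hasSum_ite_eq 0 _).add (hZ.mul_left _)) fun k =>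
    norm_mul_fourier_mul_measureFourier_le hD ha ha2 hη hη1 hC hq hc k).trans ?_
  have hC0 : 0 ≤ C := by simpa using (norm_nonneg _).trans (hC 1 one_ne_zero)
  have hmass : 0 ≤ D * (c / q * μ.real univ) * Z := by positivity
  have hdecay : 0 ≤ D * (C * q ^ (-a) * (c / q) ^ (-η)) := by positivity
  linarith

end ProgressionNhd

theorem natCast_card_le_of_forall_le {S : Finset ℕ} {R : ℝ} (hR : 0 ≤ R)
    (hS : ∀ H ∈ S, 1 ≤ H ∧ (H : ℝ) ≤ R) : (S.card : ℝ) ≤ R := by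
  have hsub : S ⊆ Finset.Icc 1 ⌊R⌋₊ := fun H hH =>
    Finset.mem_Icc.2 ⟨(hS H hH).1, Nat.le_floor (hS H hH).2⟩
  have hcard := Finset.card_le_card hsub
  rw [Nat.card_Icc, Nat.add_sub_cancel] at hcard
  exact (Nat.cast_le.2 hcard).trans (Nat.floor_le hR)

theorem exists_measureReal_progressionNhd_mul_rpow_le {γ β a : ℝ} (hγ : 0 ≤ γ) (hβ : 0 ≤ β)
    (ha : γ < a) (ha2 : a ≤ 1 / 2) :
    ∃ D : ℝ, 0 < D ∧ ∀ (μ : Measure ℝ) [IsFiniteMeasure μ] (C : ℝ),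
      (∀ ξ : ℝ, ξ ≠ 0 → ‖measureFourier μ ξ‖ ≤ C * |ξ| ^ (-a)) → ∀ (q : ℝ) (H : ℕ), 1 < q →
      1 ≤ H → (H : ℝ) ≤ q ^ γ → μ.real (progressionNhd q⁻¹ (H * q ^ β) univ) ≤
        D * (q ^ (γ + β - 1) * μ.real univ + C * q ^ (-a) * q ^ ((a - γ) / 2)) := by
  obtain ⟨D, hD0, hD⟩ := exists_measureReal_progressionNhd_le (η := (a - γ) / 2)
    (hγ.trans_lt ha) ha2 (by linarith) (by linarith)
  refine ⟨D, hD0, fun μ _ C hC q H hq hH1 hHγ => ?_⟩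
  have _ : 0 ≤ C := by simpa using (norm_nonneg _).trans (hC 1 one_ne_zero)
  have hq0 : 0 < q := one_pos.trans hq
  have hHq : 1 ≤ H * q ^ β :=
    one_le_mul_of_one_le_of_one_le (by exact_mod_cast hH1) (Real.one_le_rpow hq.le hβ)
  refine (hD μ C hC q _ hq0 (one_pos.trans_le hHq)).trans ?_
  gcongr
  · calc H * q ^ β / q ≤ q ^ γ * q ^ β / q := by gcongr
      _ = q ^ (γ + β - 1) := by rw [Real.rpow_sub hq0, Real.rpow_add hq0, Real.rpow_one]
  · calc (H * q ^ β / q) ^ (-((a - γ) / 2)) ≤ q⁻¹ ^ (-((a - γ) / 2)) :=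
          Real.rpow_le_rpow_of_nonpos (inv_pos.2 hq0)
            (by rw [inv_eq_one_div]; gcongr) (by linarith)
      _ = q ^ ((a - γ) / 2) := by
          rw [Real.inv_rpow hq0.le, Real.rpow_neg hq0.le, inv_inv]

theorem exists_measureReal_univ_le_of_fourier_decay {γ β a : ℝ} (hγ : 0 ≤ γ) (hβ : 0 ≤ β)
    (ha : γ < a) (ha2 : a ≤ 1 / 2) :
    ∃ D : ℝ, ∀ (μ : Measure ℝ) [IsFiniteMeasure μ] (C : ℝ),
      (∀ ξ : ℝ, ξ ≠ 0 → ‖measureFourier μ ξ‖ ≤ C * |ξ| ^ (-a)) → ∀ (q : ℝ) (S : Finset ℕ), 1 < q →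
      (∀ H ∈ S, 1 ≤ H ∧ (H : ℝ) ≤ q ^ γ) →
      μ (⋃ H ∈ S, progressionNhd q⁻¹ (H * q ^ β) univ)ᶜ = 0 →
      μ.real univ ≤ D * μ.real univ * (S.card * q ^ (γ + β - 1)) +
        D * C * q ^ (-((a - γ) / 2)) := by
  obtain ⟨D, _, hD⟩ := exists_measureReal_progressionNhd_mul_rpow_le hγ hβ ha ha2
  refine ⟨D, fun μ _ C hC q S hq hS hμ => ?_⟩
  have _ : 0 ≤ C := by simpa using (norm_nonneg _).trans (hC 1 one_ne_zero)
  have hq0 : 0 < q := one_pos.trans hq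
  calc μ.real univ = μ.real (⋃ H ∈ S, progressionNhd q⁻¹ (H * q ^ β) univ) :=
        (measureReal_congr (ae_eq_univ.2 hμ)).symm
    _ ≤ ∑ _ ∈ S, D * (q ^ (γ + β - 1) * μ.real univ + C * q ^ (-a) * q ^ ((a - γ) / 2)) :=
        (measureReal_biUnion_finset_le _ _).trans
          (Finset.sum_le_sum fun H hH => hD μ C hC q H hq (hS H hH).1 (hS H hH).2)
    _ = D * μ.real univ * (S.card * q ^ (γ + β - 1)) +
          S.card * (D * C * (q ^ (-a) * q ^ ((a - γ) / 2))) := by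
        rw [Finset.sum_const, nsmul_eq_mul]
        ring
    _ ≤ D * μ.real univ * (S.card * q ^ (γ + β - 1)) +
          q ^ γ * (D * C * (q ^ (-a) * q ^ ((a - γ) / 2))) := by
        gcongr
        exact natCast_card_le_of_forall_le (by positivity) hS
    _ = D * μ.real univ * (S.card * q ^ (γ + β - 1)) +
          D * C * (q ^ γ * (q ^ (-a) * q ^ ((a - γ) / 2))) := by ring
    _ = _ := by
        rw [← Real.rpow_add hq0, ← Real.rpow_add hq0]
        ring_nf

theorem measure_eq_zero_of_fourier_decay {γ β : ℝ} (hγ : 0 ≤ γ) (hβ : 0 ≤ β) {q : ℕ → ℝ}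
    (hq1 : ∀ i, 1 < q i) (hq : Tendsto q atTop atTop) {S : ℕ → Finset ℕ}
    (hS : ∀ i, ∀ H ∈ S i, 1 ≤ H ∧ (H : ℝ) ≤ q i ^ γ)
    (hScard : Tendsto (fun i => (S i).card * q i ^ (γ + β - 1)) atTop (𝓝 0))
    {μ : Measure ℝ} [IsFiniteMeasure μ]
    (hμ : ∀ i, μ (⋃ H ∈ S i, progressionNhd (q i)⁻¹ (H * q i ^ β) univ)ᶜ = 0)
    {a C : ℝ} (ha : γ < a) (ha2 : a ≤ 1 / 2)
    (hC : ∀ ξ : ℝ, ξ ≠ 0 → ‖measureFourier μ ξ‖ ≤ C * |ξ| ^ (-a)) : μ = 0 := by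
  obtain ⟨D, hD⟩ := exists_measureReal_univ_le_of_fourier_decay hγ hβ ha ha2
  have hlim : Tendsto (fun i => D * μ.real univ * ((S i).card * q i ^ (γ + β - 1)) +
      D * C * q i ^ (-((a - γ) / 2))) atTop (𝓝 0) := by
    simpa using (hScard.const_mul (D * μ.real univ)).add
      (((tendsto_rpow_neg_atTop (half_pos (sub_pos.2 ha))).comp hq).const_mul (D * C))
  have hmass : μ.real univ ≤ 0 :=
    ge_of_tendsto' hlim fun i => hD μ C hC (q i) (S i) (hq1 i) (hS i) (hμ i)
  exact Measure.measure_univ_eq_zero.1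
    ((measureReal_eq_zero_iff).1 (hmass.antisymm measureReal_nonneg))

theorem tendsto_primeCounting_floor_div :
    Tendsto (fun x : ℝ => (Nat.primeCounting ⌊x⌋₊ : ℝ) / x) atTop (𝓝 0) := by
  refine squeeze_zero' ?_ ?_ (Real.tendsto_log_atTop.const_div_atTop (Real.log 4 + 1))
  · filter_upwards [eventually_ge_atTop 0] with x hx
    positivity
  · filter_upwards [Chebyshev.eventually_primeCounting_le one_pos, eventually_gt_atTop 0]
      with x hx hx0
    rw [div_le_iff₀ hx0]
    exact hx.trans_eq (by ring)

theorem card_filter_prime_Icc_one (n : ℕ) :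
    ((Finset.Icc 1 n).filter Nat.Prime).card = Nat.primeCounting n := by
  rw [Nat.primeCounting, Nat.primeCounting', Nat.count_eq_card_filter_range]
  congr 1
  ext p
  simp only [Finset.mem_filter, Finset.mem_range, Finset.mem_Icc]
  exact ⟨fun hp => ⟨by omega, hp.2⟩, fun hp => ⟨⟨hp.2.one_le, by omega⟩, hp.2⟩⟩

/-- The denominators `H` occurring in `approxSet` at the scale `q`. -/
noncomputable def allowedDenominators (γ β q : ℝ) : Finset ℕ :=
  if 2 * γ + β < 1 then Finset.Icc 1 ⌊q ^ γ⌋₊ else (Finset.Icc 1 ⌊q ^ γ⌋₊).filter Nat.Prime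

/-- The set of the `x` approximated at the scale `q`, so that `approxSet` is the intersection of
these sets over the scales. -/
noncomputable def approxStage (γ β q : ℝ) : Set ℝ :=
  ⋃ H ∈ allowedDenominators γ β q, progressionNhd q⁻¹ (H * q ^ β) univ

section ApproxSet

variable {γ β : ℝ} {q : ℕ → ℝ}

theorem bounds_of_mem_allowedDenominators {q : ℝ} (hq : 0 ≤ q) {H : ℕ}
    (hH : H ∈ allowedDenominators γ β q) : 1 ≤ H ∧ (H : ℝ) ≤ q ^ γ := by
  rw [← Nat.le_floor_iff (by positivity), ← Finset.mem_Icc]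
  unfold allowedDenominators at hH
  split_ifs at hH
  exacts [hH, Finset.filter_subset _ _ hH]

theorem approxSet_eq_iInter (hq : ∀ i, 0 ≤ q i) :
    approxSet q γ β = ⋂ i, approxStage γ β (q i) := by
  have hfloor (i H) : H ≤ ⌊q i ^ γ⌋₊ ↔ (H : ℝ) ≤ q i ^ γ :=
    Nat.le_floor_iff (Real.rpow_nonneg (hq i) γ)
  unfold approxSet approxStage allowedDenominators
  split_ifs
  · simp only [integerConstruction, Finset.mem_Icc, hfloor, mem_ofPred_eq]
  · have hprime (i) (H : ℕ) : (1 ≤ H ∧ (H : ℝ) ≤ q i ^ γ) ∧ H.Prime ↔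
        H.Prime ∧ (H : ℝ) ≤ q i ^ γ :=
      ⟨fun h => ⟨h.2, h.1.2⟩, fun h => ⟨⟨h.1.one_le, h.2⟩, h.1⟩⟩
    simp only [primeConstruction, Finset.mem_filter, Finset.mem_Icc, hfloor, hprime, mem_ofPred_eq]

theorem isCompact_approxSet_inter_Icc (hq : ∀ i, 0 ≤ q i) (a b : ℝ) :
    IsCompact (approxSet q γ β ∩ Icc a b) := by
  rw [approxSet_eq_iInter hq]
  exact isCompact_Icc.inter_left <| isClosed_iInter fun i =>
    isClosed_biUnion_finset fun _ _ => Metric.isClosed_cthickening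

/-! ### Upper bounds for the dimensions -/

/- In the endpoint case `2γ + β = 1` all integers up to `q ^ γ` would give a quantity of order `1`;
restricting to primes gains a logarithm. -/
theorem tendsto_card_allowedDenominators (hs : 2 * γ + β ≤ 1) (hlt : γ + β < 1)
    (hq0 : ∀ i, 0 < q i) (hq : Tendsto q atTop atTop) :
    Tendsto (fun i => (allowedDenominators γ β (q i)).card * q i ^ (γ + β - 1)) atTop (𝓝 0) := by
  rcases hs.lt_or_eq with h | h
  · refine squeeze_zero (fun i => ?_) (fun i => ?_)
      ((tendsto_rpow_neg_atTop (sub_pos.2 h)).comp hq)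
    · have := hq0 i
      positivity
    · calc (allowedDenominators γ β (q i)).card * q i ^ (γ + β - 1)
          ≤ q i ^ γ * q i ^ (γ + β - 1) := by
            gcongr
            · exact Real.rpow_nonneg (hq0 i).le _
            · exact natCast_card_le_of_forall_le (Real.rpow_nonneg (hq0 i).le _) fun H hH =>
                bounds_of_mem_allowedDenominators (hq0 i).le hH
        _ = q i ^ (-(1 - (2 * γ + β))) := by
            rw [← Real.rpow_add (hq0 i)]
            ring_nf
  · have hγ' : 0 < γ := by linarith
    refine (tendsto_primeCounting_floor_div.comp ((tendsto_rpow_atTop hγ').comp hq)).congr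
      fun i => ?_
    rw [allowedDenominators, if_neg h.not_lt, card_filter_prime_Icc_one,
      show γ + β - 1 = -γ by linarith, Real.rpow_neg (hq0 i).le, ← div_eq_mul_inv]
    rfl

theorem le_two_mul_of_fourier_decay (hγ : 0 ≤ γ) (hβ : 0 ≤ β) (hs : 2 * γ + β ≤ 1)
    (hlt : γ + β < 1) (hq1 : ∀ i, 1 < q i) (hq : Tendsto q atTop atTop) {t : ℝ} (ht1 : t ≤ 1)
    {μ : Measure ℝ} (hμ : IsCompactlySupportedMeasureOn μ (approxSet q γ β)) {C : ℝ}
    (hC : ∀ ξ : ℝ, ξ ≠ 0 → ‖measureFourier μ ξ‖ ≤ C * |ξ| ^ (-t / 2)) : t ≤ 2 * γ := by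
  obtain ⟨hfin, hne, K, -, hKE, hμK⟩ := hμ
  have hq0 (i : ℕ) : 0 < q i := one_pos.trans (hq1 i)
  rw [approxSet_eq_iInter fun i => (hq0 i).le] at hKE
  contrapose! hne
  exact measure_eq_zero_of_fourier_decay hγ hβ hq1 hq
    (fun i H => bounds_of_mem_allowedDenominators (hq0 i).le)
    (tendsto_card_allowedDenominators hs hlt hq0 hq)
    (fun i => measure_mono_null (compl_subset_compl.2 (hKE.trans (iInter_subset _ i))) hμK)
    (a := t / 2) (by linarith) (by linarith) (neg_div (2 : ℝ) t ▸ hC)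

theorem exists_allowedDenominators_abs_sub_le {q : ℝ} (hq : 1 ≤ q) {b x : ℝ}
    (hx : x ∈ approxStage γ β q) (hxb : |x| ≤ b) :
    ∃ H ∈ allowedDenominators γ β q, ∃ m : ℤ,
      |(m : ℝ)| ≤ (b + 2) * q ^ (γ + β) ∧ |m / (H * q ^ β) - x| ≤ 2 * q⁻¹ := by
  have hq0 : 0 < q := one_pos.trans_le hq
  obtain ⟨H, hH, hxH⟩ := mem_iUnion₂.1 hx
  obtain ⟨hH1, hHq⟩ := bounds_of_mem_allowedDenominators hq0.le hH
  obtain ⟨m, -, hm⟩ := exists_abs_sub_le_of_mem_progressionNhd (inv_pos.2 hq0) hxH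
  have _ : (0 : ℝ) < H := by exact_mod_cast hH1
  refine ⟨H, hH, m, ?_, hm⟩
  have hfrac : |m / (H * q ^ β)| ≤ b + 2 :=
    calc |m / (H * q ^ β)| ≤ |m / (H * q ^ β) - x| + |x| := by
          simpa using abs_add_le (m / (H * q ^ β) - x) x
      _ ≤ 2 * 1 + b := by
          gcongr
          exact hm.trans (by gcongr; exact inv_le_one_of_one_le₀ hq)
      _ = b + 2 := by ring
  calc |(m : ℝ)| = |m / (H * q ^ β)| * (H * q ^ β) := by
        rw [abs_div, abs_of_pos (a := H * q ^ β) (by positivity), div_mul_cancel₀ _ (by positivity)]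
    _ ≤ (b + 2) * (q ^ γ * q ^ β) := by
        gcongr
        exact (abs_nonneg _).trans hfrac
    _ = (b + 2) * q ^ (γ + β) := by rw [Real.rpow_add hq0]

theorem ediam_real_closedBall (x r : ℝ) :
    Metric.ediam (Metric.closedBall x r) = ENNReal.ofReal (2 * r) := by
  rw [Real.closedBall_eq_Icc, Real.ediam_Icc]
  ring_nf

/-- Indices `(H, m)` of the intervals about `m / (H * q ^ β)` covering the part of `approxSet` in
`[-b, b]`. -/
noncomputable def coverIndices (γ β q : ℝ) (b : ℕ) : Finset (ℕ × ℤ) :=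
  allowedDenominators γ β q ×ˢ
    Finset.Icc (-(⌊(b + 2) * q ^ (γ + β)⌋₊ : ℤ)) ⌊(b + 2) * q ^ (γ + β)⌋₊

theorem approxStage_inter_Icc_subset {q : ℝ} (hq : 1 ≤ q) (b : ℕ) :
    approxStage γ β q ∩ Icc (-(b : ℝ)) b ⊆ ⋃ p : coverIndices γ β q b,
      Metric.closedBall ((p : ℕ × ℤ).2 / ((p : ℕ × ℤ).1 * q ^ β)) (2 * q⁻¹) := by
  rintro x ⟨hx, hxb⟩
  obtain ⟨H, hH, m, hm, hmx⟩ :=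
    exists_allowedDenominators_abs_sub_le hq hx (abs_le.2 hxb)
  have hmN : |m| ≤ ⌊(b + 2) * q ^ (γ + β)⌋₊ := by
    rw [← Int.natCast_natAbs, Nat.cast_le, Nat.le_floor_iff ((abs_nonneg _).trans hm)]
    simpa [Nat.cast_natAbs] using hm
  refine mem_iUnion.2
    ⟨⟨(H, m), Finset.mem_product.2 ⟨hH, Finset.mem_Icc.2 (abs_le.1 hmN)⟩⟩, ?_⟩
  rwa [Metric.mem_closedBall', Real.dist_eq]

theorem card_coverIndices_le (hγβ : 0 ≤ γ + β) {q : ℝ} (hq : 1 ≤ q) (b : ℕ) :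
    ((coverIndices γ β q b).card : ℝ) ≤ (2 * b + 5) * q ^ (2 * γ + β) := by
  have hq0 : 0 < q := one_pos.trans_le hq
  have hH : ((allowedDenominators γ β q).card : ℝ) ≤ q ^ γ :=
    natCast_card_le_of_forall_le (by positivity) fun H hH =>
      bounds_of_mem_allowedDenominators hq0.le hH
  have hN : (⌊(b + 2) * q ^ (γ + β)⌋₊ : ℝ) ≤ (b + 2) * q ^ (γ + β) := Nat.floor_le (by positivity)
  have h1 : 1 ≤ q ^ (γ + β) := Real.one_le_rpow hq hγβ
  rw [coverIndices, Finset.card_product, Int.card_Icc, Nat.cast_mul,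
    show ((⌊(b + 2) * q ^ (γ + β)⌋₊ : ℤ) + 1 - -(⌊(b + 2) * q ^ (γ + β)⌋₊ : ℤ)).toNat =
      2 * ⌊(b + 2) * q ^ (γ + β)⌋₊ + 1 by omega]
  calc ((allowedDenominators γ β q).card : ℝ) * (2 * ⌊(b + 2) * q ^ (γ + β)⌋₊ + 1 : ℕ)
      ≤ q ^ γ * ((2 * b + 5) * q ^ (γ + β)) := by
        gcongr
        push_cast
        linarith
    _ = (2 * b + 5) * (q ^ γ * q ^ (γ + β)) := by ring
    _ = (2 * b + 5) * q ^ (2 * γ + β) := by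
        rw [← Real.rpow_add hq0]
        ring_nf

theorem sum_ediam_coverIndices_rpow_le (hγβ : 0 ≤ γ + β) {q : ℝ} (hq : 1 ≤ q) (b : ℕ) {d : ℝ}
    (hd : 0 ≤ d) :
    ∑ p : coverIndices γ β q b,
        Metric.ediam (Metric.closedBall ((p : ℕ × ℤ).2 / ((p : ℕ × ℤ).1 * q ^ β)) (2 * q⁻¹)) ^ d ≤
      ENNReal.ofReal ((2 * b + 5) * 4 ^ d * q ^ (-(d - (2 * γ + β)))) := by
  have hq0 : 0 < q := one_pos.trans_le hq
  have hterm (x : ℝ) : Metric.ediam (Metric.closedBall x (2 * q⁻¹)) ^ d =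
      ENNReal.ofReal (4 ^ d * q ^ (-d)) := by
    rw [ediam_real_closedBall, ENNReal.ofReal_rpow_of_nonneg (by positivity) hd,
      show 2 * (2 * q⁻¹) = 4 * q⁻¹ by ring, Real.mul_rpow (by norm_num) (by positivity),
      Real.inv_rpow hq0.le, ← Real.rpow_neg hq0.le]
  simp only [hterm]
  rw [Finset.sum_const, nsmul_eq_mul, Finset.card_univ, Fintype.card_coe, ← ENNReal.ofReal_natCast,
    ← ENNReal.ofReal_mul (by positivity)]
  refine ENNReal.ofReal_le_ofReal ?_
  calc (coverIndices γ β q b).card * (4 ^ d * q ^ (-d))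
      ≤ (2 * b + 5) * q ^ (2 * γ + β) * (4 ^ d * q ^ (-d)) := by
        gcongr
        exact card_coverIndices_le hγβ hq b
    _ = (2 * b + 5) * 4 ^ d * (q ^ (2 * γ + β) * q ^ (-d)) := by ring
    _ = (2 * b + 5) * 4 ^ d * q ^ (-(d - (2 * γ + β))) := by
        rw [← Real.rpow_add hq0]
        ring_nf

theorem hausdorffMeasure_approxSet_inter_Icc (hγβ : 0 ≤ γ + β) (hq1 : ∀ i, 1 < q i)
    (hq : Tendsto q atTop atTop) (b : ℕ) {d : ℝ} (hd0 : 0 ≤ d) (hd : 2 * γ + β < d) :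
    Measure.hausdorffMeasure d (approxSet q γ β ∩ Icc (-(b : ℝ)) b) = 0 := by
  have hsum : Tendsto (fun i => ENNReal.ofReal
      ((2 * b + 5) * 4 ^ d * q i ^ (-(d - (2 * γ + β))))) atTop (𝓝 0) := by
    simpa using ENNReal.tendsto_ofReal
      (((tendsto_rpow_neg_atTop (sub_pos.2 hd)).comp hq).const_mul ((2 * b + 5) * 4 ^ d : ℝ))
  have hdiam : Tendsto (fun i => ENNReal.ofReal (2 * (2 * (q i)⁻¹))) atTop (𝓝 0) := by
    simpa using ENNReal.tendsto_ofReal ((hq.inv_tendsto_atTop.const_mul 2).const_mul 2)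
  have hcover (i : ℕ) : approxSet q γ β ∩ Icc (-(b : ℝ)) b ⊆ _ :=
    (inter_subset_inter_left _ (by
      rw [approxSet_eq_iInter fun i => (one_pos.trans (hq1 i)).le]
      exact iInter_subset _ i)).trans (approxStage_inter_Icc_subset (hq1 i).le b)
  refine nonpos_iff_eq_zero.1 ((Measure.hausdorffMeasure_le_liminf_sum d _ _ hdiam _
    (.of_forall fun i p => (ediam_real_closedBall ..).le) (.of_forall hcover)).trans ?_)
  exact (tendsto_of_tendsto_of_tendsto_of_le_of_le tendsto_const_nhds hsum (fun _ => zero_le)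
    fun i => sum_ediam_coverIndices_rpow_le hγβ (hq1 i).le b hd0).liminf_eq.le

theorem dimH_approxSet_le (hγ : 0 ≤ γ) (hβ : 0 ≤ β) (hq1 : ∀ i, 1 < q i)
    (hq : Tendsto q atTop atTop) : dimH (approxSet q γ β) ≤ ENNReal.ofReal (2 * γ + β) := by
  have hunion : approxSet q γ β = ⋃ n : ℕ, approxSet q γ β ∩ Icc (-(n : ℝ)) n := by
    refine (iUnion_subset fun n => inter_subset_left).antisymm' fun x hx => ?_
    obtain ⟨n, hn⟩ := exists_nat_ge |x|
    exact mem_iUnion.2 ⟨n, hx, abs_le.1 hn⟩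
  rw [hunion, dimH_iUnion]
  refine iSup_le fun n => le_of_forall_gt_imp_ge_of_dense fun d hd => ?_
  induction d with
  | top => exact le_top
  | coe d =>
    refine dimH_le_of_hausdorffMeasure_ne_top (ne_of_eq_of_ne ?_ ENNReal.zero_ne_top)
    refine hausdorffMeasure_approxSet_inter_Icc (add_nonneg hγ hβ) hq1 hq n d.coe_nonneg ?_
    rwa [← ENNReal.ofReal_coe_nnreal, ENNReal.ofReal_lt_ofReal_iff_of_nonneg (by positivity)] at hd

end ApproxSet

/-! ### The mass distribution principle -/

theorem measure_le_mul_ediam_rpow {X : Type*} [PseudoMetricSpace X] [MeasurableSpace X]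
    {ν : Measure X} {d : ℝ} {D : ENNReal} (hD : D ≠ ⊤) (hball : ∀ (x : X) (r : ℝ), 0 < r → r ≤ 1 →
      ν (Metric.closedBall x r) ≤ D * ENNReal.ofReal r ^ d)
    {s : Set X} (hs : Metric.ediam s < 1) : ν s ≤ D * Metric.ediam s ^ d := by
  rcases s.eq_empty_or_nonempty with rfl | ⟨x, hx⟩
  · simp
  have hcont : Continuous fun r : ENNReal => D * r ^ d :=
    (ENNReal.continuous_const_mul hD).comp ENNReal.continuous_rpow_const
  have : (𝓝[>] Metric.ediam s).NeBot := nhdsGT_neBot_of_exists_gt ⟨1, hs⟩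
  have hlim : Tendsto (fun r => D * r ^ d) (𝓝[>] Metric.ediam s) (𝓝 (D * Metric.ediam s ^ d)) :=
    (hcont.tendsto _).mono_left nhdsWithin_le_nhds
  refine ge_of_tendsto hlim ?_
  filter_upwards [Ioo_mem_nhdsGT hs] with r hr
  have hrtop : r ≠ ⊤ := hr.2.ne_top
  have hr0 : 0 < r.toReal := ENNReal.toReal_pos (pos_of_gt hr.1).ne' hrtop
  have hsub : s ⊆ Metric.closedBall x r.toReal := fun y hy => by
    rw [Metric.mem_closedBall, ← edist_le_ofReal hr0.le, ENNReal.ofReal_toReal hrtop]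
    exact (Metric.edist_le_ediam_of_mem hy hx).trans hr.1.le
  simpa only [ENNReal.ofReal_toReal hrtop] using
    (measure_mono hsub).trans (hball x _ hr0 (ENNReal.toReal_mono ENNReal.one_ne_top hr.2.le))

section MassDistribution

variable {X : Type*} [MetricSpace X] [MeasurableSpace X] [BorelSpace X]

theorem le_dimH_of_measure_closedBall_le {ν : Measure X} {E : Set X} (hE : ν E ≠ 0) {d : NNReal}
    {D : ENNReal} (hD : D ≠ ⊤) (hball : ∀ (x : X) (r : ℝ), 0 < r → r ≤ 1 →
      ν (Metric.closedBall x r) ≤ D * ENNReal.ofReal r ^ (d : ℝ)) :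
    (d : ENNReal) ≤ dimH E := by
  have hle : D⁻¹ • ν ≤ Measure.hausdorffMeasure (d : ℝ) :=
    Measure.le_hausdorffMeasure _ _ 2⁻¹ (by simp) fun s hs => by
      rw [Measure.smul_apply, smul_eq_mul, mul_comm, ← div_eq_mul_inv]
      exact ENNReal.div_le_of_le_mul'
        (measure_le_mul_ediam_rpow hD hball (hs.trans_lt ENNReal.one_half_lt_one))
  refine le_dimH_of_hausdorffMeasure_ne_zero fun h0 => ?_
  have hzero : D⁻¹ * ν E = 0 := le_zero_iff.1 ((hle E).trans_eq h0)
  exact (mul_ne_zero (ENNReal.inv_ne_zero.2 hD) hE) hzero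

theorem ofReal_le_dimH_of_measureReal_closedBall_le {ν : Measure X} [IsFiniteMeasure ν]
    {E : Set X} (hE : ν E ≠ 0) {s : ℝ}
    (hball : ∀ ε : ℝ, 0 < ε → ∃ C : ℝ, ∀ (x : X) (r : ℝ), 0 < r → r ≤ 1 →
      ν.real (Metric.closedBall x r) ≤ C * r ^ (s - ε)) :
    ENNReal.ofReal s ≤ dimH E := by
  refine le_of_forall_lt fun c hc => ?_
  obtain ⟨d, hcd, hds⟩ := ENNReal.lt_iff_exists_nnreal_btwn.1 hc
  rw [← ENNReal.ofReal_coe_nnreal, ENNReal.ofReal_lt_ofReal_iff_of_nonneg d.coe_nonneg] at hds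
  obtain ⟨C, hC⟩ := hball (s - d) (sub_pos.2 hds)
  refine hcd.trans_le (le_dimH_of_measure_closedBall_le hE (ENNReal.ofReal_ne_top (r := C))
    fun x r hr hr1 => ?_)
  rw [ENNReal.ofReal_rpow_of_pos hr, ← ENNReal.ofReal_mul' (by positivity), ← ofReal_measureReal]
  exact ENNReal.ofReal_le_ofReal (by simpa using hC x r hr hr1)

end MassDistribution

/-! ### Dimensions and the limit measure -/

theorem norm_measureFourier_le_of_one_le_abs {μ : Measure ℝ} [IsFiniteMeasure μ] {a C : ℝ}
    (ha : a ≤ 0) (hC : ∀ ξ : ℝ, 1 ≤ |ξ| → ‖measureFourier μ ξ‖ ≤ C * |ξ| ^ a) {ξ : ℝ}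
    (hξ : ξ ≠ 0) : ‖measureFourier μ ξ‖ ≤ max C (μ.real univ) * |ξ| ^ a := by
  rcases le_total 1 |ξ| with h | h
  · exact (hC ξ h).trans (by gcongr; exact le_max_left _ _)
  · calc ‖measureFourier μ ξ‖ ≤ μ.real univ * 1 := by simpa using norm_measureFourier_le μ ξ
      _ ≤ max C (μ.real univ) * |ξ| ^ a := by
          gcongr
          · exact le_max_right _ _
          · exact Real.one_le_rpow_of_pos_of_le_one_of_nonpos (abs_pos.2 hξ) h ha

theorem le_fourierDim_of_norm_measureFourier_le {E : Set ℝ} {μ : Measure ℝ}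
    (hμ : IsCompactlySupportedMeasureOn μ E) {s : ℝ} (hs : s ≤ 1)
    (hdecay : ∀ ε : ℝ, 0 < ε → ∃ C : ℝ, ∀ ξ : ℝ, 1 ≤ |ξ| →
      ‖measureFourier μ ξ‖ ≤ C * |ξ| ^ (-(s / 2) + ε)) : s ≤ fourierDim E := by
  have := hμ.1
  refine le_of_forall_lt_imp_le_of_dense fun t ht => (le_max_left t 0).trans <|
    le_csSup ⟨1, fun _ h => h.1⟩ ⟨max_le (ht.le.trans hs) zero_le_one, μ, hμ, ?_⟩
  rcases le_total t 0 with ht0 | ht0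
  · refine ⟨μ.real univ, fun ξ _ => ?_⟩
    simpa [max_eq_right ht0] using norm_measureFourier_le μ ξ
  · obtain ⟨C, hC⟩ := hdecay ((s - t) / 2) (half_pos (sub_pos.2 ht))
    rw [show -(s / 2) + (s - t) / 2 = -t / 2 by ring] at hC
    rw [max_eq_left ht0]
    exact ⟨_, fun ξ => norm_measureFourier_le_of_one_le_abs (by linarith) hC⟩

theorem fourierDim_approxSet_le {γ β : ℝ} (hγ : 0 ≤ γ) (hβ : 0 ≤ β) (hs : 2 * γ + β ≤ 1)
    (hlt : γ + β < 1) {q : ℕ → ℝ} (hq1 : ∀ i, 1 < q i) (hq : Tendsto q atTop atTop) :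
    fourierDim (approxSet q γ β) ≤ 2 * γ :=
  Real.sSup_le (fun _ ⟨ht1, _, hμ, _, hC⟩ =>
    le_two_mul_of_fourier_decay hγ hβ hs hlt hq1 hq ht1 hμ hC) (by positivity)

theorem denominators_subset_allowedDenominators {γ β q : ℝ} (hγ : 0 ≤ γ) (hlt : γ + β < 1)
    (hq : 0 < q) : denominators γ q ⊆ allowedDenominators γ β q := by
  intro p hp
  have hle : p ∈ Finset.Icc 1 ⌊q ^ γ⌋₊ := Finset.mem_Icc.2
    ⟨pos_of_mem_denominators hp, Nat.le_floor (denominators_bounds hγ hq hp).2⟩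
  unfold allowedDenominators
  split_ifs with h
  · exact hle
  · have hγ' : 0 < γ := by linarith
    exact Finset.mem_filter.2 ⟨hle, ((mem_denominators_of_pos hγ' hq).1 hp).1⟩

theorem stageSet_subset_approxStage {γ β q : ℝ} (hγ : 0 ≤ γ) (hlt : γ + β < 1) (hq : 0 < q) :
    stageSet γ β q ⊆ approxStage γ β q :=
  biUnion_mono (denominators_subset_allowedDenominators hγ hlt hq) fun _ _ =>
    Metric.cthickening_subset_of_subset _ (image_mono (subset_univ _))

theorem stageSet_subset_of_pos {γ β q : ℝ} (hγ : 0 < γ) (hq : 0 < q) :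
    stageSet γ β q ⊆ ⋃ p ∈ {p : ℕ | p.Prime ∧ q ^ γ / 2 ≤ (p : ℝ) ∧ (p : ℝ) ≤ q ^ γ},
      progressionNhd q⁻¹ (p * q ^ β) {m : ℤ | ¬ (p : ℤ) ∣ m} :=
  biUnion_mono (fun _ hp => (mem_denominators_of_pos hγ hq).1 hp) fun _ hp =>
    Metric.cthickening_subset_of_subset _ <| image_mono fun m hm =>
      (int_gcd_eq_one_iff_of_prime hp.1 m).1 hm

namespace IsLimitMeasure

variable {γ β : ℝ} {q : ℕ → ℝ} {ν : Measure ℝ}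

theorem compl_iInter_inter_Icc (h : IsLimitMeasure γ β q ν) {T : ℕ → Set ℝ}
    (hT : ∀ i, stageSet γ β (q i) ⊆ T i) : ν ((⋂ i, T i) ∩ Icc 0 1)ᶜ = 0 := by
  rw [compl_inter, compl_iInter]
  exact measure_union_null (measure_iUnion_null fun i =>
    measure_mono_null (compl_subset_compl.2 (hT i)) (h.compl_stageSet i)) h.compl_Icc

theorem compl_reducedPrimeConstruction (h : IsLimitMeasure γ β q ν) (hγ : 0 < γ)
    (hq : ∀ i, 0 < q i) : ν (reducedPrimeConstruction q γ β)ᶜ = 0 :=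
  h.compl_iInter_inter_Icc fun i => stageSet_subset_of_pos hγ (hq i)

theorem compl_approxSet_inter_Icc (h : IsLimitMeasure γ β q ν) (hγ : 0 ≤ γ)
    (hlt : γ + β < 1) (hq : ∀ i, 0 < q i) :
    ν (approxSet q γ β ∩ Icc 0 1)ᶜ = 0 := by
  rw [approxSet_eq_iInter fun i => (hq i).le]
  exact h.compl_iInter_inter_Icc fun i => stageSet_subset_approxStage hγ hlt (hq i)

theorem isCompactlySupportedMeasureOn_approxSet (h : IsLimitMeasure γ β q ν) (hγ : 0 ≤ γ)
    (hlt : γ + β < 1) (hq : ∀ i, 0 < q i) :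
    IsCompactlySupportedMeasureOn ν (approxSet q γ β) :=
  have := h.isProbabilityMeasure
  ⟨inferInstance, IsProbabilityMeasure.ne_zero ν, _,
    isCompact_approxSet_inter_Icc (fun i => (hq i).le) 0 1, inter_subset_left,
    h.compl_approxSet_inter_Icc hγ hlt hq⟩

theorem dimH_approxSet (h : IsLimitMeasure γ β q ν) (hγ : 0 ≤ γ) (hβ : 0 ≤ β)
    (hlt : γ + β < 1) (hq1 : ∀ i, 1 < q i) (hq : Tendsto q atTop atTop) :
    dimH (approxSet q γ β) = ENNReal.ofReal (2 * γ + β) := by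
  have := h.isProbabilityMeasure
  have hsupp : ν (approxSet q γ β)ᶜ = 0 :=
    measure_mono_null (compl_subset_compl.2 inter_subset_left)
      (h.compl_approxSet_inter_Icc hγ hlt fun i => one_pos.trans (hq1 i))
  have hmass : ν (approxSet q γ β) = 1 := (measure_congr (ae_eq_univ.2 hsupp)).trans measure_univ
  exact (dimH_approxSet_le hγ hβ hq1 hq).antisymm
    (ofReal_le_dimH_of_measureReal_closedBall_le (hmass.trans_ne one_ne_zero) h.ball)

theorem fourierDim_approxSet (h : IsLimitMeasure γ β q ν) (hγ : 0 ≤ γ) (hβ : 0 ≤ β)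
    (hs : 2 * γ + β ≤ 1) (hlt : γ + β < 1) (hq1 : ∀ i, 1 < q i) (hq : Tendsto q atTop atTop) :
    fourierDim (approxSet q γ β) = 2 * γ :=
  (fourierDim_approxSet_le hγ hβ hs hlt hq1 hq).antisymm <|
    le_fourierDim_of_norm_measureFourier_le
      (h.isCompactlySupportedMeasureOn_approxSet hγ hlt fun i => one_pos.trans (hq1 i))
      (by linarith) (by simpa using h.fourier)

theorem dirac : IsLimitMeasure 0 0 q (Measure.dirac 0) where
  isProbabilityMeasure := inferInstance
  compl_Icc := by simp
  compl_stageSet i := by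
    rw [Measure.dirac_apply' _ (isClosed_stageSet _ _ _).measurableSet.compl]
    refine indicator_of_notMem (notMem_compl_iff.2 ?_) _
    exact mem_biUnion (x := 1) (by simp [denominators])
      (Metric.self_subset_cthickening _ ⟨0, by simp, by simp⟩)
  ball ε hε := ⟨1, fun x r hr hr1 => by
    rw [one_mul]
    exact measureReal_le_one.trans
      (Real.one_le_rpow_of_pos_of_le_one_of_nonpos hr hr1 (by linarith))⟩
  fourier ε hε := ⟨1, fun ξ hξ => by
    rw [one_mul]
    exact (norm_measureFourier_le _ ξ).trans
      (probReal_univ.trans_le (Real.one_le_rpow hξ (by linarith)))⟩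

end IsLimitMeasure

theorem exists_isLacunary : ∃ q, IsLacunary q := by
  let q : ℕ → ℝ := Nat.rec 2 fun i x => x ^ (10 * (i + 1)) + 1
  have hq (i : ℕ) : q (i + 1) = q i ^ (10 * (i + 1)) + 1 := rfl
  refine ⟨q, fun i => ?_, fun i => hq i ▸ lt_add_one _⟩
  induction i with
  | zero => exact le_rfl
  | succ i ih =>
    calc (2 : ℝ) ≤ q i := ih
      _ ≤ q i ^ (10 * (i + 1)) := le_self_pow₀ (one_le_two.trans ih) (by omega)
      _ ≤ q (i + 1) := (lt_add_one _).le

theorem exists_isLacunary_isLimitMeasure {γ β : ℝ} (hγ : 0 ≤ γ) (hβ : 0 ≤ β)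
    (hs : 2 * γ + β ≤ 1) : ∃ q ν, IsLacunary q ∧ IsLimitMeasure γ β q ν := by
  rcases (add_nonneg hγ hβ).eq_or_lt with h | h
  · obtain ⟨rfl, rfl⟩ : γ = 0 ∧ β = 0 := (add_eq_zero_iff_of_nonneg hγ hβ).1 h.symm
    obtain ⟨q, hq⟩ := exists_isLacunary
    exact ⟨q, _, hq, .dirac⟩
  · obtain ⟨q, g, hqg⟩ := exists_densitySequence hγ hβ h hs
    obtain ⟨ν, hν⟩ := hqg.exists_isLimitMeasure hγ hβ hs
    exact ⟨_, ν, hqg.isLacunary.shift, hν⟩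

theorem theorem1p4 (β γ : ℝ) (hβ : 0 ≤ β) (hγ : 0 ≤ γ) (hsum : 2 * γ + β ≤ 1)
    (hlt : γ + β < 1) :
    ∃ q : ℕ → ℝ, StrictMono q ∧ (∀ i, 1 < q i) ∧
      (∀ i, q i ^ (10 * (i + 1)) < q (i + 1)) ∧
      dimH (approxSet q γ β) = ENNReal.ofReal (2 * γ + β) ∧
      fourierDim (approxSet q γ β) = 2 * γ ∧
      ∃ μ : Measure ℝ, IsFiniteMeasure μ ∧ μ ≠ 0 ∧
        μ (approxSet q γ β ∩ Set.Icc 0 1)ᶜ = 0 ∧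
        (0 < γ → μ (reducedPrimeConstruction q γ β)ᶜ = 0) ∧
        (∀ ε : ℝ, 0 < ε → ∃ C : ℝ, ∀ x r : ℝ, 0 < r → r ≤ 1 →
          μ.real (Metric.closedBall x r) ≤ C * r ^ (2 * γ + β - ε)) ∧
        (∀ ε : ℝ, 0 < ε → ∃ C : ℝ, ∀ ξ : ℝ, 1 ≤ |ξ| →
          ‖measureFourier μ ξ‖ ≤ C * |ξ| ^ (-γ + ε)) := by
  obtain ⟨q, ν, hq, hν⟩ := exists_isLacunary_isLimitMeasure hγ hβ hsum
  have hprob := hν.isProbabilityMeasure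
  exact ⟨q, hq.strictMono, hq.one_lt, hq.growth,
    hν.dimH_approxSet hγ hβ hlt hq.one_lt hq.tendsto_atTop,
    hν.fourierDim_approxSet hγ hβ hsum hlt hq.one_lt hq.tendsto_atTop,
    ν, inferInstance, IsProbabilityMeasure.ne_zero ν,
    hν.compl_approxSet_inter_Icc hγ hlt hq.pos,
    fun hγ' => hν.compl_reducedPrimeConstruction hγ' hq.pos, hν.ball, hν.fourier⟩
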